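/- Let $n\ge 1$, $\gamma<0$, and let $0<p<\infty$ if $n\in\{1,2\}$, $0<p<4/(n-2)$ if $n\ge 3$. Let $V:\mathbb R^n\to\mathbb R$ satisfy $V\in L^q(\mathbb R^n)+L^\infty(\mathbb R^n)$ for some $q\ge 1$, $q>n/2$, and $\lim_{|x|\to\infty}V(x)=0$. For $E>0$ a coherent state with parameter $E$ is a $\phi\in H^1(\mathbb R^n;\mathbb C)$ that solves $$(-\Delta+V+E)\phi+\gamma|\phi|^p\phi=0\quad\text{in } H^{-1}(\mathbb R^n),$$ and $Q(\phi)=\frac12\int_{\mathbb R^n}|\phi|^2\,dx$. A $C^1$ branch of coherent states over an open interval $I\subseteq(0,\infty)$ is a map $I\ni E\mapsto\phi_E\in H^1(\mathbb R^n;\mathbb C)$ that is $C^1$ for the real Hilbert space structure of $H^1$ and such that $\phi_E$ is a coherent state with parameter $E$ for every $E\in I$. (i) Let $0<E_*<\infty$, $E_*\in\overline I$. If a $C^1$ branch over $I$ satisfies $\|\phi_E\|_{H^1}\to\infty$ as $E\to E_*$, $E\in I$, then, as $E\to E_*$, $E\in I$, $$Q(\phi_E)\to\infty,\qquad \frac{\|\phi_E\|_{L^{p+2}}^{p+2}}{Q(\phi_E)}\to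 0.$$ (ii) Assume in addition that the distribution $x\cdot\nabla V$ belongs to $L^{r}(\mathbb R^n)+L^\infty(\mathbb R^n)$ for some $r\ge 1$, $r>n/2$. If a $C^1$ branch over $(E_1,\infty)$, $E_1\ge 0$, is not identically zero for all large $E$, then there exists $b>0$ such that, as $E\to\infty$, $$\frac{\|\phi_E\|_{L^{p+2}}^{p+2}}{E^{2/p+1-n/2}}\to b,\qquad \frac{Q(\phi_E)}{E^{2/p-n/2}}\to -\gamma\,\frac{(2-n)p+4}{4p+8}\,b,\qquad \frac{\|\nabla\phi_E\|_{L^2}^2}{E^{2/p+1-n/2}}\to -\gamma\,\frac{np}{2p+4}\,b.$$ -/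

import Mathlib

open MeasureTheory Filter Topology
open scoped ENNReal ContDiff

noncomputable section

/-- `ℝⁿ` with its Euclidean structure. -/
abbrev Space (n : ℕ) : Type := EuclideanSpace ℝ (Fin n)

/-- Real-valued test functions, i.e. elements of `C_c^∞(ℝⁿ)`. -/
def IsTestFunction {n : ℕ} (η : Space n → ℝ) : Prop :=
  ContDiff ℝ ∞ η ∧ HasCompactSupport η

/-- The `i`-th partial derivative of a real-valued function on `ℝⁿ`. -/
def partialDeriv {n : ℕ} (i : Fin n) (η : Space n → ℝ) (x : Space n) : ℝ :=
  fderiv ℝ η x (EuclideanSpace.single i 1)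

/-- `v` is the weak (distributional) gradient of `u`: for every test function `η` and every `i`,
`∫ (∂ᵢη) u = - ∫ η vᵢ`. -/
def HasWeakGradient {n : ℕ} (u : Space n → ℂ) (v : Space n → EuclideanSpace ℂ (Fin n)) : Prop :=
  ∀ η : Space n → ℝ, IsTestFunction η → ∀ i : Fin n,
    ∫ x, partialDeriv i η x • u x = - ∫ x, η x • v x i

/-- A bounded test weight with compact support can be integrated against any `L²` function. -/
theorem integrable_smul_of_memLp_two {n : ℕ} {η : Space n → ℝ} (hc : Continuous η)
    (hs : HasCompactSupport η) {f : Space n → ℂ} (hf : MemLp f 2 (volume : Measure (Space n))) :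
    Integrable (fun x => η x • f x) (volume : Measure (Space n)) := by
  have h1 : MemLp η 2 (volume : Measure (Space n)) := hc.memLp_of_hasCompactSupport hs
  exact memLp_one_iff_integrable.1 (hf.smul h1)

theorem IsTestFunction.continuous_partialDeriv {n : ℕ} {η : Space n → ℝ} (h : IsTestFunction η)
    (i : Fin n) : Continuous (partialDeriv i η) :=
  (h.1.continuous_fderiv (by simp)).clm_apply continuous_const

theorem IsTestFunction.hasCompactSupport_partialDeriv {n : ℕ} {η : Space n → ℝ}
    (h : IsTestFunction η) (i : Fin n) : HasCompactSupport (partialDeriv i η) :=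
  h.2.fderiv_apply ℝ (EuclideanSpace.single i 1)

theorem memLp_coord {n : ℕ} {v : Space n → EuclideanSpace ℂ (Fin n)}
    (hv : MemLp v 2 (volume : Measure (Space n))) (i : Fin n) :
    MemLp (fun x => v x i) 2 (volume : Measure (Space n)) :=
  (EuclideanSpace.proj i : EuclideanSpace ℂ (Fin n) →L[ℂ] ℂ).comp_memLp' hv

theorem HasWeakGradient.congr {n : ℕ} {u u' : Space n → ℂ}
    {v v' : Space n → EuclideanSpace ℂ (Fin n)} (h : HasWeakGradient u v)
    (hu : u' =ᵐ[volume] u) (hv : v' =ᵐ[volume] v) : HasWeakGradient u' v' := by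
  intro η hη i
  have e1 : ∫ x, partialDeriv i η x • u' x = ∫ x, partialDeriv i η x • u x :=
    integral_congr_ae (by filter_upwards [hu] with x hx; rw [hx])
  have e2 : ∫ x, η x • v' x i = ∫ x, η x • v x i :=
    integral_congr_ae (by filter_upwards [hv] with x hx; rw [hx])
  rw [e1, e2, h η hη i]

/-- The complex Sobolev space `H¹(ℝⁿ) = W^{1,2}(ℝⁿ; ℂ)`, with its real Hilbert space structure:
pairs `(u, ∇u)` with `u ∈ L²(ℝⁿ; ℂ)` and weak gradient `∇u ∈ L²(ℝⁿ; ℂⁿ)`, normed by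
`‖u‖_{H¹}² = ‖u‖_{L²}² + ‖∇u‖_{L²}²`. -/
def H1 (n : ℕ) :
    Submodule ℝ (WithLp 2 (Lp ℂ 2 (volume : Measure (Space n)) ×
      Lp (EuclideanSpace ℂ (Fin n)) 2 (volume : Measure (Space n)))) where
  carrier := {w | HasWeakGradient (w.fst : Space n → ℂ)
    (w.snd : Space n → EuclideanSpace ℂ (Fin n))}
  zero_mem' := by
    have h : HasWeakGradient (fun _ : Space n => (0 : ℂ)) (fun _ => 0) := by
      intro η _ i
      simp
    exact h.congr (Lp.coeFn_zero _ _ _) (Lp.coeFn_zero _ _ _)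
  add_mem' := by
    intro a b ha hb
    have h : HasWeakGradient (fun x : Space n => a.fst x + b.fst x)
        (fun x => a.snd x + b.snd x) := by
      intro η hη i
      have hd := hη.continuous_partialDeriv i
      have hd' := hη.hasCompactSupport_partialDeriv i
      have hc := hη.1.continuous
      simp only [smul_add, PiLp.add_apply]
      rw [integral_add (integrable_smul_of_memLp_two hd hd' (Lp.memLp a.fst))
          (integrable_smul_of_memLp_two hd hd' (Lp.memLp b.fst)),
        integral_add (integrable_smul_of_memLp_two hc hη.2 (memLp_coord (Lp.memLp a.snd) i))
          (integrable_smul_of_memLp_two hc hη.2 (memLp_coord (Lp.memLp b.snd) i)),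
        ha η hη i, hb η hη i, neg_add]
    exact h.congr (Lp.coeFn_add _ _) (Lp.coeFn_add _ _)
  smul_mem' := by
    intro c a ha
    have h : HasWeakGradient (fun x : Space n => c • a.fst x) (fun x => c • a.snd x) := by
      intro η hη i
      simp only [PiLp.smul_apply]
      simp_rw [fun x => smul_comm (partialDeriv i η x) c (a.fst x),
        fun x => smul_comm (η x) c (a.snd x i)]
      rw [integral_smul, integral_smul, ha η hη i, smul_neg]
    exact h.congr (Lp.coeFn_smul _ _) (Lp.coeFn_smul _ _)

namespace H1

variable {n : ℕ}

/-- The function underlying an element of `H¹(ℝⁿ)`. -/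
def val (φ : H1 n) : Space n → ℂ := φ.1.fst

/-- The weak gradient of an element of `H¹(ℝⁿ)`. -/
def grad (φ : H1 n) : Space n → EuclideanSpace ℂ (Fin n) := φ.1.snd

end H1

/-- `f ∈ L^q(ℝⁿ) + L^∞(ℝⁿ)`. -/
def MemLqAddLinfty {n : ℕ} (q : ℝ) (f : Space n → ℝ) : Prop :=
  ∃ f₁ f₂ : Space n → ℝ, MemLp f₁ (ENNReal.ofReal q) (volume : Measure (Space n)) ∧
    MemLp f₂ ⊤ (volume : Measure (Space n)) ∧ f = f₁ + f₂

/-- `W = x · ∇V` in the sense of distributions: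
`∫ W η = - ∫ V div(x η) = - ∫ V (x · ∇η + n η)` for every test function `η`. -/
def IsRadialDerivative {n : ℕ} (V W : Space n → ℝ) : Prop :=
  ∀ η : Space n → ℝ, IsTestFunction η →
    ∫ x, W x * η x = - ∫ x, V x * (fderiv ℝ η x x + n * η x)

/-- `φ ∈ H¹(ℝⁿ)` is a coherent state with parameter `E`: the equation
`(-Δ + V + E) φ + γ |φ|^p φ = 0` holds in `H⁻¹(ℝⁿ)`, i.e. when paired with any `v ∈ H¹(ℝⁿ)`. -/
def IsCoherentState {n : ℕ} (V : Space n → ℝ) (γ p E : ℝ) (φ : H1 n) : Prop :=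
  ∀ v : H1 n,
    (∫ x, inner ℂ (H1.grad v x) (H1.grad φ x))
      + (∫ x, ((V x + E : ℝ) : ℂ) * (H1.val φ x * star (H1.val v x)))
      + (γ : ℂ) * (∫ x, ((‖H1.val φ x‖ ^ p : ℝ) : ℂ) * (H1.val φ x * star (H1.val v x))) = 0

/-- A `C¹` branch of coherent states, parametrized by `E` in an open interval `I ⊆ (0, ∞)`:
a `C¹` map `E ↦ φ_E` from `I` to the real Hilbert space `H¹(ℝⁿ)`, each `φ_E` being a coherent
state with parameter `E`. -/
structure IsC1Branch {n : ℕ} (V : Space n → ℝ) (γ p : ℝ) (I : Set ℝ) (φ : ℝ → H1 n) : Prop where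
  isOpen : IsOpen I
  ordConnected : I.OrdConnected
  pos : I ⊆ Set.Ioi 0
  contDiffOn : ContDiffOn ℝ 1 φ I
  coherent : ∀ E ∈ I, IsCoherentState V γ p E (φ E)

/-- The conserved charge `Q(φ) = ½ ∫ |φ|²`. -/
def charge {n : ℕ} (φ : H1 n) : ℝ := (1 / 2) * ∫ x, ‖H1.val φ x‖ ^ 2

/-- `‖φ‖_{L^{p+2}}^{p+2}`. -/
def lpPow {n : ℕ} (p : ℝ) (φ : H1 n) : ℝ := ∫ x, ‖H1.val φ x‖ ^ (p + 2)

/-- `‖∇φ‖_{L²}²`. -/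
def gradSq {n : ℕ} (φ : H1 n) : ℝ := ∫ x, ‖H1.grad φ x‖ ^ 2

end

/-!
# Charge and energy along branches of coherent states

Let `N = ‖φ_E‖_{p+2}^{p+2}`, `Q` the charge and `T = ‖∇φ_E‖²`. Three identities carry the argument.

* Testing the equations of two states of a branch against each other cancels the linear terms, and
  letting the parameters merge gives `dN/dE = (2p+4)/(-γp) Q`
  (`IsC1Branch.hasDerivAt_lpPow`). Only differentiability of the branch is used, not smoothness of
  the action: the nonlinear error is quadratic in the increment of `φ`.
* Testing the equation with `φ_E` itself gives `T + ∫ V|φ|² + 2EQ + γN = 0`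
  (`IsCoherentState.energy_identity`).
* Dilations give `T = -γ np/(2p+4) N + (1/2) ∫ W|φ|²`, where `W = x·∇V`
  (`IsCoherentState.pohozaev`). Neither regularity nor decay of `φ` is available, so `x·∇φ` is not an
  admissible test function. Instead `φ(c·)` is a competitor: the action at `φ(c·)` minus the action
  at `φ` is at least `-B (c-1)²`, because the equation kills the first order term, form compactness
  reduces the indefinite second order terms to an `L²` norm on a ball, and there dilations are
  Lipschitz. The action being differentiable in `c`, its derivative at `c = 1` vanishes.

The potential enters only through its quadratic form, which is bounded with a power rate
(`HasFormBound`) for every weight in `L^q + L^∞`, and moreover compact (`IsFormCompact`) if the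
weight vanishes at infinity.

For a finite parameter, the energy identity, form compactness and `|φ|² ≤ 1 + |φ|^{p+2}` on a ball
bound `Q` and `T` by `K (N + 1)`. With the first identity, `N` is monotone and satisfies Grönwall's
inequality, so `N` and `T` stay bounded near the limit parameter: if the `H¹` norm diverges, then `Q`
diverges and `N / Q → 0`. (The estimate `Q ≤ K (N + 1)` even shows that the norm cannot diverge at a
positive finite parameter; the deduction given here does not rest on that.)

For large parameters, the form bounds with `m = E^{1/2}` make all terms with `V` and `W` of size
`O(E^{-δ}) N`, so that `T` and `2EQ` are multiples of `N` up to that error. The first identity then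
reads `(log N)' = s/E + O(E^{-1-δ})` with `s = 2/p + 1 - n/2`, and the error is integrable.
-/

/-! ### Function-level `H¹` pairs, dilations and classical gradients -/

/-- `u ∈ L²(ℝⁿ; ℂ)` has the weak gradient `v ∈ L²(ℝⁿ; ℂⁿ)`. This is membership in `H¹` at the level
of functions, which spares the passage to almost everywhere classes. -/
structure IsSobolev {n : ℕ} (u : Space n → ℂ) (v : Space n → EuclideanSpace ℂ (Fin n)) : Prop where
  memLp : MemLp u 2 (volume : Measure (Space n))
  memLp_grad : MemLp v 2 (volume : Measure (Space n))
  hasWeakGradient : HasWeakGradient u v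

/-- The squared `H¹` norm `‖u‖_{L²}² + ‖v‖_{L²}²` of a function `u` with gradient `v`. -/
noncomputable def sobolevSq {n : ℕ} (u : Space n → ℂ) (v : Space n → EuclideanSpace ℂ (Fin n)) :
    ℝ :=
  (∫ x, ‖u x‖ ^ 2) + ∫ x, ‖v x‖ ^ 2

/-- The gradient of a differentiable function, as a vector of partial derivatives. -/
noncomputable def classicalGrad {n : ℕ} (u : Space n → ℂ) (x : Space n) :
    EuclideanSpace ℂ (Fin n) :=
  WithLp.toLp 2 fun i => fderiv ℝ u x (EuclideanSpace.single i 1)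

section Basic

variable {n : ℕ} {u u' : Space n → ℂ} {v v' : Space n → EuclideanSpace ℂ (Fin n)}

theorem sobolevSq_nonneg (u : Space n → ℂ) (v : Space n → EuclideanSpace ℂ (Fin n)) :
    0 ≤ sobolevSq u v :=
  add_nonneg (integral_nonneg fun _ => by positivity) (integral_nonneg fun _ => by positivity)

theorem integral_sq_le_sobolevSq (u : Space n → ℂ) (v : Space n → EuclideanSpace ℂ (Fin n)) :
    ∫ x, ‖u x‖ ^ 2 ≤ sobolevSq u v :=
  le_add_of_nonneg_right (integral_nonneg fun _ => by positivity)

theorem H1.isSobolev (φ : H1 n) : IsSobolev (H1.val φ) (H1.grad φ) :=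
  ⟨Lp.memLp _, Lp.memLp _, φ.2⟩

/-- Every function-level Sobolev pair is represented by an element of `H¹`. -/
theorem IsSobolev.exists_H1 (h : IsSobolev u v) :
    ∃ φ : H1 n, H1.val φ =ᵐ[volume] u ∧ H1.grad φ =ᵐ[volume] v := by
  refine ⟨⟨WithLp.toLp 2 (h.memLp.toLp u, h.memLp_grad.toLp v), ?_⟩, ?_, ?_⟩
  · exact h.hasWeakGradient.congr h.memLp.coeFn_toLp h.memLp_grad.coeFn_toLp
  · exact h.memLp.coeFn_toLp
  · exact h.memLp_grad.coeFn_toLp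

theorem IsSobolev.add (h : IsSobolev u v) (h' : IsSobolev u' v') : IsSobolev (u + u') (v + v') := by
  refine ⟨h.memLp.add h'.memLp, h.memLp_grad.add h'.memLp_grad, fun η hη i => ?_⟩
  have hd := hη.continuous_partialDeriv i
  have hd' := hη.hasCompactSupport_partialDeriv i
  have hc := hη.1.continuous
  simp only [Pi.add_apply, smul_add, PiLp.add_apply]
  rw [integral_add (integrable_smul_of_memLp_two hd hd' h.memLp)
      (integrable_smul_of_memLp_two hd hd' h'.memLp),
    integral_add (integrable_smul_of_memLp_two hc hη.2 (memLp_coord h.memLp_grad i))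
      (integrable_smul_of_memLp_two hc hη.2 (memLp_coord h'.memLp_grad i)),
    h.hasWeakGradient η hη i, h'.hasWeakGradient η hη i, neg_add]

theorem IsSobolev.neg (h : IsSobolev u v) : IsSobolev (-u) (-v) := by
  refine ⟨h.memLp.neg, h.memLp_grad.neg, fun η hη i => ?_⟩
  simp only [Pi.neg_apply, smul_neg, PiLp.neg_apply, integral_neg]
  rw [h.hasWeakGradient η hη i]

theorem IsSobolev.sub (h : IsSobolev u v) (h' : IsSobolev u' v') : IsSobolev (u - u') (v - v') := by
  simpa [sub_eq_add_neg] using h.add h'.neg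

theorem IsSobolev.integrable_sq (h : IsSobolev u v) : Integrable fun x => ‖u x‖ ^ 2 :=
  h.memLp.integrable_norm_pow (by norm_num)

theorem IsSobolev.integrable_grad_sq (h : IsSobolev u v) : Integrable fun x => ‖v x‖ ^ 2 :=
  h.memLp_grad.integrable_norm_pow (by norm_num)

theorem measurableEmbedding_smul {c : ℝ} (hc : c ≠ 0) :
    MeasurableEmbedding fun x : Space n => c • x :=
  (Homeomorph.smulOfNeZero c hc).measurableEmbedding

theorem memLp_comp_smul {F : Type*} [NormedAddCommGroup F] {f : Space n → F} {p : ℝ≥0∞} {c : ℝ}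
    (hc : c ≠ 0) (hf : MemLp f p volume) : MemLp (fun x => f (c • x)) p volume := by
  have h : MemLp f p (Measure.map (fun x : Space n => c • x) volume) := by
    rw [Measure.map_addHaar_smul _ hc]
    exact hf.smul_measure ENNReal.ofReal_ne_top
  exact (measurableEmbedding_smul hc).memLp_map_measure_iff.1 h

theorem integral_comp_smul_space {F : Type*} [NormedAddCommGroup F] [NormedSpace ℝ F]
    (f : Space n → F) {c : ℝ} (hc : 0 < c) :
    ∫ x, f (c • x) = (c ^ n)⁻¹ • ∫ x, f x := by
  rw [Measure.integral_comp_smul, finrank_euclideanSpace_fin, abs_of_nonneg (by positivity)]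

/-- Dilations preserve `H¹`, with `∇(u(c·)) = c (∇u)(c·)`. -/
theorem IsSobolev.dilate (h : IsSobolev u v) {c : ℝ} (hc : 0 < c) :
    IsSobolev (fun x => u (c • x)) (fun x => c • v (c • x)) := by
  refine ⟨memLp_comp_smul hc.ne' h.memLp, (memLp_comp_smul hc.ne' h.memLp_grad).const_smul c,
    fun η hη i => ?_⟩
  set ζ : Space n → ℝ := fun y => η (c⁻¹ • y) with hζ
  have hζt : IsTestFunction ζ := by
    refine ⟨hη.1.comp (contDiff_const_smul _), ?_⟩
    exact hη.2.comp_homeomorph (Homeomorph.smulOfNeZero c⁻¹ (inv_ne_zero hc.ne'))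
  have hd : ∀ x, partialDeriv i η x = c * partialDeriv i ζ (c • x) := by
    intro x
    have hηd : DifferentiableAt ℝ η x := hη.1.differentiable (by simp) x
    have h1 : HasFDerivAt ζ ((fderiv ℝ η x).comp (c⁻¹ • ContinuousLinearMap.id ℝ (Space n)))
        (c • x) := by
      have h2 : HasFDerivAt (fun y : Space n => c⁻¹ • y) (c⁻¹ • ContinuousLinearMap.id ℝ (Space n))
        (c • x) := (hasFDerivAt_id _).const_smul c⁻¹
      have h3 : HasFDerivAt η (fderiv ℝ η x) (c⁻¹ • c • x) := by
        rw [inv_smul_smul₀ hc.ne']; exact hηd.hasFDerivAt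
      exact h3.comp (c • x) h2
    simp only [partialDeriv, h1.fderiv, ContinuousLinearMap.comp_apply,
      smul_apply, ContinuousLinearMap.id_apply, map_smul, smul_eq_mul]
    field_simp
  have hz : ∀ x, η x = ζ (c • x) := fun x => by simp [hζ, inv_smul_smul₀ hc.ne']
  have e1 : ∫ x, partialDeriv i η x • u (c • x)
      = c • (c ^ n)⁻¹ • ∫ y, partialDeriv i ζ y • u y := by
    rw [← integral_comp_smul_space (fun y => partialDeriv i ζ y • u y) hc, ← integral_smul]
    exact integral_congr_ae (.of_forall fun x => by simp only [hd x, smul_smul])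
  have e2 : ∫ x, η x • (c • v (c • x)) i = c • (c ^ n)⁻¹ • ∫ y, ζ y • v y i := by
    rw [← integral_comp_smul_space (fun y => ζ y • v y i) hc, ← integral_smul]
    exact integral_congr_ae (.of_forall fun x => by
      simp only [hz x, PiLp.smul_apply]; exact smul_comm _ _ _)
  rw [e1, e2, h.hasWeakGradient ζ hζt i, smul_neg, smul_neg]

theorem sobolevSq_dilate (u : Space n → ℂ) (v : Space n → EuclideanSpace ℂ (Fin n)) {c : ℝ}
    (hc : 0 < c) :
    sobolevSq (fun x => u (c • x)) (fun x => c • v (c • x))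
      = (c ^ n)⁻¹ * ((∫ x, ‖u x‖ ^ 2) + c ^ 2 * ∫ x, ‖v x‖ ^ 2) := by
  have e2 : (fun x => ‖c • v (c • x)‖ ^ 2) = fun x => c ^ 2 * ‖v (c • x)‖ ^ 2 := by
    ext x
    rw [norm_smul, mul_pow, Real.norm_eq_abs, sq_abs]
  rw [sobolevSq, e2, integral_const_mul, integral_comp_smul_space (fun x => ‖u x‖ ^ 2) hc,
    integral_comp_smul_space (fun x => ‖v x‖ ^ 2) hc, smul_eq_mul, smul_eq_mul]
  ring

theorem norm_sq_classicalGrad (u : Space n → ℂ) (x : Space n) :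
    ‖classicalGrad u x‖ ^ 2 = ∑ i, ‖fderiv ℝ u x (EuclideanSpace.single i 1)‖ ^ 2 := by
  simp [classicalGrad, EuclideanSpace.norm_sq_eq]

theorem norm_fderiv_le_classicalGrad (u : Space n → ℂ) (x : Space n) :
    ‖fderiv ℝ u x‖ ≤ ‖classicalGrad u x‖ := by
  refine ContinuousLinearMap.opNorm_le_bound _ (norm_nonneg _) fun h => ?_
  have h1 : h = ∑ i, h i • (EuclideanSpace.single i 1 : Space n) := by
    ext j
    simp [Pi.single_apply]
  have h2 : ‖fderiv ℝ u x h‖ ≤ ∑ i, ‖fderiv ℝ u x (EuclideanSpace.single i 1)‖ * ‖h i‖ := by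
    conv_lhs => rw [h1, map_sum]
    refine (norm_sum_le _ _).trans (Finset.sum_le_sum fun i _ => ?_)
    rw [map_smul, norm_smul, mul_comm]
  refine h2.trans ((Real.sum_mul_le_sqrt_mul_sqrt _ _ _).trans (le_of_eq ?_))
  rw [← norm_sq_classicalGrad, ← EuclideanSpace.norm_sq_eq, Real.sqrt_sq (norm_nonneg _),
    Real.sqrt_sq (norm_nonneg _)]

theorem continuous_classicalGrad (hu : ContDiff ℝ 1 u) : Continuous (classicalGrad u) := by
  refine (PiLp.continuous_toLp 2 _).comp (continuous_pi fun i => ?_)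
  exact (hu.continuous_fderiv (by simp)).clm_apply continuous_const

theorem hasCompactSupport_classicalGrad (hs : HasCompactSupport u) :
    HasCompactSupport (classicalGrad u) := by
  refine (hs.fderiv (𝕜 := ℝ)).mono fun x hx => ?_
  rw [Function.mem_support] at hx ⊢
  contrapose! hx
  ext i
  simp [classicalGrad, hx]

theorem isSobolev_of_contDiff (hu : ContDiff ℝ 1 u) (hs : HasCompactSupport u) :
    IsSobolev u (classicalGrad u) := by
  refine ⟨hu.continuous.memLp_of_hasCompactSupport hs,
    (continuous_classicalGrad hu).memLp_of_hasCompactSupport (hasCompactSupport_classicalGrad hs),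
    fun η hη i => ?_⟩
  have hη1 : Continuous η := hη.1.continuous
  have hcd : Continuous fun x => fderiv ℝ u x (EuclideanSpace.single i 1) :=
    (hu.continuous_fderiv (by simp)).clm_apply continuous_const
  have := integral_bilinear_fderiv_right_eq_neg_left_of_integrable (μ := (volume : Measure (Space n)))
    (f := η) (g := u) (v := EuclideanSpace.single i 1)
    (B := ContinuousLinearMap.lsmul ℝ ℝ)
    (((hη.continuous_partialDeriv i).smul hu.continuous).integrable_of_hasCompactSupport
      (hs.smul_left))
    ((hη1.smul hcd).integrable_of_hasCompactSupport hη.2.smul_right)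
    ((hη1.smul hu.continuous).integrable_of_hasCompactSupport hs.smul_left)
    (fun x _ => hη.1.differentiable (by simp) x) (fun x _ => hu.differentiable (by simp) x)
  simp only [ContinuousLinearMap.lsmul_apply] at this
  simp only [classicalGrad, partialDeriv]
  rw [this, neg_neg]

end Basic

/-! ### Approximation of `H¹` functions by test functions -/

section Approximation

variable {n : ℕ}

open ContinuousLinearMap in
/-- Averaging against a probability density contracts the `L²` norm (Cauchy-Schwarz and Tonelli). -/
theorem lintegral_convolution_sq_le {F : Type*} [NormedAddCommGroup F] [NormedSpace ℝ F]
    {ρ : Space n → ℝ} (hρ : Continuous ρ) (h1 : ∫⁻ t, ‖ρ t‖ₑ = 1)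
    {u : Space n → F} (hu : AEStronglyMeasurable u volume) :
    ∫⁻ x, ‖convolution ρ u (lsmul ℝ ℝ) volume x‖ₑ ^ 2 ≤ ∫⁻ x, ‖u x‖ₑ ^ 2 := by
  have key : ∀ x, ‖convolution ρ u (lsmul ℝ ℝ) volume x‖ₑ ^ 2
      ≤ ∫⁻ t, ‖ρ t • ‖u (x - t)‖ ^ 2‖ₑ := by
    intro x
    have hux : AEStronglyMeasurable (fun t => u (x - t)) volume :=
      hu.comp_quasiMeasurePreserving (quasiMeasurePreserving_sub_left volume x)
    have hle : ‖convolution ρ u (lsmul ℝ ℝ) volume x‖ₑ ≤ ∫⁻ t, ‖ρ t‖ₑ * ‖u (x - t)‖ₑ := by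
      rw [convolution_def]
      refine (enorm_integral_le_lintegral_enorm _).trans (lintegral_mono fun t => ?_)
      rw [lsmul_apply, enorm_smul]
    have hρm : AEMeasurable (fun t => ‖ρ t‖ₑ) volume := hρ.measurable.enorm.aemeasurable
    have cs := ENNReal.lintegral_mul_norm_pow_le (μ := (volume : Measure (Space n)))
      hρm (hρm.mul (hux.enorm.pow_const 2)) (p := 1 / 2) (q := 1 / 2) (by norm_num) (by norm_num)
      (by norm_num)
    have e : ∀ t, ‖ρ t‖ₑ ^ (1 / 2 : ℝ) * ((fun t => ‖ρ t‖ₑ) * fun t => ‖u (x - t)‖ₑ ^ 2) t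
        ^ (1 / 2 : ℝ) = ‖ρ t‖ₑ * ‖u (x - t)‖ₑ := by
      intro t
      rw [Pi.mul_apply, ENNReal.mul_rpow_of_nonneg _ _ (by norm_num), ← mul_assoc,
        ← ENNReal.rpow_add_of_nonneg _ _ (by norm_num) (by norm_num), ← ENNReal.rpow_natCast,
        ← ENNReal.rpow_mul]
      norm_num
    simp only [e, h1, ENNReal.one_rpow, one_mul] at cs
    calc _ ≤ ((∫⁻ t, ((fun t => ‖ρ t‖ₑ) * fun t => ‖u (x - t)‖ₑ ^ 2) t) ^ (1 / 2 : ℝ)) ^ 2 := by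
          gcongr; exact hle.trans cs
      _ = ∫⁻ t, ((fun t => ‖ρ t‖ₑ) * fun t => ‖u (x - t)‖ₑ ^ 2) t := by
          rw [← ENNReal.rpow_natCast, ← ENNReal.rpow_mul]; norm_num
      _ = _ := by
          refine lintegral_congr fun t => ?_
          simp
  have hm : AEMeasurable (Function.uncurry fun x t : Space n => ‖ρ t • ‖u (x - t)‖ ^ 2‖ₑ)
      (volume.prod volume) := by
    have := AEStronglyMeasurable.convolution_integrand (μ := (volume : Measure (Space n)))
      (ν := (volume : Measure (Space n))) (lsmul ℝ ℝ)
      hρ.aestronglyMeasurable (hu.norm.pow 2)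
    exact this.enorm
  calc _ ≤ ∫⁻ x, ∫⁻ t, ‖ρ t • ‖u (x - t)‖ ^ 2‖ₑ := lintegral_mono key
    _ = ∫⁻ t, ∫⁻ x, ‖ρ t • ‖u (x - t)‖ ^ 2‖ₑ := lintegral_lintegral_swap hm
    _ = ∫⁻ t, ‖ρ t‖ₑ * ∫⁻ x, ‖u x‖ₑ ^ 2 := by
        refine lintegral_congr fun t => ?_
        simp only [enorm_smul]
        rw [lintegral_const_mul' _ _ enorm_ne_top]
        congr 1
        rw [← lintegral_sub_right_eq_self (fun x => ‖u x‖ₑ ^ 2) t]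
        simp
    _ = _ := by rw [lintegral_mul_const'' _ hρ.measurable.enorm.aemeasurable, h1, one_mul]

theorem lintegral_enorm_sq_eq {F : Type*} [NormedAddCommGroup F] {f : Space n → F}
    (hf : MemLp f 2 volume) : ∫⁻ x, ‖f x‖ₑ ^ 2 = ENNReal.ofReal (∫ x, ‖f x‖ ^ 2) := by
  rw [ofReal_integral_eq_lintegral_ofReal (hf.integrable_norm_pow (by norm_num))
    (.of_forall fun _ => by positivity)]
  refine lintegral_congr fun x => ?_
  rw [ENNReal.ofReal_pow (norm_nonneg _), ofReal_norm]

theorem memLp_two_of_lintegral_le {F : Type*} [NormedAddCommGroup F] {f : Space n → F} {C : ℝ≥0∞}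
    (hf : AEStronglyMeasurable f volume) (hC : C ≠ ⊤) (h : ∫⁻ x, ‖f x‖ₑ ^ 2 ≤ C) :
    MemLp f 2 volume := by
  refine ⟨hf, ?_⟩
  rw [eLpNorm_lt_top_iff_lintegral_rpow_enorm_lt_top (by norm_num) (by norm_num)]
  refine lt_of_le_of_lt (le_of_eq ?_) (h.trans_lt hC.lt_top)
  refine lintegral_congr fun x => ?_
  norm_num

theorem integral_sq_le_of_lintegral_le {F G : Type*} [NormedAddCommGroup F] [NormedAddCommGroup G]
    {f : Space n → F} {g : Space n → G} (hf : AEStronglyMeasurable f volume) (hg : MemLp g 2 volume)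
    (h : ∫⁻ x, ‖f x‖ₑ ^ 2 ≤ ∫⁻ x, ‖g x‖ₑ ^ 2) :
    MemLp f 2 volume ∧ ∫ x, ‖f x‖ ^ 2 ≤ ∫ x, ‖g x‖ ^ 2 := by
  rw [lintegral_enorm_sq_eq hg] at h
  have hf2 := memLp_two_of_lintegral_le hf ENNReal.ofReal_ne_top h
  refine ⟨hf2, ?_⟩
  rw [lintegral_enorm_sq_eq hf2] at h
  exact (ENNReal.ofReal_le_ofReal_iff (integral_nonneg fun _ => by positivity)).1 h

open ContinuousLinearMap in
/-- A mollification is smooth, and its classical gradient is the mollified weak gradient. -/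
theorem classicalGrad_convolution {ρ : Space n → ℝ} (hρ : IsTestFunction ρ)
    {u : Space n → ℂ} {v : Space n → EuclideanSpace ℂ (Fin n)} (h : IsSobolev u v) :
    classicalGrad (convolution ρ u (lsmul ℝ ℝ) volume)
      = convolution ρ v (lsmul ℝ ℝ) volume := by
  have hul : LocallyIntegrable u volume := h.memLp.locallyIntegrable (by norm_num)
  have hvl : LocallyIntegrable v volume := h.memLp_grad.locallyIntegrable (by norm_num)
  have hρ1 : ContDiff ℝ 1 ρ := hρ.1.of_le (by exact_mod_cast le_top)
  ext x i
  have hd := hρ.2.hasFDerivAt_convolution_left (lsmul ℝ ℝ) hρ1 hul x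
  have hex : ConvolutionExistsAt (fderiv ℝ ρ) u x ((lsmul ℝ ℝ).precompL (Space n)) volume :=
    (hρ.2.fderiv (𝕜 := ℝ)).convolutionExists_left _ (hρ1.continuous_fderiv (by simp)) hul x
  have hex' : ConvolutionExistsAt ρ v x (lsmul ℝ ℝ) volume :=
    hρ.2.convolutionExists_left _ hρ.1.continuous hvl x
  set η : Space n → ℝ := fun y => ρ (x - y) with hη
  have hηt : IsTestFunction η :=
    ⟨hρ.1.comp (contDiff_const.sub contDiff_id), hρ.2.comp_homeomorph (Homeomorph.subLeft x)⟩
  have hηd : ∀ y, partialDeriv i η y = - fderiv ℝ ρ (x - y) (EuclideanSpace.single i 1) := by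
    intro y
    have h3 : HasFDerivAt ρ (fderiv ℝ ρ (x - y)) (x - y) :=
      (hρ1.differentiable (by simp) _).hasFDerivAt
    have h4 : HasFDerivAt (fun y : Space n => x - y) (-ContinuousLinearMap.id ℝ (Space n)) y :=
      (hasFDerivAt_id y).const_sub x
    have h5 : HasFDerivAt η _ y := h3.comp y h4
    simp [partialDeriv, h5.fderiv]
  have e1 : (classicalGrad (convolution ρ u (lsmul ℝ ℝ) volume) x) i
      = ∫ y, fderiv ℝ ρ (x - y) (EuclideanSpace.single i 1) • u y := by
    simp only [classicalGrad, hd.fderiv]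
    rw [convolution_def, ContinuousLinearMap.integral_apply hex.integrable,
      ← integral_sub_left_eq_self _ volume x]
    simp [precompL_apply]
  have e2 : (convolution ρ v (lsmul ℝ ℝ) volume x) i = ∫ y, ρ (x - y) • v y i := by
    have : (convolution ρ v (lsmul ℝ ℝ) volume x) i
        = (EuclideanSpace.proj i : EuclideanSpace ℂ (Fin n) →L[ℂ] ℂ)
            (∫ t, ρ t • v (x - t)) := rfl
    have hint : Integrable (fun t => ρ t • v (x - t)) := hex'.integrable
    rw [this, ← ContinuousLinearMap.integral_comp_comm _ hint,
      ← integral_sub_left_eq_self _ volume x]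
    simp
  rw [e1, e2]
  have := h.hasWeakGradient η hηt i
  simp only [hηd, neg_smul, integral_neg, neg_inj] at this
  exact this

/-- Almost everywhere convergence together with `‖f k‖_{L²} ≤ ‖f‖_{L²}` gives convergence in `L²`:
apply Fatou's lemma to `‖f k + f‖²` and use the parallelogram law. -/
theorem tendsto_integral_sq_sub_of_ae {f : ℕ → Space n → ℂ} {g : Space n → ℂ}
    (hf : ∀ k, MemLp (f k) 2 volume) (hg : MemLp g 2 volume)
    (hle : ∀ k, ∫ x, ‖f k x‖ ^ 2 ≤ ∫ x, ‖g x‖ ^ 2)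
    (hae : ∀ᵐ x, Tendsto (fun k => f k x) atTop (𝓝 (g x))) :
    Tendsto (fun k => ∫ x, ‖f k x - g x‖ ^ 2) atTop (𝓝 0) := by
  set A := ∫ x, ‖g x‖ ^ 2 with hA
  have hint : ∀ {h : Space n → ℂ}, MemLp h 2 volume → Integrable (fun x => ‖h x‖ ^ 2) :=
    fun hh => hh.integrable_norm_pow (by norm_num)
  have hpar : ∀ k, ∫ x, ‖f k x + g x‖ ^ 2 ≤ 4 * A - ∫ x, ‖f k x - g x‖ ^ 2 := by
    intro k
    have hs : Integrable fun x => ‖f k x + g x‖ ^ 2 := hint ((hf k).add hg)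
    have hd : Integrable fun x => ‖f k x - g x‖ ^ 2 := hint ((hf k).sub hg)
    have h1 : (∫ x, ‖f k x + g x‖ ^ 2) + ∫ x, ‖f k x - g x‖ ^ 2
        = 2 * (∫ x, ‖f k x‖ ^ 2) + 2 * A := by
      rw [hA, ← integral_const_mul, ← integral_const_mul,
        ← integral_add hs hd,
        ← integral_add ((hint (hf k)).const_mul 2) ((hint hg).const_mul 2)]
      refine integral_congr_ae (.of_forall fun x => ?_)
      have := parallelogram_law_with_norm ℝ (f k x) (g x)
      simp only
      nlinarith
    linarith [hle k]
  have hfatou : ENNReal.ofReal (4 * A)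
      ≤ liminf (fun k => ENNReal.ofReal (4 * A - ∫ x, ‖f k x - g x‖ ^ 2)) atTop := by
    have h2 : ENNReal.ofReal (4 * A) = ∫⁻ x, ‖g x + g x‖ₑ ^ 2 := by
      rw [show (∫⁻ x, ‖g x + g x‖ₑ ^ 2) = ∫⁻ x, ‖(g + g) x‖ₑ ^ 2 from rfl,
        lintegral_enorm_sq_eq (hg.add hg), hA, ← integral_const_mul]
      congr 1
      refine integral_congr_ae (.of_forall fun x => ?_)
      simp only [Pi.add_apply, ← two_mul, norm_mul, mul_pow]
      norm_num
    have h3 : ∫⁻ x, ‖g x + g x‖ₑ ^ 2 ≤ ∫⁻ x, liminf (fun k => ‖f k x + g x‖ₑ ^ 2) atTop := by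
      refine lintegral_mono_ae ?_
      filter_upwards [hae] with x hx
      have : Tendsto (fun k => ‖f k x + g x‖ₑ ^ 2) atTop (𝓝 (‖g x + g x‖ₑ ^ 2)) :=
        ((ENNReal.continuous_pow 2).tendsto _).comp
          ((continuous_enorm.tendsto _).comp (hx.add_const _))
      exact this.liminf_eq.ge
    rw [h2]
    refine (h3.trans (lintegral_liminf_le' fun k =>
      ((hf k).add hg).aestronglyMeasurable.enorm.pow_const 2)).trans ?_
    refine liminf_le_liminf (.of_forall fun k => ?_)
    have : (∫⁻ x, ‖f k x + g x‖ₑ ^ 2) = ENNReal.ofReal (∫ x, ‖f k x + g x‖ ^ 2) :=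
      lintegral_enorm_sq_eq ((hf k).add hg)
    simp only [this]
    exact ENNReal.ofReal_le_ofReal (hpar k)
  have h0 : ∀ k, 0 ≤ ∫ x, ‖f k x - g x‖ ^ 2 := fun k => integral_nonneg fun _ => by positivity
  have h0' : ∀ k, 0 ≤ ∫ x, ‖f k x + g x‖ ^ 2 := fun k => integral_nonneg fun _ => by positivity
  refine tendsto_order.2 ⟨fun a ha => .of_forall fun k => ha.trans_le (h0 k), fun ε hε => ?_⟩
  rcases (show 0 ≤ A from integral_nonneg fun _ => by positivity).eq_or_lt with hA0 | hA0
  · refine .of_forall fun k => ?_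
    have := hpar k
    have := h0' k
    linarith
  · have h4 : ENNReal.ofReal (4 * A - ε)
        < liminf (fun k => ENNReal.ofReal (4 * A - ∫ x, ‖f k x - g x‖ ^ 2)) atTop := by
      refine lt_of_lt_of_le ?_ hfatou
      exact (ENNReal.ofReal_lt_ofReal_iff (by linarith)).2 (by linarith)
    filter_upwards [eventually_lt_of_lt_liminf h4] with k hk
    have := (ENNReal.ofReal_lt_ofReal_iff'.1 hk).1
    linarith

/-- The product rule for a cutoff `χ` with gradient bounded by `D`. -/
theorem norm_sq_classicalGrad_smul_le {χ : Space n → ℝ} {m : Space n → ℂ} {x : Space n} {D : ℝ}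
    (hχ : DifferentiableAt ℝ χ x) (hm : DifferentiableAt ℝ m x) (h1 : |χ x| ≤ 1)
    (hD : ‖fderiv ℝ χ x‖ ≤ D) :
    ‖classicalGrad (fun y => χ y • m y) x‖ ^ 2
      ≤ 2 * ‖classicalGrad m x‖ ^ 2 + 2 * n * D ^ 2 * ‖m x‖ ^ 2 := by
  have hD0 : 0 ≤ D := (norm_nonneg _).trans hD
  rw [norm_sq_classicalGrad, norm_sq_classicalGrad]
  have : ∀ i : Fin n, ‖fderiv ℝ (fun y => χ y • m y) x (EuclideanSpace.single i 1)‖ ^ 2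
      ≤ 2 * ‖fderiv ℝ m x (EuclideanSpace.single i 1)‖ ^ 2 + 2 * D ^ 2 * ‖m x‖ ^ 2 := by
    intro i
    have e : fderiv ℝ (fun y => χ y • m y) x (EuclideanSpace.single i 1)
        = χ x • fderiv ℝ m x (EuclideanSpace.single i 1)
          + fderiv ℝ χ x (EuclideanSpace.single i 1) • m x := by
      have := (hχ.hasFDerivAt.smul hm.hasFDerivAt).fderiv
      have h' : fderiv ℝ (fun y => χ y • m y) x = _ := this
      rw [h']
      simp
    have ha : ‖χ x • fderiv ℝ m x (EuclideanSpace.single i 1)‖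
        ≤ ‖fderiv ℝ m x (EuclideanSpace.single i 1)‖ := by
      rw [norm_smul]
      exact mul_le_of_le_one_left (norm_nonneg _) h1
    have hb : ‖fderiv ℝ χ x (EuclideanSpace.single i 1) • m x‖ ≤ D * ‖m x‖ := by
      rw [norm_smul]
      gcongr
      refine (ContinuousLinearMap.le_opNorm _ _).trans ?_
      simpa using hD
    have hab := (norm_add_le (χ x • fderiv ℝ m x (EuclideanSpace.single i 1))
      (fderiv ℝ χ x (EuclideanSpace.single i 1) • m x)).trans (add_le_add ha hb)
    rw [e]
    calc _ ≤ (‖fderiv ℝ m x (EuclideanSpace.single i 1)‖ + D * ‖m x‖) ^ 2 := by gcongr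
      _ ≤ _ := by nlinarith [sq_nonneg (‖fderiv ℝ m x (EuclideanSpace.single i 1)‖ - D * ‖m x‖)]
  refine (Finset.sum_le_sum fun i _ => this i).trans (le_of_eq ?_)
  rw [Finset.sum_add_distrib, ← Finset.mul_sum]
  simp
  ring

/-- Smooth cutoffs `b(x / (k + 1))`, with gradients bounded uniformly in `k`. -/
theorem exists_cutoff (n : ℕ) : ∃ (D : ℝ) (χ : ℕ → Space n → ℝ), (∀ k, ContDiff ℝ ∞ (χ k)) ∧
    (∀ k, HasCompactSupport (χ k)) ∧ (∀ k x, |χ k x| ≤ 1) ∧ (∀ k x, ‖fderiv ℝ (χ k) x‖ ≤ D) ∧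
    ∀ x, Tendsto (fun k => χ k x) atTop (𝓝 1) := by
  let b : ContDiffBump (0 : Space n) := ⟨1, 2, by norm_num, by norm_num⟩
  have hb : ContDiff ℝ ∞ b := b.contDiff
  obtain ⟨D, hD⟩ := (hb.continuous_fderiv (by simp)).bounded_above_of_compact_support
    (b.hasCompactSupport.fderiv (𝕜 := ℝ))
  refine ⟨D, fun k x => b (((k : ℝ) + 1)⁻¹ • x), fun k => hb.comp (contDiff_const_smul _),
    fun k => ?_, fun k x => ?_, fun k x => ?_, fun x => ?_⟩
  · exact b.hasCompactSupport.comp_homeomorph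
      (Homeomorph.smulOfNeZero ((k : ℝ) + 1)⁻¹ (inv_ne_zero (by positivity)))
  · rw [abs_of_nonneg b.nonneg]
    exact b.le_one
  · have h1 : HasFDerivAt (fun y : Space n => ((k : ℝ) + 1)⁻¹ • y)
        (((k : ℝ) + 1)⁻¹ • ContinuousLinearMap.id ℝ (Space n)) x :=
      (hasFDerivAt_id x).const_smul ((k : ℝ) + 1)⁻¹
    have h2 : HasFDerivAt b (fderiv ℝ b (((k : ℝ) + 1)⁻¹ • x)) (((k : ℝ) + 1)⁻¹ • x) :=
      (hb.differentiable (by simp) _).hasFDerivAt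
    have h3 : HasFDerivAt (fun y : Space n => b (((k : ℝ) + 1)⁻¹ • y)) _ x := h2.comp x h1
    rw [h3.fderiv]
    refine (ContinuousLinearMap.opNorm_comp_le _ _).trans ?_
    have h4 : ‖((k : ℝ) + 1)⁻¹ • ContinuousLinearMap.id ℝ (Space n)‖ ≤ 1 := by
      rw [norm_smul]
      refine mul_le_one₀ ?_ (norm_nonneg _) ContinuousLinearMap.norm_id_le
      rw [Real.norm_of_nonneg (by positivity)]
      exact inv_le_one_of_one_le₀ (by linarith [Nat.cast_nonneg (α := ℝ) k])
    calc _ ≤ D * 1 := mul_le_mul (hD _) h4 (norm_nonneg _) ((norm_nonneg _).trans (hD 0))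
      _ = D := mul_one D
  · have hz : Tendsto (fun k : ℕ => ((k : ℝ) + 1)⁻¹ • x) atTop (𝓝 ((0 : ℝ) • x)) :=
      (tendsto_inv_atTop_zero.comp
        (tendsto_atTop_add_const_right _ _ tendsto_natCast_atTop_atTop)).smul_const x
    rw [zero_smul] at hz
    have := (hb.continuous.tendsto 0).comp hz
    rwa [b.one_of_mem_closedBall (by simp [b])] at this

open ContinuousLinearMap in
/-- Meyers-Serrin in the form used below: by mollification and cutoff, every `u ∈ H¹` is the limit,
in `L²` and almost everywhere, of test functions that are bounded in `H¹` by a multiple of the norm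
of `u`. -/
theorem exists_smooth_approx (n : ℕ) : ∃ C : ℝ, 0 ≤ C ∧
    ∀ (u : Space n → ℂ) (v : Space n → EuclideanSpace ℂ (Fin n)), IsSobolev u v →
    ∃ U : ℕ → Space n → ℂ, (∀ k, ContDiff ℝ ∞ (U k)) ∧ (∀ k, HasCompactSupport (U k)) ∧
      (∀ k, sobolevSq (U k) (classicalGrad (U k)) ≤ C * sobolevSq u v) ∧
      (∀ᵐ x, Tendsto (fun k => U k x) atTop (𝓝 (u x))) ∧
      Tendsto (fun k => ∫ x, ‖U k x - u x‖ ^ 2) atTop (𝓝 0) := by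
  obtain ⟨D, χ, hχs, hχc, hχ1, hχD, hχt⟩ := exists_cutoff n
  refine ⟨2 + (1 + 2 * n * D ^ 2), by positivity, fun u v h => ?_⟩
  let b : ℕ → ContDiffBump (0 : Space n) := fun k =>
    ⟨((k : ℝ) + 1)⁻¹, 2 * ((k : ℝ) + 1)⁻¹, by positivity, by
      have : (0 : ℝ) < ((k : ℝ) + 1)⁻¹ := by positivity
      linarith⟩
  set ρ : ℕ → Space n → ℝ := fun k => (b k).normed volume with hρ
  have hρt : ∀ k, IsTestFunction (ρ k) := fun k =>
    ⟨(b k).contDiff_normed, (b k).hasCompactSupport_normed⟩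
  have hρ1 : ∀ k, ∫⁻ t, ‖ρ k t‖ₑ = 1 := by
    intro k
    have hi : Integrable (ρ k) volume := (hρt k).1.continuous.integrable_of_hasCompactSupport
      (hρt k).2
    have h1 := ofReal_integral_eq_lintegral_ofReal hi (.of_forall fun x => (b k).nonneg_normed x)
    rw [show ∫ x, ρ k x = 1 from (b k).integral_normed, ENNReal.ofReal_one] at h1
    rw [h1]
    exact lintegral_congr fun x => Real.enorm_of_nonneg ((b k).nonneg_normed x)
  have hul : LocallyIntegrable u volume := h.memLp.locallyIntegrable (by norm_num)
  have hvl : LocallyIntegrable v volume := h.memLp_grad.locallyIntegrable (by norm_num)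
  set m : ℕ → Space n → ℂ := fun k => convolution (ρ k) u (lsmul ℝ ℝ) volume with hm
  have hms : ∀ k, ContDiff ℝ ∞ (m k) := fun k =>
    (hρt k).2.contDiff_convolution_left (lsmul ℝ ℝ) (hρt k).1 hul
  have hmg : ∀ k, classicalGrad (m k) = convolution (ρ k) v (lsmul ℝ ℝ) volume := fun k =>
    classicalGrad_convolution (hρt k) h
  have hm2 : ∀ k, MemLp (m k) 2 volume ∧ ∫ x, ‖m k x‖ ^ 2 ≤ ∫ x, ‖u x‖ ^ 2 := fun k =>
    integral_sq_le_of_lintegral_le (hms k).continuous.aestronglyMeasurable h.memLp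
      (lintegral_convolution_sq_le (hρt k).1.continuous (hρ1 k) h.memLp.aestronglyMeasurable)
  have hg2 : ∀ k, MemLp (classicalGrad (m k)) 2 volume ∧
      ∫ x, ‖classicalGrad (m k) x‖ ^ 2 ≤ ∫ x, ‖v x‖ ^ 2 := by
    intro k
    refine integral_sq_le_of_lintegral_le (continuous_classicalGrad
      ((hms k).of_le (by exact_mod_cast le_top))).aestronglyMeasurable h.memLp_grad ?_
    rw [hmg k]
    exact lintegral_convolution_sq_le (hρt k).1.continuous (hρ1 k)
      h.memLp_grad.aestronglyMeasurable
  set U : ℕ → Space n → ℂ := fun k x => χ k x • m k x with hU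
  have hUs : ∀ k, ContDiff ℝ ∞ (U k) := fun k => (hχs k).smul (hms k)
  have hUc : ∀ k, HasCompactSupport (U k) := fun k => (hχc k).smul_right
  have hUS : ∀ k, IsSobolev (U k) (classicalGrad (U k)) := fun k =>
    isSobolev_of_contDiff ((hUs k).of_le (by exact_mod_cast le_top)) (hUc k)
  have hUle : ∀ k x, ‖U k x‖ ≤ ‖m k x‖ := fun k x => by
    simp only [hU, norm_smul]
    exact mul_le_of_le_one_left (norm_nonneg _) (hχ1 k x)
  have hmi : ∀ k, Integrable (fun x => ‖m k x‖ ^ 2) := fun k =>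
    (hm2 k).1.integrable_norm_pow (by norm_num)
  have hgi : ∀ k, Integrable (fun x => ‖classicalGrad (m k) x‖ ^ 2) := fun k =>
    (hg2 k).1.integrable_norm_pow (by norm_num)
  have hU2 : ∀ k, ∫ x, ‖U k x‖ ^ 2 ≤ ∫ x, ‖u x‖ ^ 2 := fun k =>
    (integral_mono (hUS k).integrable_sq (hmi k) fun x => by
      simp only; gcongr; exact hUle k x).trans (hm2 k).2
  have hae : ∀ᵐ x, Tendsto (fun k => U k x) atTop (𝓝 (u x)) := by
    have h1 : Tendsto (fun k => (b k).rOut) atTop (𝓝 0) := by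
      have : Tendsto (fun k : ℕ => 2 * ((k : ℝ) + 1)⁻¹) atTop (𝓝 (2 * 0)) :=
        (tendsto_inv_atTop_zero.comp
          (tendsto_atTop_add_const_right _ _ tendsto_natCast_atTop_atTop)).const_mul 2
      simpa using this
    filter_upwards [ContDiffBump.ae_convolution_tendsto_right_of_locallyIntegrable (K := 2)
      h1 (.of_forall fun k => le_rfl) hul] with x hx
    have := (hχt x).smul hx
    rwa [one_smul] at this
  refine ⟨U, hUs, hUc, fun k => ?_, hae,
    tendsto_integral_sq_sub_of_ae (fun k => (hUS k).memLp) h.memLp hU2 hae⟩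
  have hgU : ∫ x, ‖classicalGrad (U k) x‖ ^ 2
      ≤ 2 * (∫ x, ‖v x‖ ^ 2) + 2 * n * D ^ 2 * ∫ x, ‖u x‖ ^ 2 := by
    calc _ ≤ ∫ x, (2 * ‖classicalGrad (m k) x‖ ^ 2 + 2 * n * D ^ 2 * ‖m k x‖ ^ 2) :=
          integral_mono (hUS k).integrable_grad_sq
            (((hgi k).const_mul 2).add ((hmi k).const_mul _)) fun x =>
            norm_sq_classicalGrad_smul_le ((hχs k).differentiable (by simp) x)
              ((hms k).differentiable (by simp) x) (hχ1 k x) (hχD k x)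
      _ = 2 * (∫ x, ‖classicalGrad (m k) x‖ ^ 2) + 2 * n * D ^ 2 * ∫ x, ‖m k x‖ ^ 2 := by
          rw [integral_add ((hgi k).const_mul 2) ((hmi k).const_mul _), integral_const_mul,
            integral_const_mul]
      _ ≤ _ := add_le_add (mul_le_mul_of_nonneg_left (hg2 k).2 (by norm_num))
          (mul_le_mul_of_nonneg_left (hm2 k).2 (by positivity))
  have ha : 0 ≤ ∫ x, ‖u x‖ ^ 2 := integral_nonneg fun _ => by positivity
  have hb : 0 ≤ ∫ x, ‖v x‖ ^ 2 := integral_nonneg fun _ => by positivity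
  have hK : 0 ≤ 2 * n * D ^ 2 := by positivity
  have hK' := mul_nonneg hK hb
  unfold sobolevSq
  nlinarith [hU2 k]

end Approximation

/-! ### Sobolev embeddings and weighted inequalities -/

section Embedding

variable {n : ℕ}

theorem lintegral_mul_sq_le {α : Type*} [MeasurableSpace α] {μ : Measure α} {f g : α → ℝ≥0∞}
    (hf : AEMeasurable f μ) (hg : AEMeasurable g μ) :
    (∫⁻ x, f x * g x ∂μ) ^ 2 ≤ (∫⁻ x, f x ^ 2 ∂μ) * ∫⁻ x, g x ^ 2 ∂μ := by
  have h := ENNReal.lintegral_mul_le_Lp_mul_Lq μ Real.HolderConjugate.two_two hf hg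
  simp only [Pi.mul_apply, ENNReal.rpow_two] at h
  calc _ ≤ ((∫⁻ x, f x ^ 2 ∂μ) ^ (1 / 2 : ℝ) * (∫⁻ x, g x ^ 2 ∂μ) ^ (1 / 2 : ℝ)) ^ 2 := by
        gcongr
    _ = _ := by
        rw [mul_pow, ← ENNReal.rpow_natCast, ← ENNReal.rpow_natCast, ← ENNReal.rpow_mul,
          ← ENNReal.rpow_mul]
        norm_num

/-- The critical Sobolev inequality for test functions in dimension at least three. -/
theorem lintegral_critical_le (hn : 3 ≤ n) : ∃ C : ℝ≥0∞, C ≠ ⊤ ∧ ∀ u : Space n → ℂ,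
    ContDiff ℝ 1 u → HasCompactSupport u →
    ∫⁻ x, ‖u x‖ₑ ^ (2 * n / (n - 2) : ℝ)
      ≤ C * (∫⁻ x, ‖fderiv ℝ u x‖ₑ ^ 2) ^ ((n : ℝ) / (n - 2)) := by
  have hn3 : (3 : ℝ) ≤ n := by exact_mod_cast hn
  have hσ : (0 : ℝ) < 2 * n / (n - 2) := div_pos (by linarith) (by linarith)
  set σ : NNReal := ⟨2 * n / (n - 2), hσ.le⟩ with hσd
  have hσc : (σ : ℝ) = 2 * n / (n - 2) := rfl
  set K := SNormLESNormFDerivOfEqConst ℂ (volume : Measure (Space n)) (2 : NNReal)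
  refine ⟨(K : ℝ≥0∞) ^ (σ : ℝ), ENNReal.rpow_ne_top_of_nonneg hσ.le ENNReal.coe_ne_top,
    fun u hu hs => ?_⟩
  have h := eLpNorm_le_eLpNorm_fderiv_of_eq (volume : Measure (Space n)) hu hs (p := 2) (p' := σ)
    (by norm_num) (by rw [finrank_euclideanSpace_fin]; omega) (by
      rw [finrank_euclideanSpace_fin, hσc]
      have : (n : ℝ) - 2 ≠ 0 := by linarith
      field_simp
      simp
      ring)
  have hσ0 : σ ≠ 0 := by
    rw [← NNReal.coe_ne_zero, hσc]; exact hσ.ne'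
  rw [eLpNorm_nnreal_eq_lintegral hσ0, eLpNorm_nnreal_eq_lintegral (by norm_num)] at h
  have h' := ENNReal.rpow_le_rpow h hσ.le
  rw [ENNReal.mul_rpow_of_nonneg _ _ hσ.le, ← ENNReal.rpow_mul, ← ENNReal.rpow_mul, hσc,
    one_div_mul_cancel hσ.ne', ENNReal.rpow_one] at h'
  refine h'.trans (le_of_eq ?_)
  rw [hσc]
  congr 2
  · refine lintegral_congr fun x => ?_
    norm_num
  · have : (n : ℝ) - 2 ≠ 0 := by linarith
    simp only [NNReal.coe_ofNat]
    field_simp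

/-- Ladyzhenskaya-type inequalities in the plane: the `W^{1,1}` Sobolev inequality for `|u|^(m+1)`
raises the exponent from `2m` to `2(m+1)`. -/
theorem lintegral_planar_le (m : ℕ) : ∃ C : ℝ≥0∞, C ≠ ⊤ ∧ ∀ u : Space 2 → ℂ,
    ContDiff ℝ 1 u → HasCompactSupport u →
    ∫⁻ x, ‖u x‖ₑ ^ (2 * (m + 1))
      ≤ C * ((∫⁻ x, ‖u x‖ₑ ^ 2) * (∫⁻ x, ‖fderiv ℝ u x‖ₑ ^ 2) ^ m) := by
  induction m with
  | zero => exact ⟨1, ENNReal.one_ne_top, fun u _ _ => by simp⟩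
  | succ m ih =>
    obtain ⟨C, hC, ih⟩ := ih
    set K := eLpNormLESNormFDerivOneConst (volume : Measure (Space 2)) (2 : NNReal)
    refine ⟨(K * (m + 2)) ^ 2 * C, by finiteness, fun u hu hs => ?_⟩
    set γ : NNReal := m + 2 with hγ
    have hγ1 : 1 < γ := by
      rw [hγ, ← NNReal.coe_lt_coe]; push_cast; linarith [Nat.cast_nonneg (α := ℝ) m]
    have hγr : (γ : ℝ) = m + 2 := by simp [hγ]
    have h := eLpNorm_le_eLpNorm_fderiv_one (volume : Measure (Space 2)) (p := 2)
      (hu.norm_rpow (p := γ) (by exact_mod_cast hγ1))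
      (hs.norm.rpow_const (by rw [hγr]; positivity)) (by
        rw [finrank_euclideanSpace_fin]
        exact NNReal.HolderConjugate.two_two)
    have h2 : ∫⁻ x, ‖fderiv ℝ (fun x => ‖u x‖ ^ (γ : ℝ)) x‖ₑ
        ≤ (m + 2) * ∫⁻ x, ‖u x‖ₑ ^ (m + 1) * ‖fderiv ℝ u x‖ₑ := by
      rw [← lintegral_const_mul' _ _ (by finiteness)]
      refine lintegral_mono fun x => ?_
      refine (enorm_fderiv_norm_rpow_le (hu.differentiable one_ne_zero) hγ1).trans (le_of_eq ?_)
      rw [mul_assoc, hγr, show (m : ℝ) + 2 - 1 = ((m + 1 : ℕ) : ℝ) by push_cast; ring,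
        ENNReal.rpow_natCast]
      congr 1
    have hcs := lintegral_mul_sq_le (μ := (volume : Measure (Space 2)))
      (f := fun x => ‖u x‖ₑ ^ (m + 1)) (g := fun x => ‖fderiv ℝ u x‖ₑ)
      (hu.continuous.measurable.enorm.pow_const _).aemeasurable
      (hu.continuous_fderiv one_ne_zero).measurable.enorm.aemeasurable
    rw [eLpNorm_one_eq_lintegral_enorm,
      eLpNorm_nnreal_eq_lintegral (by norm_num)] at h
    have h3 : ∫⁻ x, ‖‖u x‖ ^ (γ : ℝ)‖ₑ ^ ((2 : NNReal) : ℝ)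
        = ∫⁻ x, ‖u x‖ₑ ^ (2 * (m + 1 + 1)) := by
      refine lintegral_congr fun x => ?_
      rw [Real.enorm_rpow_of_nonneg (norm_nonneg _) (by positivity), ← ENNReal.rpow_mul, hγr,
        show ((m : ℝ) + 2) * ((2 : NNReal) : ℝ) = ((2 * (m + 1 + 1) : ℕ) : ℝ) by push_cast; ring,
        ENNReal.rpow_natCast, enorm_norm]
    rw [h3] at h
    calc ∫⁻ x, ‖u x‖ₑ ^ (2 * (m + 1 + 1))
        = ((∫⁻ x, ‖u x‖ₑ ^ (2 * (m + 1 + 1))) ^ (1 / ((2 : NNReal) : ℝ))) ^ 2 := by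
          rw [← ENNReal.rpow_natCast, ← ENNReal.rpow_mul]
          norm_num
      _ ≤ (K * ((m + 2) * ∫⁻ x, ‖u x‖ₑ ^ (m + 1) * ‖fderiv ℝ u x‖ₑ)) ^ 2 := by
          gcongr
          refine h.trans ?_
          gcongr
      _ = (K * (m + 2)) ^ 2 * (∫⁻ x, ‖u x‖ₑ ^ (m + 1) * ‖fderiv ℝ u x‖ₑ) ^ 2 := by ring
      _ ≤ (K * (m + 2)) ^ 2 * ((C * ((∫⁻ x, ‖u x‖ₑ ^ 2) * (∫⁻ x, ‖fderiv ℝ u x‖ₑ ^ 2) ^ m))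
            * ∫⁻ x, ‖fderiv ℝ u x‖ₑ ^ 2) := by
          gcongr
          refine hcs.trans ?_
          gcongr
          refine le_trans (le_of_eq ?_) (ih u hu hs)
          refine lintegral_congr fun x => ?_
          rw [← pow_mul, mul_comm]
      _ = _ := by ring

/-- Agmon's inequality for test functions on the line, from the fundamental theorem of calculus
for `|u|²`. -/
theorem enorm_sq_le_of_line {u : Space 1 → ℂ} (hu : ContDiff ℝ 1 u) (hs : HasCompactSupport u)
    (x : Space 1) : ‖u x‖ₑ ^ 2 ≤ 2 * ∫⁻ y, ‖u y‖ₑ * ‖fderiv ℝ u y‖ₑ := by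
  let e : ℝ → Space 1 := fun t => t • EuclideanSpace.single 0 1
  have he : ∀ t, e t = WithLp.toLp 2 (fun _ => t) := by
    intro t
    ext i
    simp [e, Subsingleton.elim i 0]
  have hmp : MeasurePreserving e volume volume := by
    have h1 := (volume_preserving_funUnique (Fin 1) ℝ).symm
    have h2 := (PiLp.volume_preserving_toLp (Fin 1)).comp h1
    have h3 : e = WithLp.toLp 2 ∘ (MeasurableEquiv.funUnique (Fin 1) ℝ).symm := by
      funext t
      rw [he]
      rfl
    rw [h3]
    exact h2
  set f : Space 1 → ℝ := fun y => ‖u y‖ ^ ((2 : NNReal) : ℝ) with hf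
  have hfc : ContDiff ℝ 1 f := hu.norm_rpow (by norm_num)
  have hfs : HasCompactSupport f := hs.norm.rpow_const (by norm_num)
  have hec : ContDiff ℝ 1 e := contDiff_id.smul contDiff_const
  have hxe : e (x 0) = x := by
    rw [he]; ext i; simp [Subsingleton.elim i 0]
  have hemb : IsClosedEmbedding e := by
    have : Isometry e := by
      refine AddMonoidHomClass.isometry_of_norm
        ((LinearMap.id : ℝ →ₗ[ℝ] ℝ).smulRight (EuclideanSpace.single 0 1 : Space 1)) fun t => ?_
      simp [norm_smul]
    exact this.isClosedEmbedding
  have h1 := HasCompactSupport.enorm_le_lintegral_Ici_deriv (f := f ∘ e) (hfc.comp hec)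
    (hfs.comp_isClosedEmbedding hemb) (x 0)
  have h2 : ∀ t, ‖deriv (f ∘ e) t‖ₑ ≤ 2 * (‖u (e t)‖ₑ * ‖fderiv ℝ u (e t)‖ₑ) := by
    intro t
    have hde : HasDerivAt e (EuclideanSpace.single 0 1) t := by
      simpa using (hasDerivAt_id t).smul_const (EuclideanSpace.single 0 1 : Space 1)
    have hdf := ((hfc.differentiable one_ne_zero (e t)).hasFDerivAt.comp_hasDerivAt t hde).deriv
    rw [hdf]
    have h3 : ‖fderiv ℝ f (e t) (EuclideanSpace.single 0 1)‖ₑ ≤ ‖fderiv ℝ f (e t)‖ₑ := by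
      refine (ContinuousLinearMap.le_opENorm _ _).trans ?_
      simp [enorm_eq_nnnorm]
    refine h3.trans ((enorm_fderiv_norm_rpow_le (hu.differentiable one_ne_zero)
      (by norm_num)).trans (le_of_eq ?_))
    norm_num [mul_assoc]
  have h4 : ‖(f ∘ e) (x 0)‖ₑ = ‖u x‖ₑ ^ 2 := by
    simp only [Function.comp_apply, hxe, hf]
    rw [Real.enorm_rpow_of_nonneg (norm_nonneg _) (by positivity), enorm_norm]
    norm_num
  rw [← h4]
  calc _ ≤ ∫⁻ t in Set.Iic (x 0), ‖deriv (f ∘ e) t‖ₑ := h1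
    _ ≤ ∫⁻ t, ‖deriv (f ∘ e) t‖ₑ := lintegral_mono' Measure.restrict_le_self le_rfl
    _ ≤ ∫⁻ t, 2 * (‖u (e t)‖ₑ * ‖fderiv ℝ u (e t)‖ₑ) := lintegral_mono h2
    _ = ∫⁻ y, 2 * (‖u y‖ₑ * ‖fderiv ℝ u y‖ₑ) := by
        refine hmp.lintegral_comp (f := fun y => 2 * (‖u y‖ₑ * ‖fderiv ℝ u y‖ₑ)) ?_
        exact ((hu.continuous.measurable.enorm.mul
          (hu.continuous_fderiv one_ne_zero).measurable.enorm).const_mul 2)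
    _ = _ := lintegral_const_mul' _ _ (by finiteness)

/-- Interpolation of `Lˢ` between `L²` and `L^σ`, in homogeneous form. -/
theorem lintegral_rpow_le_of_endpoints {α : Type*} [MeasurableSpace α] {μ : Measure α}
    {f : α → ℝ≥0∞} (hf : AEMeasurable f μ) {s σ : ℝ} (hs : 2 ≤ s) (hsσ : s ≤ σ) (hσ : 2 < σ)
    {L C : ℝ≥0∞} (h2 : ∫⁻ x, f x ^ 2 ∂μ ≤ L) (h : ∫⁻ x, f x ^ σ ∂μ ≤ C * L ^ (σ / 2)) :
    ∫⁻ x, f x ^ s ∂μ ≤ C ^ ((s - 2) / (σ - 2)) * L ^ (s / 2) := by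
  have hd : 0 < σ - 2 := by linarith
  set a := (σ - s) / (σ - 2) with ha
  set b := (s - 2) / (σ - 2) with hb
  have ha0 : 0 ≤ a := div_nonneg (by linarith) hd.le
  have hb0 : 0 ≤ b := div_nonneg (by linarith) hd.le
  have hab : a + b = 1 := by rw [ha, hb]; field_simp; ring
  have hs' : 2 * a + σ * b = s := by rw [ha, hb]; field_simp; ring
  have key := ENNReal.lintegral_mul_norm_pow_le (μ := μ) (hf.pow_const 2) (hf.pow_const σ)
    ha0 hb0 hab
  have e : ∀ x, (f x ^ 2) ^ a * (f x ^ σ) ^ b = f x ^ s := by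
    intro x
    rw [← ENNReal.rpow_natCast, ← ENNReal.rpow_mul, ← ENNReal.rpow_mul,
      ← ENNReal.rpow_add_of_nonneg _ _ (by positivity) (by nlinarith)]
    push_cast
    rw [hs']
  simp only [e] at key
  calc _ ≤ _ := key
    _ ≤ L ^ a * (C * L ^ (σ / 2)) ^ b := by gcongr
    _ = C ^ b * (L ^ a * L ^ (σ / 2 * b)) := by
        rw [ENNReal.mul_rpow_of_nonneg _ _ hb0, ← ENNReal.rpow_mul]; ring
    _ = C ^ b * L ^ (s / 2) := by
        rw [← ENNReal.rpow_add_of_nonneg _ _ ha0 (by nlinarith)]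
        congr 2
        linarith

theorem lintegral_fderiv_sq_le {u : Space n → ℂ} (hu : ContDiff ℝ 1 u)
    (hs : HasCompactSupport u) :
    ∫⁻ x, ‖fderiv ℝ u x‖ₑ ^ 2 ≤ ENNReal.ofReal (∫ x, ‖classicalGrad u x‖ ^ 2) := by
  rw [← lintegral_enorm_sq_eq (isSobolev_of_contDiff hu hs).memLp_grad]
  refine lintegral_mono fun x => ?_
  gcongr
  simpa only [enorm_le_iff_norm_le] using norm_fderiv_le_classicalGrad u x

theorem IsSobolev.lintegral_sq_le {u : Space n → ℂ} {v : Space n → EuclideanSpace ℂ (Fin n)}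
    (h : IsSobolev u v) : ∫⁻ x, ‖u x‖ₑ ^ 2 ≤ ENNReal.ofReal (sobolevSq u v) := by
  rw [lintegral_enorm_sq_eq h.memLp]
  exact ENNReal.ofReal_le_ofReal (integral_sq_le_sobolevSq u v)

theorem lintegral_fderiv_sq_le_sobolevSq {u : Space n → ℂ} (hu : ContDiff ℝ 1 u)
    (hs : HasCompactSupport u) :
    ∫⁻ x, ‖fderiv ℝ u x‖ₑ ^ 2 ≤ ENNReal.ofReal (sobolevSq u (classicalGrad u)) :=
  (lintegral_fderiv_sq_le hu hs).trans (ENNReal.ofReal_le_ofReal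
    (le_add_of_nonneg_left (integral_nonneg fun _ => by positivity)))

/-- Agmon's inequality on the line, in the form in which it survives passage to the limit. -/
theorem ae_norm_sq_le_of_line : ∃ C : ℝ, 0 ≤ C ∧
    ∀ (u : Space 1 → ℂ) (v : Space 1 → EuclideanSpace ℂ (Fin 1)), IsSobolev u v →
    ∀ᵐ x, ‖u x‖ ^ 2 ≤ C * √(∫ x, ‖u x‖ ^ 2) * √(sobolevSq u v) := by
  obtain ⟨C, hC, happ⟩ := exists_smooth_approx 1
  refine ⟨2 * √C, by positivity, fun u v h => ?_⟩
  obtain ⟨U, hUs, hUc, hUb, hUae, hU2⟩ := happ u v h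
  have hU1 : ∀ k, ContDiff ℝ 1 (U k) := fun k => (hUs k).of_le (by exact_mod_cast le_top)
  have hUS : ∀ k, IsSobolev (U k) (classicalGrad (U k)) := fun k =>
    isSobolev_of_contDiff (hU1 k) (hUc k)
  have hlim : Tendsto (fun k => ∫ x, ‖U k x‖ ^ 2) atTop (𝓝 (∫ x, ‖u x‖ ^ 2)) := by
    have hL : ∀ {w : Space 1 → ℂ}, MemLp w 2 volume →
        (eLpNorm w 2 volume).toReal = √(∫ x, ‖w x‖ ^ 2) := by
      intro w hw
      rw [hw.eLpNorm_eq_integral_rpow_norm (by norm_num) (by norm_num),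
        ENNReal.toReal_ofReal (by positivity), Real.sqrt_eq_rpow]
      norm_num
    have hsq : Tendsto (fun k => √(∫ x, ‖U k x‖ ^ 2)) atTop (𝓝 (√(∫ x, ‖u x‖ ^ 2))) := by
      have hd : Tendsto (fun k => √(∫ x, ‖U k x - u x‖ ^ 2)) atTop (𝓝 0) := by
        simpa [Function.comp_def] using (Real.continuous_sqrt.tendsto 0).comp hU2
      refine tendsto_iff_norm_sub_tendsto_zero.2
        (squeeze_zero (fun _ => norm_nonneg _) (fun k => ?_) hd)
      have e1 : (hUS k).memLp.toLp (U k) - h.memLp.toLp u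
          = ((hUS k).memLp.sub h.memLp).toLp (U k - u) := rfl
      have e2 := abs_norm_sub_norm_le ((hUS k).memLp.toLp (U k)) (h.memLp.toLp u)
      rw [e1, Lp.norm_toLp, Lp.norm_toLp, Lp.norm_toLp, hL (hUS k).memLp, hL h.memLp,
        hL ((hUS k).memLp.sub h.memLp)] at e2
      exact e2
    have := hsq.pow 2
    simpa [Real.sq_sqrt (integral_nonneg fun _ => by positivity :
      (0 : ℝ) ≤ ∫ x, ‖u x‖ ^ 2), fun k => Real.sq_sqrt (integral_nonneg fun _ => by positivity :
      (0 : ℝ) ≤ ∫ x, ‖U k x‖ ^ 2)] using this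
  filter_upwards [hUae] with x hx
  have hb : ∀ k, ‖U k x‖ ^ 2 ≤ 2 * √(∫ x, ‖U k x‖ ^ 2) * √(C * sobolevSq u v) := by
    intro k
    have h1 := enorm_sq_le_of_line (hU1 k) (hUc k) x
    have h2 := lintegral_mul_sq_le (μ := (volume : Measure (Space 1)))
      (hU1 k).continuous.measurable.enorm.aemeasurable
      ((hU1 k).continuous_fderiv one_ne_zero).measurable.enorm.aemeasurable
    have h3 : ∫⁻ y, ‖fderiv ℝ (U k) y‖ₑ ^ 2 ≤ ENNReal.ofReal (C * sobolevSq u v) :=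
      (lintegral_fderiv_sq_le_sobolevSq (hU1 k) (hUc k)).trans (ENNReal.ofReal_le_ofReal (hUb k))
    have h4 : (∫⁻ y, ‖U k y‖ₑ * ‖fderiv ℝ (U k) y‖ₑ) ^ 2
        ≤ ENNReal.ofReal (√(∫ x, ‖U k x‖ ^ 2) * √(C * sobolevSq u v)) ^ 2 := by
      refine h2.trans ?_
      rw [lintegral_enorm_sq_eq (hUS k).memLp, ← ENNReal.ofReal_pow (by positivity), mul_pow,
        Real.sq_sqrt (integral_nonneg fun _ => by positivity),
        Real.sq_sqrt (mul_nonneg hC (sobolevSq_nonneg u v)),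
        ENNReal.ofReal_mul (integral_nonneg fun _ => by positivity)]
      gcongr
    have h5 := (ENNReal.pow_le_pow_left_iff two_ne_zero).1 h4
    have h6 : ENNReal.ofReal (‖U k x‖ ^ 2)
        ≤ ENNReal.ofReal (2 * √(∫ x, ‖U k x‖ ^ 2) * √(C * sobolevSq u v)) := by
      rw [ENNReal.ofReal_pow (norm_nonneg _), ofReal_norm, mul_assoc,
        ENNReal.ofReal_mul (by norm_num), ENNReal.ofReal_ofNat]
      exact h1.trans (by gcongr)
    exact (ENNReal.ofReal_le_ofReal_iff (by positivity)).1 h6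
  have hl := le_of_tendsto_of_tendsto' ((hx.norm).pow 2)
    (((Real.continuous_sqrt.tendsto _).comp hlim).const_mul 2 |>.mul_const
      (√(C * sobolevSq u v))) hb
  refine hl.trans (le_of_eq ?_)
  rw [Real.sqrt_mul hC]
  ring

/-- The Sobolev embedding `H¹ ⊂ Lˢ` for finite subcritical or critical exponents, for test
functions. -/
theorem lintegral_rpow_le_of_contDiff (hn : 2 ≤ n) {s : ℝ} (hs : 2 ≤ s)
    (hs' : 3 ≤ n → s * (n - 2) ≤ 2 * n) : ∃ C : ℝ≥0∞, C ≠ ⊤ ∧ ∀ u : Space n → ℂ,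
    ContDiff ℝ 1 u → HasCompactSupport u →
    ∫⁻ x, ‖u x‖ₑ ^ s ≤ C * ENNReal.ofReal (sobolevSq u (classicalGrad u)) ^ (s / 2) := by
  rcases hn.eq_or_lt with rfl | hn
  · obtain ⟨m, hm⟩ := exists_nat_ge s
    obtain ⟨C, hC, hCu⟩ := lintegral_planar_le m
    have hσ : (2 * (m + 1) : ℝ) - 2 = 2 * m := by ring
    have hm2 : (2 : ℝ) ≤ m := hs.trans hm
    refine ⟨C ^ ((s - 2) / (2 * (m + 1) - 2)), ENNReal.rpow_ne_top_of_nonneg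
      (div_nonneg (by linarith) (by linarith)) hC, fun u hu hc => ?_⟩
    have hS := isSobolev_of_contDiff hu hc
    refine lintegral_rpow_le_of_endpoints hu.continuous.measurable.enorm.aemeasurable hs
      (by linarith) (by linarith) hS.lintegral_sq_le ?_
    calc ∫⁻ x, ‖u x‖ₑ ^ (2 * (m + 1) : ℝ) = ∫⁻ x, ‖u x‖ₑ ^ (2 * (m + 1)) := by
          refine lintegral_congr fun x => ?_
          rw [← ENNReal.rpow_natCast]
          push_cast
          rfl
      _ ≤ C * ((∫⁻ x, ‖u x‖ₑ ^ 2) * (∫⁻ x, ‖fderiv ℝ u x‖ₑ ^ 2) ^ m) := hCu u hu hc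
      _ ≤ C * (ENNReal.ofReal (sobolevSq u (classicalGrad u))
            * ENNReal.ofReal (sobolevSq u (classicalGrad u)) ^ m) := by
          gcongr
          exacts [hS.lintegral_sq_le, lintegral_fderiv_sq_le_sobolevSq hu hc]
      _ = _ := by
          rw [← pow_succ', ← ENNReal.rpow_natCast]
          push_cast
          congr 2
          ring
  · obtain ⟨C, hC, hCu⟩ := lintegral_critical_le (n := n) (by omega)
    have hn3 : (3 : ℝ) ≤ n := by exact_mod_cast hn
    have hd : (0 : ℝ) < n - 2 := by linarith
    have hσ : (2 : ℝ) < 2 * n / (n - 2) := by rw [lt_div_iff₀ hd]; linarith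
    refine ⟨C ^ ((s - 2) / (2 * n / (n - 2) - 2)), ENNReal.rpow_ne_top_of_nonneg
      (div_nonneg (by linarith) (by linarith)) hC, fun u hu hc => ?_⟩
    refine lintegral_rpow_le_of_endpoints hu.continuous.measurable.enorm.aemeasurable hs
      (by rw [le_div_iff₀ hd]; exact hs' (by omega)) hσ
      (isSobolev_of_contDiff hu hc).lintegral_sq_le ?_
    refine (hCu u hu hc).trans ?_
    rw [show (2 * n / (n - 2) / 2 : ℝ) = n / (n - 2) by ring]
    gcongr
    exact lintegral_fderiv_sq_le_sobolevSq hu hc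

/-- The Sobolev embedding `H¹(ℝⁿ) ⊂ Lˢ(ℝⁿ)` for finite exponents `s ≤ 2n/(n-2)`. -/
theorem lintegral_rpow_le_sobolevSq (hn : 1 ≤ n) {s : ℝ} (hs : 2 ≤ s)
    (hs' : 3 ≤ n → s * (n - 2) ≤ 2 * n) : ∃ C : ℝ≥0∞, C ≠ ⊤ ∧
    ∀ (u : Space n → ℂ) (v : Space n → EuclideanSpace ℂ (Fin n)), IsSobolev u v →
    ∫⁻ x, ‖u x‖ₑ ^ s ≤ C * ENNReal.ofReal (sobolevSq u v) ^ (s / 2) := by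
  rcases hn.eq_or_lt with rfl | hn
  · obtain ⟨C, hC, hCu⟩ := ae_norm_sq_le_of_line
    refine ⟨ENNReal.ofReal C ^ ((s - 2) / 2), ENNReal.rpow_ne_top_of_nonneg (by linarith)
      ENNReal.ofReal_ne_top, fun u v h => ?_⟩
    set L := ENNReal.ofReal (sobolevSq u v) with hL
    have hpt : ∀ᵐ x, ‖u x‖ₑ ^ s ≤ (ENNReal.ofReal C * L) ^ ((s - 2) / 2) * ‖u x‖ₑ ^ 2 := by
      filter_upwards [hCu u v h] with x hx
      have h1 : ‖u x‖ₑ ^ 2 ≤ ENNReal.ofReal C * L := by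
        rw [hL, ← ENNReal.ofReal_mul hC, ← ofReal_norm, ← ENNReal.ofReal_pow (norm_nonneg _)]
        refine ENNReal.ofReal_le_ofReal (hx.trans ?_)
        calc _ ≤ C * √(sobolevSq u v) * √(sobolevSq u v) := by
              gcongr; exact integral_sq_le_sobolevSq u v
          _ = _ := by rw [mul_assoc, Real.mul_self_sqrt (sobolevSq_nonneg u v)]
      calc ‖u x‖ₑ ^ s = (‖u x‖ₑ ^ 2) ^ ((s - 2) / 2) * ‖u x‖ₑ ^ 2 := by
            rw [← ENNReal.rpow_natCast, ← ENNReal.rpow_mul,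
              ← ENNReal.rpow_add_of_nonneg _ _ (by push_cast; linarith) (by positivity)]
            congr 1
            push_cast
            ring
        _ ≤ _ := by gcongr
    calc _ ≤ ∫⁻ x, (ENNReal.ofReal C * L) ^ ((s - 2) / 2) * ‖u x‖ₑ ^ 2 := lintegral_mono_ae hpt
      _ = (ENNReal.ofReal C * L) ^ ((s - 2) / 2) * ∫⁻ x, ‖u x‖ₑ ^ 2 :=
          lintegral_const_mul' _ _ (ENNReal.rpow_ne_top_of_nonneg (by linarith) (by finiteness))
      _ ≤ (ENNReal.ofReal C * L) ^ ((s - 2) / 2) * L := by gcongr; exact h.lintegral_sq_le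
      _ = ENNReal.ofReal C ^ ((s - 2) / 2) * (L ^ ((s - 2) / 2) * L ^ (1 : ℝ)) := by
          rw [ENNReal.mul_rpow_of_nonneg _ _ (by linarith), ENNReal.rpow_one]; ring
      _ = _ := by
          rw [← ENNReal.rpow_add_of_nonneg _ _ (by linarith) (by norm_num)]
          congr 2
          ring
  · obtain ⟨C, hC, hCu⟩ := lintegral_rpow_le_of_contDiff hn hs hs'
    obtain ⟨K, hK, happ⟩ := exists_smooth_approx n
    refine ⟨C * ENNReal.ofReal K ^ (s / 2), ENNReal.mul_ne_top hC
      (ENNReal.rpow_ne_top_of_nonneg (by linarith) ENNReal.ofReal_ne_top), fun u v h => ?_⟩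
    obtain ⟨U, hUs, hUc, hUb, hUae, -⟩ := happ u v h
    have hU1 : ∀ k, ContDiff ℝ 1 (U k) := fun k => (hUs k).of_le (by exact_mod_cast le_top)
    have h1 : ∫⁻ x, ‖u x‖ₑ ^ s ≤ ∫⁻ x, liminf (fun k => ‖U k x‖ₑ ^ s) atTop := by
      refine lintegral_mono_ae ?_
      filter_upwards [hUae] with x hx
      have : Tendsto (fun k => ‖U k x‖ₑ ^ s) atTop (𝓝 (‖u x‖ₑ ^ s)) :=
        ((ENNReal.continuous_rpow_const (y := s)).tendsto _).comp
          ((continuous_enorm.tendsto _).comp hx)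
      exact this.liminf_eq.ge
    refine (h1.trans (lintegral_liminf_le' fun k =>
      ((hU1 k).continuous.measurable.enorm.pow_const s).aemeasurable)).trans ?_
    refine liminf_le_of_frequently_le' (Frequently.of_forall fun k => ?_)
    refine (hCu (U k) (hU1 k) (hUc k)).trans ?_
    rw [mul_assoc, ← ENNReal.mul_rpow_of_nonneg _ _ (by linarith), ← ENNReal.ofReal_mul hK]
    gcongr
    exact hUb k

/-- For `t ≥ 1`, `t > n/2`, a weight in `Lᵗ` is form bounded with respect to `H¹`: by Hölder's
inequality this is the embedding into `L^{2t'}`. -/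
theorem lintegral_weight_le (hn : 1 ≤ n) {t : ℝ} (ht : 1 ≤ t) (ht' : (n : ℝ) / 2 < t) :
    ∃ C : ℝ≥0∞, C ≠ ⊤ ∧ ∀ f : Space n → ℝ, AEStronglyMeasurable f volume →
    ∀ (u : Space n → ℂ) (v : Space n → EuclideanSpace ℂ (Fin n)), IsSobolev u v →
    ∫⁻ x, ‖f x‖ₑ * ‖u x‖ₑ ^ 2
      ≤ C * eLpNorm f (ENNReal.ofReal t) volume * ENNReal.ofReal (sobolevSq u v) := by
  rcases ht.eq_or_lt with rfl | ht
  · have hn1 : n = 1 := by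
      have : (n : ℝ) < 2 := by linarith
      have : n < 2 := by exact_mod_cast this
      omega
    subst hn1
    obtain ⟨C, hC, hCu⟩ := ae_norm_sq_le_of_line
    refine ⟨ENNReal.ofReal C, ENNReal.ofReal_ne_top, fun f hf u v h => ?_⟩
    rw [ENNReal.ofReal_one, eLpNorm_one_eq_lintegral_enorm, mul_right_comm,
      ← lintegral_const_mul' _ _ (by finiteness)]
    refine lintegral_mono_ae ?_
    filter_upwards [hCu u v h] with x hx
    rw [mul_comm]
    gcongr
    rw [← ENNReal.ofReal_mul hC, ← ofReal_norm, ← ENNReal.ofReal_pow (norm_nonneg _)]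
    refine ENNReal.ofReal_le_ofReal (hx.trans ?_)
    calc _ ≤ C * √(sobolevSq u v) * √(sobolevSq u v) := by
          gcongr; exact integral_sq_le_sobolevSq u v
      _ = _ := by rw [mul_assoc, Real.mul_self_sqrt (sobolevSq_nonneg u v)]
  · have htc := Real.HolderConjugate.conjExponent ht
    set r := t.conjExponent with hr
    have hrv : r = t / (t - 1) := rfl
    have hr1 : 1 < r := htc.symm.lt
    have hr0 : 0 < r := by linarith
    obtain ⟨C, hC, hCu⟩ := lintegral_rpow_le_sobolevSq hn (s := 2 * r) (by linarith) (by
      intro _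
      rw [hrv, ← mul_div_assoc, div_mul_eq_mul_div, div_le_iff₀ (by linarith)]
      nlinarith)
    refine ⟨C ^ (1 / r), ENNReal.rpow_ne_top_of_nonneg (by positivity) hC, fun f hf u v h => ?_⟩
    have hH := ENNReal.lintegral_mul_le_Lp_mul_Lq volume htc hf.enorm
      (h.memLp.aestronglyMeasurable.enorm.pow_const 2)
    refine hH.trans ?_
    have e1 : (∫⁻ x, ‖f x‖ₑ ^ t) ^ (1 / t) = eLpNorm f (ENNReal.ofReal t) volume := by
      rw [eLpNorm_eq_lintegral_rpow_enorm_toReal (by simp; linarith) ENNReal.ofReal_ne_top,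
        ENNReal.toReal_ofReal (by linarith)]
    have e2 : (∫⁻ x, (‖u x‖ₑ ^ 2) ^ r) ^ (1 / r)
        ≤ C ^ (1 / r) * ENNReal.ofReal (sobolevSq u v) := by
      calc _ = (∫⁻ x, ‖u x‖ₑ ^ (2 * r)) ^ (1 / r) := by
            congr 1
            refine lintegral_congr fun x => ?_
            rw [← ENNReal.rpow_natCast, ← ENNReal.rpow_mul]
            norm_num
        _ ≤ (C * ENNReal.ofReal (sobolevSq u v) ^ (2 * r / 2)) ^ (1 / r) := by
            gcongr
            exact hCu u v h
        _ = _ := by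
            rw [ENNReal.mul_rpow_of_nonneg _ _ (by positivity), ← ENNReal.rpow_mul]
            congr 1
            rw [show 2 * r / 2 * (1 / r) = 1 by field_simp, ENNReal.rpow_one]
    rw [e1, mul_right_comm, mul_comm]
    gcongr

end Embedding

/-! ### Form bounded and form compact weights -/

section Weights

variable {n : ℕ}

/-- The quadratic form of the weight `f` is infinitesimally small with respect to the `H¹` norm, with
a power rate: `∫ |f| |u|² ≤ C (m ‖u‖_{L²}² + m^{-κ} ‖u‖_{H¹}²)` for all `m ≥ 1`. -/
def HasFormBound (f : Space n → ℝ) : Prop :=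
  ∃ C κ : ℝ, 0 ≤ C ∧ 0 < κ ∧ ∀ m : ℝ, 1 ≤ m →
    ∀ (u : Space n → ℂ) (v : Space n → EuclideanSpace ℂ (Fin n)), IsSobolev u v →
      Integrable (fun x => |f x| * ‖u x‖ ^ 2) ∧
      ∫ x, |f x| * ‖u x‖ ^ 2 ≤ C * (m * (∫ x, ‖u x‖ ^ 2) + m ^ (-κ) * sobolevSq u v)

/-- The quadratic form of the weight `f` is compact with respect to the `H¹` norm: up to an
arbitrarily small multiple of that norm it only sees the `L²` norm on a ball. -/
def IsFormCompact (f : Space n → ℝ) : Prop :=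
  ∀ ε : ℝ, 0 < ε → ∃ M R : ℝ, 0 ≤ M ∧ 0 < R ∧
    ∀ (u : Space n → ℂ) (v : Space n → EuclideanSpace ℂ (Fin n)), IsSobolev u v →
      Integrable (fun x => |f x| * ‖u x‖ ^ 2) ∧
      ∫ x, |f x| * ‖u x‖ ^ 2
        ≤ ε * sobolevSq u v + M * ∫ x in Metric.ball 0 R, ‖u x‖ ^ 2

theorem IsFormCompact.congr {f g : Space n → ℝ} (hf : IsFormCompact f) (h : f =ᵐ[volume] g) :
    IsFormCompact g := by
  intro ε hε
  obtain ⟨M, R, hM, hR, H⟩ := hf ε hε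
  refine ⟨M, R, hM, hR, fun u v huv => ?_⟩
  have e : (fun x => |f x| * ‖u x‖ ^ 2) =ᵐ[volume] fun x => |g x| * ‖u x‖ ^ 2 := by
    filter_upwards [h] with x hx
    rw [hx]
  obtain ⟨h1, h2⟩ := H u v huv
  exact ⟨h1.congr e, (integral_congr_ae e).symm.trans_le h2⟩

theorem integrable_weight_of_lintegral_le {f : Space n → ℝ} (hf : AEStronglyMeasurable f volume)
    {u : Space n → ℂ} (hu : AEStronglyMeasurable u volume) {B : ℝ} (hB : 0 ≤ B)
    (h : ∫⁻ x, ‖f x‖ₑ * ‖u x‖ₑ ^ 2 ≤ ENNReal.ofReal B) :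
    Integrable (fun x => |f x| * ‖u x‖ ^ 2) ∧ ∫ x, |f x| * ‖u x‖ ^ 2 ≤ B := by
  have hm : AEStronglyMeasurable (fun x => |f x| * ‖u x‖ ^ 2) volume :=
    hf.norm.mul (hu.norm.pow 2)
  have e : ∫⁻ x, ‖f x‖ₑ * ‖u x‖ₑ ^ 2 = ∫⁻ x, ENNReal.ofReal (|f x| * ‖u x‖ ^ 2) := by
    refine lintegral_congr fun x => ?_
    rw [ENNReal.ofReal_mul (abs_nonneg _), ENNReal.ofReal_pow (norm_nonneg _), ofReal_norm,
      ← Real.norm_eq_abs, ofReal_norm]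
  rw [e] at h
  refine ⟨⟨hm, ?_⟩, ?_⟩
  · rw [hasFiniteIntegral_iff_ofReal (.of_forall fun x => by positivity)]
    exact h.trans_lt ENNReal.ofReal_lt_top
  · rw [integral_eq_lintegral_of_nonneg_ae (.of_forall fun x => by positivity) hm]
    exact ENNReal.toReal_le_of_le_ofReal hB h

theorem integrable_weight_of_memLp (hn : 1 ≤ n) {t : ℝ} (ht : 1 ≤ t) (ht' : (n : ℝ) / 2 < t) :
    ∃ C : ℝ, 0 ≤ C ∧ ∀ f : Space n → ℝ, MemLp f (ENNReal.ofReal t) volume →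
    ∀ (u : Space n → ℂ) (v : Space n → EuclideanSpace ℂ (Fin n)), IsSobolev u v →
    Integrable (fun x => |f x| * ‖u x‖ ^ 2) ∧ ∫ x, |f x| * ‖u x‖ ^ 2
      ≤ C * (eLpNorm f (ENNReal.ofReal t) volume).toReal * sobolevSq u v := by
  obtain ⟨C, hC, H⟩ := lintegral_weight_le hn ht ht'
  refine ⟨C.toReal, ENNReal.toReal_nonneg, fun f hf u v h => ?_⟩
  refine integrable_weight_of_lintegral_le hf.1 h.memLp.1
    (by have := sobolevSq_nonneg u v; positivity) ((H f hf.1 u v h).trans (le_of_eq ?_))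
  rw [ENNReal.ofReal_mul (by positivity), ENNReal.ofReal_mul (by positivity),
    ENNReal.ofReal_toReal hC, ENNReal.ofReal_toReal hf.2.ne]

theorem abs_le_add_indicator (f : Space n → ℝ) {m : ℝ} (hm : 0 ≤ m) (x : Space n) :
    |f x| ≤ m + |{x | |f x| ≤ m}ᶜ.indicator f x| := by
  by_cases hx : |f x| ≤ m
  · exact hx.trans (le_add_of_nonneg_right (abs_nonneg _))
  · rw [Set.indicator_of_mem (by simpa using hx)]
    linarith

/-- Weights in `Lᵗ`, `t ≥ 1`, `t > n/2`, are form compact: truncate in height and in space. -/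
theorem isFormCompact_of_memLp (hn : 1 ≤ n) {t : ℝ} (ht : 1 ≤ t) (ht' : (n : ℝ) / 2 < t)
    {f : Space n → ℝ} (hf : MemLp f (ENNReal.ofReal t) volume) : IsFormCompact f := by
  wlog hm : Measurable f generalizing f
  · have h1 := this (hf.ae_eq hf.1.ae_eq_mk) hf.1.stronglyMeasurable_mk.measurable
    exact h1.congr hf.1.ae_eq_mk.symm
  intro ε hε
  obtain ⟨C, hC, H⟩ := integrable_weight_of_memLp hn ht ht'
  have ht0 : 0 < t := by linarith
  set s : ℕ → Set (Space n) := fun k => {x | |f x| ≤ k} ∩ Metric.ball 0 k with hs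
  have hsm : ∀ k, MeasurableSet (s k) := fun k =>
    (measurableSet_le hm.abs measurable_const).inter measurableSet_ball
  have hnorm : ∀ g : Space n → ℝ,
      eLpNorm g (ENNReal.ofReal t) volume = (∫⁻ x, ‖g x‖ₑ ^ t) ^ (1 / t) := fun g => by
    rw [eLpNorm_eq_lintegral_rpow_enorm_toReal (by simp; linarith) ENNReal.ofReal_ne_top,
      ENNReal.toReal_ofReal ht0.le]
  have hlim : Tendsto (fun k => (eLpNorm ((s k)ᶜ.indicator f) (ENNReal.ofReal t) volume).toReal)
      atTop (𝓝 0) := by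
    have h1 : Tendsto (fun k => ∫⁻ x, ‖(s k)ᶜ.indicator f x‖ₑ ^ t) atTop
        (𝓝 (∫⁻ _ : Space n, 0)) := by
      refine tendsto_lintegral_of_dominated_convergence (fun x => ‖f x‖ₑ ^ t)
        (fun k => ((hm.indicator (hsm k).compl).enorm.pow_const t))
        (fun k => .of_forall fun x => ?_) ?_ (.of_forall fun x => ?_)
      · refine ENNReal.rpow_le_rpow ?_ ht0.le
        by_cases hx : x ∈ (s k)ᶜ
        · rw [Set.indicator_of_mem hx]
        · rw [Set.indicator_of_notMem hx]; simp
      · exact (lintegral_rpow_enorm_lt_top_of_eLpNorm_lt_top (by simp; linarith)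
          ENNReal.ofReal_ne_top hf.2).ne |> fun h => by
            rwa [ENNReal.toReal_ofReal ht0.le] at h
      · refine tendsto_const_nhds.congr' ?_
        obtain ⟨k₀, hk₀⟩ := exists_nat_gt (max |f x| ‖x‖)
        filter_upwards [eventually_ge_atTop k₀] with k hk
        have hk' : max |f x| ‖x‖ < k := hk₀.trans_le (by exact_mod_cast hk)
        have hx : x ∈ s k := ⟨((le_max_left _ _).trans_lt hk').le, by
          simpa using (le_max_right _ _).trans_lt hk'⟩
        rw [Set.indicator_of_notMem (by simpa using hx)]
        simp [ht0]
    rw [lintegral_zero] at h1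
    have h2 := (ENNReal.continuous_rpow_const (y := 1 / t)).tendsto 0 |>.comp h1
    rw [ENNReal.zero_rpow_of_pos (by positivity)] at h2
    have h3 := (ENNReal.tendsto_toReal ENNReal.zero_ne_top).comp h2
    simp only [hnorm]
    simpa [Function.comp_def] using h3
  have hev : ∀ᶠ k : ℕ in atTop,
      C * (eLpNorm ((s k)ᶜ.indicator f) (ENNReal.ofReal t) volume).toReal < ε := by
    have := hlim.const_mul C
    rw [mul_zero] at this
    exact this.eventually_lt_const hε
  obtain ⟨k, hk, hk1⟩ := (hev.and (eventually_ge_atTop 1)).exists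
  refine ⟨k, k, by positivity, by exact_mod_cast hk1, fun u v h => ?_⟩
  obtain ⟨-, h2⟩ := H _ (hf.indicator (hsm k).compl) u v h
  obtain ⟨h1', -⟩ := H _ (hf.indicator (hsm k).compl) u v h
  obtain ⟨h1, -⟩ := H f hf u v h
  refine ⟨h1, ?_⟩
  have hpt : ∀ x, |f x| * ‖u x‖ ^ 2 ≤ |(s k)ᶜ.indicator f x| * ‖u x‖ ^ 2
      + (Metric.ball (0 : Space n) k).indicator (fun x => k * ‖u x‖ ^ 2) x := by
    intro x
    by_cases hx : x ∈ s k
    · rw [Set.indicator_of_notMem (by simpa using hx), Set.indicator_of_mem hx.2]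
      have : |f x| ≤ k := hx.1
      simp only [abs_zero, zero_mul, zero_add]
      gcongr
    · rw [Set.indicator_of_mem (by simpa using hx)]
      exact le_add_of_nonneg_right (Set.indicator_nonneg (fun _ _ => by positivity) _)
  have hi2 : Integrable ((Metric.ball (0 : Space n) k).indicator (fun x => k * ‖u x‖ ^ 2)) :=
    (h.integrable_sq.const_mul _).indicator measurableSet_ball
  calc ∫ x, |f x| * ‖u x‖ ^ 2
      ≤ ∫ x, (|(s k)ᶜ.indicator f x| * ‖u x‖ ^ 2
        + (Metric.ball (0 : Space n) k).indicator (fun x => k * ‖u x‖ ^ 2) x) :=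
        integral_mono h1 (h1'.add hi2) hpt
    _ = (∫ x, |(s k)ᶜ.indicator f x| * ‖u x‖ ^ 2)
        + k * ∫ x in Metric.ball 0 k, ‖u x‖ ^ 2 := by
        rw [integral_add h1' hi2, integral_indicator measurableSet_ball, integral_const_mul]
    _ ≤ _ := by
        gcongr
        exact h2.trans (mul_le_mul_of_nonneg_right hk.le (sobolevSq_nonneg u v))

theorem ae_abs_le_of_memLp_top {f : Space n → ℝ} (hf : MemLp f ⊤ volume) :
    ∃ K : ℝ, 0 ≤ K ∧ ∀ᵐ x, |f x| ≤ K := by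
  refine ⟨(eLpNormEssSup f volume).toReal, ENNReal.toReal_nonneg, ?_⟩
  have h2 := hf.2
  rw [eLpNorm_exponent_top] at h2
  filter_upwards [enorm_ae_le_eLpNormEssSup f volume] with x hx
  simpa using ENNReal.toReal_mono h2.ne hx

/-- Bounded weights are form bounded, with the `L²` norm alone. -/
theorem integrable_weight_of_memLp_top {f : Space n → ℝ} (hf : MemLp f ⊤ volume) :
    ∃ K : ℝ, 0 ≤ K ∧ ∀ (u : Space n → ℂ) (v : Space n → EuclideanSpace ℂ (Fin n)), IsSobolev u v →
    Integrable (fun x => |f x| * ‖u x‖ ^ 2) ∧ ∫ x, |f x| * ‖u x‖ ^ 2 ≤ K * ∫ x, ‖u x‖ ^ 2 := by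
  obtain ⟨K, hK0, hK⟩ := ae_abs_le_of_memLp_top hf
  refine ⟨K, hK0, fun u v h => ?_⟩
  have hint : Integrable (fun x => |f x| * ‖u x‖ ^ 2) := by
    refine (h.integrable_sq.const_mul K).mono' (hf.1.norm.mul (h.memLp.1.norm.pow 2)) ?_
    filter_upwards [hK] with x hx
    rw [Real.norm_of_nonneg (by positivity)]
    gcongr
  refine ⟨hint, ?_⟩
  rw [← integral_const_mul]
  refine integral_mono_ae hint (h.integrable_sq.const_mul K) ?_
  filter_upwards [hK] with x hx
  gcongr

/-- The endpoint `q = 1` on the line, where Agmon's inequality gives the rate `m⁻¹`. -/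
theorem hasFormBound_of_memLp_one {f : Space 1 → ℝ} (hf : MemLp f 1 volume) : HasFormBound f := by
  obtain ⟨C, hC, hCu⟩ := ae_norm_sq_le_of_line
  have hfi : Integrable (fun x => |f x|) := (memLp_one_iff_integrable.1 hf).abs
  have hF : 0 ≤ ∫ x, |f x| := integral_nonneg fun _ => abs_nonneg _
  refine ⟨C * ∫ x, |f x|, 1, by positivity, one_pos, fun m hm u v h => ?_⟩
  have hm0 : 0 < m := by linarith
  have hA : 0 ≤ ∫ x, ‖u x‖ ^ 2 := integral_nonneg fun _ => by positivity
  have hS := sobolevSq_nonneg u v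
  set B := C * √(∫ x, ‖u x‖ ^ 2) * √(sobolevSq u v) with hB
  have hae := hCu u v h
  have hint : Integrable (fun x => |f x| * ‖u x‖ ^ 2) := by
    refine (hfi.mul_const B).mono' (hf.1.norm.mul (h.memLp.1.norm.pow 2)) ?_
    filter_upwards [hae] with x hx
    rw [Real.norm_of_nonneg (by positivity)]
    gcongr
  refine ⟨hint, ?_⟩
  have h1 : ∫ x, |f x| * ‖u x‖ ^ 2 ≤ (∫ x, |f x|) * B := by
    rw [← integral_mul_const]
    refine integral_mono_ae hint (hfi.mul_const B) ?_
    filter_upwards [hae] with x hx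
    gcongr
  -- Young's inequality with weight `m`
  have h2 : √(∫ x, ‖u x‖ ^ 2) * √(sobolevSq u v)
      ≤ m * (∫ x, ‖u x‖ ^ 2) + m ^ (-1 : ℝ) * sobolevSq u v := by
    rw [Real.rpow_neg_one]
    have ha := Real.sq_sqrt hA
    have hb := Real.sq_sqrt hS
    set a := √(∫ x, ‖u x‖ ^ 2)
    set b := √(sobolevSq u v)
    rw [← ha, ← hb]
    have h3 : 0 ≤ m * (a - m⁻¹ * b) ^ 2 := by positivity
    have h4 : m * (a - m⁻¹ * b) ^ 2 = m * a ^ 2 + m⁻¹ * b ^ 2 - 2 * (a * b) := by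
      field_simp
      ring
    have h5 : 0 ≤ a * b := by positivity
    linarith
  calc _ ≤ (∫ x, |f x|) * B := h1
    _ = C * (∫ x, |f x|) * (√(∫ x, ‖u x‖ ^ 2) * √(sobolevSq u v)) := by rw [hB]; ring
    _ ≤ _ := by gcongr

/-- Weights in `Lᵗ` are infinitesimally form bounded: the part of `f` above height `m` is small in
a slightly weaker Lebesgue space. -/
theorem hasFormBound_of_memLp (hn : 1 ≤ n) {t : ℝ} (ht : 1 ≤ t) (ht' : (n : ℝ) / 2 < t)
    {f : Space n → ℝ} (hf : MemLp f (ENNReal.ofReal t) volume) : HasFormBound f := by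
  rcases ht.eq_or_lt with rfl | ht1
  · have hn1 : n = 1 := by
      have : (n : ℝ) < 2 := by linarith
      have : n < 2 := by exact_mod_cast this
      omega
    subst hn1
    exact hasFormBound_of_memLp_one (by simpa using hf)
  wlog hm : Measurable f generalizing f
  · obtain ⟨C, κ, hC, hκ, h1⟩ :=
      this (hf.ae_eq hf.1.ae_eq_mk) hf.1.stronglyMeasurable_mk.measurable
    refine ⟨C, κ, hC, hκ, fun m hm u v huv => ?_⟩
    have e : (fun x => |hf.1.mk f x| * ‖u x‖ ^ 2) =ᵐ[volume] fun x => |f x| * ‖u x‖ ^ 2 := by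
      filter_upwards [hf.1.ae_eq_mk] with x hx
      rw [hx]
    obtain ⟨h2, h3⟩ := h1 m hm u v huv
    exact ⟨h2.congr e, (integral_congr_ae e).symm.trans_le h3⟩
  -- the room between `t₀` and `t` is what produces the rate `m^{-κ}`
  obtain ⟨t₀, ht₀, ht₀t⟩ := exists_between (max_lt ht1 ht')
  have ht₀1 : 1 < t₀ := (le_max_left _ _).trans_lt ht₀
  obtain ⟨C, hC, H⟩ := integrable_weight_of_memLp hn ht₀1.le ((le_max_right _ _).trans_lt ht₀)
  obtain ⟨C₁, hC₁, H₁⟩ := integrable_weight_of_memLp hn ht ht'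
  have ht₀0 : 0 < t₀ := by linarith
  have htpos : 0 < t := by linarith
  set F := ∫⁻ x, ‖f x‖ₑ ^ t with hF
  have hFtop : F ≠ ⊤ := by
    have := lintegral_rpow_enorm_lt_top_of_eLpNorm_lt_top (by simp; linarith)
      ENNReal.ofReal_ne_top hf.2
    rw [ENNReal.toReal_ofReal htpos.le] at this
    exact this.ne
  set κ := (t - t₀) / t₀ with hκ
  have hκ0 : 0 < κ := div_pos (by linarith) ht₀0
  refine ⟨1 + C * (F ^ (1 / t₀)).toReal, κ, by positivity, hκ0, fun m hm1 u v h => ?_⟩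
  have hm0 : 0 < m := by linarith
  set g := {x | |f x| ≤ m}ᶜ.indicator f with hg
  have hgm : MeasurableSet {x | |f x| ≤ m}ᶜ := (measurableSet_le hm.abs measurable_const).compl
  have hgE : eLpNorm g (ENNReal.ofReal t₀) volume
      ≤ ENNReal.ofReal (m ^ (-κ)) * F ^ (1 / t₀) := by
    rw [eLpNorm_eq_lintegral_rpow_enorm_toReal (by simp; linarith) ENNReal.ofReal_ne_top,
      ENNReal.toReal_ofReal ht₀0.le]
    have hpt : ∀ x, ‖g x‖ₑ ^ t₀ ≤ ENNReal.ofReal (m ^ (-(t - t₀))) * ‖f x‖ₑ ^ t := by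
      intro x
      by_cases hx : x ∈ {x | |f x| ≤ m}ᶜ
      · rw [hg, Set.indicator_of_mem hx]
        have hx' : m < |f x| := by simpa using hx
        have hfx : 0 < |f x| := hm0.trans hx'
        rw [← ofReal_norm, Real.norm_eq_abs, ENNReal.ofReal_rpow_of_pos hfx,
          ENNReal.ofReal_rpow_of_pos hfx, ← ENNReal.ofReal_mul (by positivity)]
        refine ENNReal.ofReal_le_ofReal ?_
        have h1 : |f x| ^ t = |f x| ^ (t - t₀) * |f x| ^ t₀ := by
          rw [← Real.rpow_add hfx]; congr 1; ring
        rw [h1, ← mul_assoc, Real.rpow_neg hm0.le]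
        refine le_mul_of_one_le_left (by positivity) ?_
        rw [inv_mul_eq_div, one_le_div (by positivity)]
        exact Real.rpow_le_rpow hm0.le hx'.le (by linarith)
      · rw [hg, Set.indicator_of_notMem hx]
        simp [ht₀0]
    calc _ ≤ (∫⁻ x, ENNReal.ofReal (m ^ (-(t - t₀))) * ‖f x‖ₑ ^ t) ^ (1 / t₀) := by
          gcongr with x
          exact hpt x
      _ = (ENNReal.ofReal (m ^ (-(t - t₀))) * F) ^ (1 / t₀) := by
          rw [lintegral_const_mul' _ _ ENNReal.ofReal_ne_top]
      _ = _ := by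
          rw [ENNReal.mul_rpow_of_nonneg _ _ (by positivity),
            ENNReal.ofReal_rpow_of_pos (by positivity), ← Real.rpow_mul hm0.le, hκ]
          congr 3
          field_simp
  have hg2 : MemLp g (ENNReal.ofReal t₀) volume := by
    refine ⟨(hm.indicator hgm).aestronglyMeasurable, hgE.trans_lt ?_⟩
    exact ENNReal.mul_lt_top ENNReal.ofReal_lt_top
      (ENNReal.rpow_lt_top_of_nonneg (by positivity) hFtop)
  obtain ⟨h1, -⟩ := H₁ f hf u v h
  obtain ⟨h2, h3⟩ := H g hg2 u v h
  refine ⟨h1, ?_⟩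
  have hS := sobolevSq_nonneg u v
  have hA : 0 ≤ ∫ x, ‖u x‖ ^ 2 := integral_nonneg fun _ => by positivity
  have hgE' : (eLpNorm g (ENNReal.ofReal t₀) volume).toReal ≤ m ^ (-κ) * (F ^ (1 / t₀)).toReal := by
    have := ENNReal.toReal_mono (ENNReal.mul_ne_top ENNReal.ofReal_ne_top
      (ENNReal.rpow_ne_top_of_nonneg (by positivity) hFtop)) hgE
    rwa [ENNReal.toReal_mul, ENNReal.toReal_ofReal (by positivity)] at this
  calc ∫ x, |f x| * ‖u x‖ ^ 2 ≤ ∫ x, (m * ‖u x‖ ^ 2 + |g x| * ‖u x‖ ^ 2) := by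
        refine integral_mono h1 ((h.integrable_sq.const_mul m).add h2) fun x => ?_
        simp only
        rw [← add_mul]
        gcongr
        exact abs_le_add_indicator f hm0.le x
    _ = m * (∫ x, ‖u x‖ ^ 2) + ∫ x, |g x| * ‖u x‖ ^ 2 := by
        rw [integral_add (h.integrable_sq.const_mul m) h2, integral_const_mul]
    _ ≤ m * (∫ x, ‖u x‖ ^ 2) + C * (m ^ (-κ) * (F ^ (1 / t₀)).toReal) * sobolevSq u v := by
        gcongr
        exact h3.trans (by gcongr)
    _ ≤ _ := by
        have e1 : 0 ≤ C * (F ^ (1 / t₀)).toReal * (m * ∫ x, ‖u x‖ ^ 2) := by positivity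
        have e2 : 0 ≤ m ^ (-κ) * sobolevSq u v := by positivity
        nlinarith

/-- Weights in `L^q + L^∞` are infinitesimally form bounded. -/
theorem MemLqAddLinfty.hasFormBound (hn : 1 ≤ n) {q : ℝ} (hq : 1 ≤ q) (hq' : (n : ℝ) / 2 < q)
    {f : Space n → ℝ} (hf : MemLqAddLinfty q f) : HasFormBound f := by
  obtain ⟨f₁, f₂, h₁, h₂, rfl⟩ := hf
  obtain ⟨C, κ, hC, hκ, H⟩ := hasFormBound_of_memLp hn hq hq' h₁
  obtain ⟨K, hK, H'⟩ := integrable_weight_of_memLp_top h₂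
  refine ⟨C + K, κ, by positivity, hκ, fun m hm u v h => ?_⟩
  obtain ⟨a1, a2⟩ := H m hm u v h
  obtain ⟨b1, b2⟩ := H' u v h
  have hpt : ∀ x, |(f₁ + f₂) x| * ‖u x‖ ^ 2 ≤ |f₁ x| * ‖u x‖ ^ 2 + |f₂ x| * ‖u x‖ ^ 2 := by
    intro x
    rw [← add_mul]
    gcongr
    exact abs_add_le _ _
  have hint : Integrable (fun x => |(f₁ + f₂) x| * ‖u x‖ ^ 2) := by
    refine (a1.add b1).mono' ((h₁.1.add h₂.1).norm.mul (h.memLp.1.norm.pow 2))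
      (.of_forall fun x => ?_)
    rw [Real.norm_of_nonneg (by positivity)]
    exact hpt x
  refine ⟨hint, ?_⟩
  have hS := sobolevSq_nonneg u v
  have hA : 0 ≤ ∫ x, ‖u x‖ ^ 2 := integral_nonneg fun _ => by positivity
  calc _ ≤ (∫ x, |f₁ x| * ‖u x‖ ^ 2) + ∫ x, |f₂ x| * ‖u x‖ ^ 2 := by
        rw [← integral_add a1 b1]
        exact integral_mono hint (a1.add b1) hpt
    _ ≤ C * (m * (∫ x, ‖u x‖ ^ 2) + m ^ (-κ) * sobolevSq u v) + K * ∫ x, ‖u x‖ ^ 2 :=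
        add_le_add a2 b2
    _ ≤ _ := by
        have e1 : 0 ≤ K * (m ^ (-κ) * sobolevSq u v) := by positivity
        have e2 : 0 ≤ K * ((m - 1) * ∫ x, ‖u x‖ ^ 2) :=
          mul_nonneg hK (mul_nonneg (by linarith) hA)
        nlinarith

/-- Weights in `L^q + L^∞` that vanish at infinity are form compact. The bounded summand need not
vanish at infinity; outside a large ball the weight itself is small. -/
theorem MemLqAddLinfty.isFormCompact (hn : 1 ≤ n) {q : ℝ} (hq : 1 ≤ q) (hq' : (n : ℝ) / 2 < q)
    {f : Space n → ℝ} (hf : MemLqAddLinfty q f) (h0 : Tendsto f (cocompact (Space n)) (𝓝 0)) :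
    IsFormCompact f := by
  have hfb := hf.hasFormBound hn hq hq'
  obtain ⟨f₁, f₂, h₁, h₂, rfl⟩ := hf
  intro ε hε
  obtain ⟨M, R, hM, hR, H⟩ := isFormCompact_of_memLp hn hq hq' h₁ (ε / 2) (by positivity)
  have hev : ∀ᶠ x in cocompact (Space n), |(f₁ + f₂) x| < ε / 2 := by
    have := h0.abs
    rw [abs_zero] at this
    exact this.eventually_lt_const (by positivity)
  obtain ⟨R₁, hR₁, hR₁'⟩ : ∃ R₁ : ℝ, 0 < R₁ ∧ ∀ x, R₁ ≤ ‖x‖ → |(f₁ + f₂) x| < ε / 2 := by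
    rw [Metric.cobounded_eq_cocompact.symm] at hev
    obtain ⟨r, -, hr⟩ := (Metric.hasBasis_cobounded_compl_closedBall (0 : Space n)).eventually_iff.1 hev
    refine ⟨max r 0 + 1, by positivity, fun x hx => hr ?_⟩
    simp only [Set.mem_compl_iff, Metric.mem_closedBall, dist_zero_right, not_le]
    linarith [le_max_left r 0]
  obtain ⟨K, hK0, hK⟩ := ae_abs_le_of_memLp_top h₂
  set ρ := max R R₁ with hρ
  refine ⟨M + K, ρ, by positivity, lt_max_of_lt_left hR, fun u v h => ?_⟩
  obtain ⟨C, κ, -, -, Hb⟩ := hfb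
  have hint := (Hb 1 le_rfl u v h).1
  refine ⟨hint, ?_⟩
  obtain ⟨a1, a2⟩ := H u v h
  have hi2 : Integrable ((Metric.ball (0 : Space n) ρ).indicator (fun x => K * ‖u x‖ ^ 2)) :=
    (h.integrable_sq.const_mul _).indicator measurableSet_ball
  have hi3 : Integrable fun x => ε / 2 * ‖u x‖ ^ 2 := h.integrable_sq.const_mul _
  have hpt : ∀ᵐ x, |(f₁ + f₂) x| * ‖u x‖ ^ 2 ≤ |f₁ x| * ‖u x‖ ^ 2
      + ((Metric.ball (0 : Space n) ρ).indicator (fun x => K * ‖u x‖ ^ 2) x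
        + ε / 2 * ‖u x‖ ^ 2) := by
    filter_upwards [hK] with x hx
    have hu2 : 0 ≤ ‖u x‖ ^ 2 := by positivity
    by_cases hxb : x ∈ Metric.ball (0 : Space n) ρ
    · rw [Set.indicator_of_mem hxb]
      have h1 : |(f₁ + f₂) x| ≤ |f₁ x| + K :=
        (abs_add_le _ _).trans (by gcongr)
      have h2 := mul_le_mul_of_nonneg_right h1 hu2
      have h3 : 0 ≤ ε / 2 * ‖u x‖ ^ 2 := by positivity
      linarith
    · rw [Set.indicator_of_notMem hxb]
      have hxn : R₁ ≤ ‖x‖ := by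
        have : ρ ≤ ‖x‖ := by simpa using hxb
        exact (le_max_right _ _).trans this
      have h2 := mul_le_mul_of_nonneg_right (hR₁' x hxn).le hu2
      have h3 : 0 ≤ |f₁ x| * ‖u x‖ ^ 2 := by positivity
      linarith
  have hball : ∫ x in Metric.ball 0 R, ‖u x‖ ^ 2 ≤ ∫ x in Metric.ball 0 ρ, ‖u x‖ ^ 2 :=
    setIntegral_mono_set h.integrable_sq.integrableOn (.of_forall fun x => by positivity)
      (Metric.ball_subset_ball (le_max_left _ _)).eventuallyLE
  calc _ ≤ (∫ x, |f₁ x| * ‖u x‖ ^ 2)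
        + (K * (∫ x in Metric.ball 0 ρ, ‖u x‖ ^ 2) + ε / 2 * ∫ x, ‖u x‖ ^ 2) := by
        refine (integral_mono_ae hint (a1.add (hi2.add hi3)) hpt).trans (le_of_eq ?_)
        have e1 := integral_add a1 (hi2.add hi3)
        have e2 := integral_add hi2 hi3
        simp only [Pi.add_apply] at e1 e2 ⊢
        rw [e1, e2, integral_indicator measurableSet_ball, integral_const_mul,
          integral_const_mul]
    _ ≤ (ε / 2 * sobolevSq u v + M * ∫ x in Metric.ball 0 ρ, ‖u x‖ ^ 2)
        + (K * (∫ x in Metric.ball 0 ρ, ‖u x‖ ^ 2) + ε / 2 * sobolevSq u v) := by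
        gcongr
        · exact a2.trans (by gcongr)
        · exact integral_sq_le_sobolevSq u v
    _ = _ := by ring

end Weights

/-! ### Convexity of `|z|^(p+2)` -/

section Power

/-- Young's inequality in the form of the tangent line inequality for `x ↦ x ^ s`. -/
theorem mul_rpow_le_of_one_lt {s x y : ℝ} (hs : 1 < s) (hx : 0 ≤ x) (hy : 0 ≤ y) :
    s * (y ^ (s - 1) * x) ≤ x ^ s + (s - 1) * y ^ s := by
  have hc := Real.HolderConjugate.conjExponent hs
  have h := Real.young_inequality_of_nonneg hx (Real.rpow_nonneg hy (s - 1)) hc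
  have hs0 : 0 < s := by linarith
  have e : (y ^ (s - 1)) ^ s.conjExponent = y ^ s := by
    rw [← Real.rpow_mul hy]
    congr 1
    have : s - 1 ≠ 0 := by linarith
    rw [Real.conjExponent]
    field_simp
  rw [e, Real.conjExponent] at h
  have h' := mul_le_mul_of_nonneg_left h hs0.le
  have hs1 : s - 1 ≠ 0 := by linarith
  calc _ = s * (x * y ^ (s - 1)) := by ring
    _ ≤ _ := h'
    _ = _ := by field_simp

theorem re_mul_star_le (a b : ℂ) : (a * star b).re ≤ ‖a‖ * ‖b‖ :=
  (Complex.re_le_norm _).trans (by rw [norm_mul, norm_star])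

theorem re_mul_star_self (a : ℂ) : (a * star a).re = ‖a‖ ^ 2 := by
  rw [← Complex.normSq_eq_norm_sq, Complex.normSq_apply]
  simp

theorem re_mul_star_comm (a b : ℂ) : (a * star b).re = (b * star a).re := by
  simp
  ring

theorem rpow_mul_sq {x p : ℝ} (hx : 0 ≤ x) (hp : 0 < p) : x ^ p * x ^ 2 = x ^ (p + 2) := by
  rw [Real.rpow_add_of_nonneg hx hp.le (by norm_num)]
  norm_num

/-- Second-order remainder in the Taylor expansion of `b ↦ |b|^(p+2)` at `a`. -/
noncomputable def powerRemainder (p : ℝ) (a b : ℂ) : ℝ :=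
  ‖b‖ ^ (p + 2) - ‖a‖ ^ (p + 2) - (p + 2) * (‖a‖ ^ p * (a * star (b - a)).re)

theorem powerRemainder_eq {p : ℝ} (hp : 0 < p) (a b : ℂ) : powerRemainder p a b
    = ‖b‖ ^ (p + 2) + (p + 1) * ‖a‖ ^ (p + 2) - (p + 2) * (‖a‖ ^ p * (a * star b).re) := by
  have : (a * star (b - a)).re = (a * star b).re - ‖a‖ ^ 2 := by
    rw [star_sub, mul_sub, Complex.sub_re, re_mul_star_self]
  rw [powerRemainder, this, mul_sub, rpow_mul_sq (norm_nonneg a) hp]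
  ring

/-- Convexity of `|z|^(p+2)`. -/
theorem powerRemainder_nonneg {p : ℝ} (hp : 0 < p) (a b : ℂ) : 0 ≤ powerRemainder p a b := by
  rw [powerRemainder_eq hp]
  have h1 := mul_rpow_le_of_one_lt (s := p + 2) (by linarith) (norm_nonneg b) (norm_nonneg a)
  have h2 : ‖a‖ ^ p * (a * star b).re ≤ ‖a‖ ^ (p + 2 - 1) * ‖b‖ := by
    have : ‖a‖ ^ (p + 2 - 1) = ‖a‖ ^ p * ‖a‖ := by
      rw [show p + 2 - 1 = p + 1 by ring, Real.rpow_add_of_nonneg (norm_nonneg a) hp.le zero_le_one,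
        Real.rpow_one]
    rw [this, mul_assoc]
    gcongr
    exact re_mul_star_le a b
  nlinarith

theorem norm_rpow_smul_sub_le {p : ℝ} (hp : 0 < p) (a b : ℂ) :
    ‖(‖b‖ ^ p) • b - (‖a‖ ^ p) • a‖ ≤ (p + 2) * (‖a‖ ^ p + ‖b‖ ^ p) * ‖b - a‖ := by
  wlog h : ‖a‖ ≤ ‖b‖ generalizing a b
  · have := this b a (le_of_not_ge h)
    rwa [norm_sub_rev, norm_sub_rev a b, add_comm (‖b‖ ^ p)] at this
  have hx := norm_nonneg a
  have hy := norm_nonneg b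
  have e : (‖b‖ ^ p) • b - (‖a‖ ^ p) • a = (‖b‖ ^ p) • (b - a) + (‖b‖ ^ p - ‖a‖ ^ p) • a := by
    rw [smul_sub, sub_smul]
    abel
  have hmono : ‖a‖ ^ p ≤ ‖b‖ ^ p := Real.rpow_le_rpow hx h hp.le
  have h1 := mul_rpow_le_of_one_lt (s := p + 1) (by linarith) hx hy
  rw [show p + 1 - 1 = p by ring, Real.rpow_add_of_nonneg hx hp.le zero_le_one,
    Real.rpow_add_of_nonneg hy hp.le zero_le_one, Real.rpow_one, Real.rpow_one] at h1
  have h2 : (‖b‖ ^ p - ‖a‖ ^ p) * ‖a‖ ≤ (p + 1) * ‖b‖ ^ p * ‖b - a‖ := by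
    have h3 : ‖b‖ - ‖a‖ ≤ ‖b - a‖ := norm_sub_norm_le b a
    have h4 : 0 ≤ (p + 1) * ‖b‖ ^ p := by positivity
    have h5 := mul_le_mul_of_nonneg_left h3 h4
    have h6 : 0 ≤ ‖b‖ ^ p * (‖b‖ - ‖a‖) := mul_nonneg (by positivity) (by linarith)
    nlinarith
  have h0 : 0 ≤ ‖a‖ ^ p * ‖b - a‖ := by positivity
  calc _ ≤ ‖b‖ ^ p * ‖b - a‖ + (‖b‖ ^ p - ‖a‖ ^ p) * ‖a‖ := by
        rw [e]
        refine (norm_add_le _ _).trans (le_of_eq ?_)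
        rw [norm_smul, norm_smul, Real.norm_of_nonneg (by positivity),
          Real.norm_of_nonneg (by linarith)]
    _ ≤ _ := by nlinarith

/-- The remainder is at most the sum of the remainders in both directions, which is a pairing of the
increment of the derivative with the increment of the argument. -/
theorem powerRemainder_le {p : ℝ} (hp : 0 < p) (a b : ℂ) :
    powerRemainder p a b ≤ (p + 2) ^ 2 * ((‖a‖ ^ p + ‖b‖ ^ p) * ‖b - a‖ ^ 2) := by
  have h1 := powerRemainder_nonneg hp b a
  have h2 : powerRemainder p a b + powerRemainder p b a
      = (p + 2) * (((‖b‖ ^ p) • b - (‖a‖ ^ p) • a) * star (b - a)).re := by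
    simp only [powerRemainder, star_sub, mul_sub, sub_mul, Complex.sub_re, smul_mul_assoc,
      Complex.smul_re, smul_eq_mul]
    ring
  have h3 := re_mul_star_le ((‖b‖ ^ p) • b - (‖a‖ ^ p) • a) (b - a)
  have h4 := mul_le_mul_of_nonneg_right (norm_rpow_smul_sub_le hp a b) (norm_nonneg (b - a))
  have h5 := mul_le_mul_of_nonneg_left (h3.trans h4) (show 0 ≤ p + 2 by linarith)
  calc _ ≤ powerRemainder p a b + powerRemainder p b a := by linarith
    _ ≤ _ := h2.trans_le h5
    _ = _ := by ring

end Power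

/-! ### The weight `|u|^p` in the subcritical range -/

section Nonlinearity

variable {n : ℕ} {p : ℝ}

/-- Subcriticality says that `|u|^p` belongs to an admissible Lebesgue space `Lᵗ`, `t > n/2`. -/
theorem exponent_condition (hp : 0 < p) (hp' : 3 ≤ n → p < 4 / ((n : ℝ) - 2)) :
    (n : ℝ) / 2 < (p + 2) / p ∧ 0 < (2 - (n : ℝ)) * p + 4 := by
  have h : 0 < (2 - (n : ℝ)) * p + 4 := by
    by_cases hn : 3 ≤ n
    · have h3 : (3 : ℝ) ≤ n := by exact_mod_cast hn
      have := (lt_div_iff₀ (by linarith)).1 (hp' hn)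
      linarith
    · have h3 : (n : ℝ) ≤ 2 := by exact_mod_cast (by omega : n ≤ 2)
      nlinarith
  refine ⟨?_, h⟩
  rw [div_lt_div_iff₀ (by norm_num) hp]
  linarith

/-- The Sobolev embedding `H¹ ⊂ L^{p+2}`, phrased for the weight `|u|^p ∈ L^{(p+2)/p}`. -/
theorem memLp_norm_rpow (hn : 1 ≤ n) (hp : 0 < p) (hp' : 3 ≤ n → p < 4 / ((n : ℝ) - 2)) :
    ∃ C : ℝ, 0 ≤ C ∧ ∀ (u : Space n → ℂ) (v : Space n → EuclideanSpace ℂ (Fin n)), IsSobolev u v →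
      MemLp (fun x => ‖u x‖ ^ p) (ENNReal.ofReal ((p + 2) / p)) volume ∧
      (eLpNorm (fun x => ‖u x‖ ^ p) (ENNReal.ofReal ((p + 2) / p)) volume).toReal
        ≤ C * √(sobolevSq u v) ^ p := by
  obtain ⟨C, hC, H⟩ := lintegral_rpow_le_sobolevSq hn (s := p + 2) (by linarith) (by
    intro h3
    have := (exponent_condition hp hp').2
    linarith)
  have hp2 : 0 < p + 2 := by linarith
  have hq : 0 < (p + 2) / p := by positivity
  refine ⟨(C ^ (p / (p + 2))).toReal, ENNReal.toReal_nonneg, fun u v h => ?_⟩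
  have hm : AEStronglyMeasurable (fun x => ‖u x‖ ^ p) volume :=
    (h.memLp.1.norm.aemeasurable.pow_const p).aestronglyMeasurable
  have hle : eLpNorm (fun x => ‖u x‖ ^ p) (ENNReal.ofReal ((p + 2) / p)) volume
      ≤ C ^ (p / (p + 2)) * ENNReal.ofReal (√(sobolevSq u v) ^ p) := by
    rw [eLpNorm_eq_lintegral_rpow_enorm_toReal (by simpa using hq) ENNReal.ofReal_ne_top,
      ENNReal.toReal_ofReal hq.le]
    calc _ = (∫⁻ x, ‖u x‖ₑ ^ (p + 2)) ^ (p / (p + 2)) := by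
          rw [one_div_div]
          congr 1
          refine lintegral_congr fun x => ?_
          rw [Real.enorm_rpow_of_nonneg (norm_nonneg _) hp.le, enorm_norm, ← ENNReal.rpow_mul]
          congr 1
          field_simp
      _ ≤ (C * ENNReal.ofReal (sobolevSq u v) ^ ((p + 2) / 2)) ^ (p / (p + 2)) := by
          gcongr
          exact H u v h
      _ = _ := by
          rw [ENNReal.mul_rpow_of_nonneg _ _ (by positivity), ← ENNReal.rpow_mul,
            Real.sqrt_eq_rpow, ← Real.rpow_mul (sobolevSq_nonneg u v),
            ENNReal.ofReal_rpow_of_nonneg (sobolevSq_nonneg u v) (by positivity)]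
          congr 3
          field_simp
  have hCt : C ^ (p / (p + 2)) ≠ ⊤ := ENNReal.rpow_ne_top_of_nonneg (by positivity) hC
  refine ⟨⟨hm, hle.trans_lt (ENNReal.mul_lt_top hCt.lt_top ENNReal.ofReal_lt_top)⟩, ?_⟩
  have := ENNReal.toReal_mono (ENNReal.mul_ne_top hCt ENNReal.ofReal_ne_top) hle
  rwa [ENNReal.toReal_mul, ENNReal.toReal_ofReal (by positivity)] at this

/-- `|u|^p` is form bounded, by Hölder's inequality and the Sobolev embedding. -/
theorem integrable_power_weight (hn : 1 ≤ n) (hp : 0 < p)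
    (hp' : 3 ≤ n → p < 4 / ((n : ℝ) - 2)) :
    ∃ C : ℝ, 0 ≤ C ∧ ∀ (u : Space n → ℂ) (v : Space n → EuclideanSpace ℂ (Fin n)), IsSobolev u v →
      ∀ (w : Space n → ℂ) (z : Space n → EuclideanSpace ℂ (Fin n)), IsSobolev w z →
      Integrable (fun x => ‖u x‖ ^ p * ‖w x‖ ^ 2) ∧
      ∫ x, ‖u x‖ ^ p * ‖w x‖ ^ 2 ≤ C * √(sobolevSq u v) ^ p * sobolevSq w z := by
  obtain ⟨C, hC, H⟩ := memLp_norm_rpow hn hp hp'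
  obtain ⟨K, hK, H'⟩ := integrable_weight_of_memLp hn (t := (p + 2) / p)
    (by rw [le_div_iff₀ hp]; linarith) (exponent_condition hp hp').1
  refine ⟨K * C, by positivity, fun u v h w z h' => ?_⟩
  obtain ⟨h1, h2⟩ := H u v h
  obtain ⟨h3, h4⟩ := H' _ h1 w z h'
  have e : ∀ x, |‖u x‖ ^ p| = ‖u x‖ ^ p := fun x => abs_of_nonneg (by positivity)
  simp only [e] at h3 h4
  refine ⟨h3, h4.trans ?_⟩
  have := sobolevSq_nonneg w z
  rw [mul_assoc K C]
  gcongr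

theorem isFormCompact_norm_rpow (hn : 1 ≤ n) (hp : 0 < p)
    (hp' : 3 ≤ n → p < 4 / ((n : ℝ) - 2)) {u : Space n → ℂ}
    {v : Space n → EuclideanSpace ℂ (Fin n)} (h : IsSobolev u v) :
    IsFormCompact fun x => ‖u x‖ ^ p := by
  obtain ⟨C, -, H⟩ := memLp_norm_rpow hn hp hp'
  exact isFormCompact_of_memLp hn (by rw [le_div_iff₀ hp]; linarith)
    (exponent_condition hp hp').1 (H u v h).1

theorem integrable_norm_rpow_add_two (hn : 1 ≤ n) (hp : 0 < p)
    (hp' : 3 ≤ n → p < 4 / ((n : ℝ) - 2)) {u : Space n → ℂ}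
    {v : Space n → EuclideanSpace ℂ (Fin n)} (h : IsSobolev u v) :
    Integrable fun x => ‖u x‖ ^ (p + 2) := by
  obtain ⟨C, -, H⟩ := integrable_power_weight hn hp hp'
  simpa only [rpow_mul_sq (norm_nonneg _) hp] using (H u v h u v h).1

end Nonlinearity

/-! ### The weak equation in real form and the energy identity -/

section CoherentState

variable {n : ℕ} {p γ E : ℝ} {V : Space n → ℝ}

theorem integrable_weight_mul_re {f : Space n → ℝ} {u w : Space n → ℂ}
    (hf : AEStronglyMeasurable f volume) (hu : AEStronglyMeasurable u volume)
    (hw : AEStronglyMeasurable w volume) (h1 : Integrable fun x => |f x| * ‖u x‖ ^ 2)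
    (h2 : Integrable fun x => |f x| * ‖w x‖ ^ 2) :
    Integrable fun x => (f x : ℂ) * (u x * star (w x)) := by
  refine (h1.add h2).mono' ?_ (.of_forall fun x => ?_)
  · exact (Complex.continuous_ofReal.comp_aestronglyMeasurable hf).mul
      (hu.mul (continuous_star.comp_aestronglyMeasurable hw))
  · rw [norm_mul, norm_mul, norm_star, Complex.norm_real, Real.norm_eq_abs, Pi.add_apply, ← mul_add]
    gcongr
    nlinarith [sq_nonneg (‖u x‖ - ‖w x‖), sq_nonneg ‖u x‖, sq_nonneg ‖w x‖]

theorem integral_ofReal_mul_re {f : Space n → ℝ} {g : Space n → ℂ}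
    (h : Integrable fun x => (f x : ℂ) * g x) :
    Integrable (fun x => f x * (g x).re) ∧
      (∫ x, (f x : ℂ) * g x).re = ∫ x, f x * (g x).re := by
  have e : ∀ x, ((f x : ℂ) * g x).re = f x * (g x).re := fun x => by simp
  have h1 := h.re
  have h2 := integral_re h
  simp only [RCLike.re_to_complex, e] at h1 h2
  exact ⟨h1, h2.symm⟩

theorem MemLqAddLinfty.aestronglyMeasurable {q : ℝ} {f : Space n → ℝ} (hf : MemLqAddLinfty q f) :
    AEStronglyMeasurable f volume := by
  obtain ⟨f₁, f₂, h₁, h₂, rfl⟩ := hf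
  exact h₁.1.add h₂.1

theorem HasFormBound.integrable {f : Space n → ℝ} (hf : HasFormBound f) {u : Space n → ℂ}
    {v : Space n → EuclideanSpace ℂ (Fin n)} (h : IsSobolev u v) :
    Integrable fun x => |f x| * ‖u x‖ ^ 2 := by
  obtain ⟨C, κ, -, -, H⟩ := hf
  exact (H 1 le_rfl u v h).1

theorem IsSobolev.integrable_grad_inner {u w : Space n → ℂ}
    {v z : Space n → EuclideanSpace ℂ (Fin n)} (h : IsSobolev u v) (h' : IsSobolev w z) :
    Integrable fun x => inner ℂ (z x) (v x) := by
  refine (h.integrable_grad_sq.add h'.integrable_grad_sq).mono'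
    (h'.memLp_grad.1.inner h.memLp_grad.1) (.of_forall fun x => ?_)
  refine (norm_inner_le_norm _ _).trans ?_
  simp only [Pi.add_apply]
  nlinarith [sq_nonneg (‖v x‖ - ‖z x‖), sq_nonneg ‖v x‖, sq_nonneg ‖z x‖]

/-- The pieces of the weak formulation are integrable. -/
theorem integrable_weak_terms (hn : 1 ≤ n) (hp : 0 < p) (hp' : 3 ≤ n → p < 4 / ((n : ℝ) - 2))
    (hVm : AEStronglyMeasurable V volume) (hV : HasFormBound V) (E : ℝ)
    {u w : Space n → ℂ} {v z : Space n → EuclideanSpace ℂ (Fin n)} (h : IsSobolev u v)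
    (h' : IsSobolev w z) :
    Integrable (fun x => ((V x + E : ℝ) : ℂ) * (u x * star (w x))) ∧
    Integrable (fun x => ((‖u x‖ ^ p : ℝ) : ℂ) * (u x * star (w x))) := by
  have hu := h.memLp.1
  have hw := h'.memLp.1
  constructor
  · have hVE : ∀ {a : Space n → ℂ} {b : Space n → EuclideanSpace ℂ (Fin n)}, IsSobolev a b →
        Integrable fun x => |V x + E| * ‖a x‖ ^ 2 := by
      intro a b hab
      refine ((hV.integrable hab).add (hab.integrable_sq.const_mul |E|)).mono'
        ((hVm.add aestronglyMeasurable_const).norm.mul (hab.memLp.1.norm.pow 2))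
        (.of_forall fun x => ?_)
      rw [Real.norm_of_nonneg (by positivity), Pi.add_apply, ← add_mul]
      gcongr
      exact abs_add_le _ _
    exact integrable_weight_mul_re (hVm.add aestronglyMeasurable_const) hu hw (hVE h) (hVE h')
  · obtain ⟨C, -, H⟩ := integrable_power_weight hn hp hp'
    have e : ∀ x, |‖u x‖ ^ p| = ‖u x‖ ^ p := fun x => abs_of_nonneg (by positivity)
    exact integrable_weight_mul_re (hu.norm.aemeasurable.pow_const p).aestronglyMeasurable hu hw
      (by simpa only [e] using (H u v h u v h).1) (by simpa only [e] using (H u v h w z h').1)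

/-- The real part of the weak equation, tested with a function-level Sobolev pair. -/
theorem IsCoherentState.re_eq (hn : 1 ≤ n) (hp : 0 < p)
    (hp' : 3 ≤ n → p < 4 / ((n : ℝ) - 2)) (hVm : AEStronglyMeasurable V volume)
    (hV : HasFormBound V) {φ : H1 n} (hφ : IsCoherentState V γ p E φ) {w : Space n → ℂ}
    {z : Space n → EuclideanSpace ℂ (Fin n)} (h : IsSobolev w z) :
    (∫ x, (inner ℂ (z x) (H1.grad φ x)).re)
      + (∫ x, (V x + E) * (H1.val φ x * star (w x)).re)
      + γ * (∫ x, ‖H1.val φ x‖ ^ p * (H1.val φ x * star (w x)).re) = 0 := by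
  obtain ⟨ψ, hψ, hψ'⟩ := h.exists_H1
  have hS := H1.isSobolev φ
  obtain ⟨i2, i3⟩ := integrable_weak_terms hn hp hp' hVm hV E hS h
  have i1 := hS.integrable_grad_inner h
  have heq := hφ ψ
  have e1 : ∫ x, inner ℂ (H1.grad ψ x) (H1.grad φ x) = ∫ x, inner ℂ (z x) (H1.grad φ x) :=
    integral_congr_ae (by filter_upwards [hψ'] with x hx; rw [hx])
  have e2 : ∫ x, ((V x + E : ℝ) : ℂ) * (H1.val φ x * star (H1.val ψ x))
      = ∫ x, ((V x + E : ℝ) : ℂ) * (H1.val φ x * star (w x)) :=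
    integral_congr_ae (by filter_upwards [hψ] with x hx; rw [hx])
  have e3 : ∫ x, ((‖H1.val φ x‖ ^ p : ℝ) : ℂ) * (H1.val φ x * star (H1.val ψ x))
      = ∫ x, ((‖H1.val φ x‖ ^ p : ℝ) : ℂ) * (H1.val φ x * star (w x)) :=
    integral_congr_ae (by filter_upwards [hψ] with x hx; rw [hx])
  rw [e1, e2, e3] at heq
  have hre := congrArg Complex.re heq
  have r1 : (∫ x, inner ℂ (z x) (H1.grad φ x)).re = ∫ x, (inner ℂ (z x) (H1.grad φ x)).re :=
    (integral_re i1).symm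
  rw [Complex.add_re, Complex.add_re, Complex.re_ofReal_mul, r1, (integral_ofReal_mul_re i2).2,
    (integral_ofReal_mul_re i3).2, Complex.zero_re] at hre
  exact hre

theorem charge_eq (φ : H1 n) : ∫ x, ‖H1.val φ x‖ ^ 2 = 2 * charge φ := by
  rw [charge]; ring

theorem charge_nonneg (φ : H1 n) : 0 ≤ charge φ :=
  mul_nonneg (by norm_num) (integral_nonneg fun _ => by positivity)

theorem lpPow_nonneg (p : ℝ) (φ : H1 n) : 0 ≤ lpPow p φ :=
  integral_nonneg fun _ => by positivity

theorem gradSq_nonneg (φ : H1 n) : 0 ≤ gradSq φ :=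
  integral_nonneg fun _ => by positivity

theorem sobolevSq_H1 (φ : H1 n) :
    sobolevSq (H1.val φ) (H1.grad φ) = 2 * charge φ + gradSq φ := by
  rw [sobolevSq, charge_eq, gradSq]

theorem integral_norm_sq_eq_inner {F : Type*} [NormedAddCommGroup F] [InnerProductSpace ℂ F]
    (f : Lp F 2 (volume : Measure (Space n))) : ‖f‖ ^ 2 = ∫ x, ‖f x‖ ^ 2 := by
  have h := L2.inner_def (𝕜 := ℂ) f f
  have h1 : (inner ℂ f f).re = ‖f‖ ^ 2 := by
    rw [inner_self_eq_norm_sq_to_K]; norm_cast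
  have h2 : (∫ x, inner ℂ (f x) (f x)) = ((∫ x, ‖f x‖ ^ 2 : ℝ) : ℂ) := by
    rw [← integral_complex_ofReal]
    refine integral_congr_ae (.of_forall fun x => ?_)
    simp only [inner_self_eq_norm_sq_to_K]
    norm_cast
  rw [← h1, h, h2, Complex.ofReal_re]

theorem norm_sq_eq_sobolevSq (φ : H1 n) : ‖φ‖ ^ 2 = sobolevSq (H1.val φ) (H1.grad φ) := by
  rw [Submodule.coe_norm, WithLp.prod_norm_sq_eq_of_L2, integral_norm_sq_eq_inner,
    integral_norm_sq_eq_inner]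
  rfl

/-- The equation tested with the state itself. -/
theorem IsCoherentState.energy_identity (hn : 1 ≤ n) (hp : 0 < p)
    (hp' : 3 ≤ n → p < 4 / ((n : ℝ) - 2)) (hVm : AEStronglyMeasurable V volume)
    (hV : HasFormBound V) {φ : H1 n} (hφ : IsCoherentState V γ p E φ) :
    gradSq φ + (∫ x, V x * ‖H1.val φ x‖ ^ 2) + 2 * E * charge φ + γ * lpPow p φ = 0 := by
  have hS := H1.isSobolev φ
  have h := hφ.re_eq hn hp hp' hVm hV hS
  have hVi : Integrable fun x => V x * ‖H1.val φ x‖ ^ 2 :=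
    (hV.integrable hS).mono' (hVm.mul (hS.memLp.1.norm.pow 2))
      (.of_forall fun x => by rw [norm_mul, Real.norm_eq_abs, Real.norm_of_nonneg (by positivity)])
  have e1 : ∀ x, (inner ℂ (H1.grad φ x) (H1.grad φ x)).re = ‖H1.grad φ x‖ ^ 2 := fun x => by
    rw [inner_self_eq_norm_sq_to_K]; norm_cast
  have e2 : ∫ x, (V x + E) * ‖H1.val φ x‖ ^ 2
      = (∫ x, V x * ‖H1.val φ x‖ ^ 2) + E * ∫ x, ‖H1.val φ x‖ ^ 2 := by
    rw [← integral_const_mul, ← integral_add hVi (hS.integrable_sq.const_mul E)]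
    simp only [add_mul]
  simp only [e1, re_mul_star_self, rpow_mul_sq (norm_nonneg _) hp] at h
  rw [e2, charge_eq] at h
  rw [gradSq, lpPow]
  linarith

end CoherentState

/-! ### The charge as a derivative along a branch -/

section ChargeIdentity

variable {n : ℕ} {p γ : ℝ} {V : Space n → ℝ}

/-- Testing two coherent states against each other makes all linear terms cancel, up to the
difference of the parameters. -/
theorem IsCoherentState.cross_identity (hn : 1 ≤ n) (hp : 0 < p)
    (hp' : 3 ≤ n → p < 4 / ((n : ℝ) - 2)) (hVm : AEStronglyMeasurable V volume)
    (hV : HasFormBound V) {E E' : ℝ} {φ ψ : H1 n} (hφ : IsCoherentState V γ p E φ)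
    (hψ : IsCoherentState V γ p E' ψ) :
    (E - E') * (∫ x, (H1.val φ x * star (H1.val ψ x)).re)
      + γ * ∫ x, (‖H1.val φ x‖ ^ p - ‖H1.val ψ x‖ ^ p) * (H1.val φ x * star (H1.val ψ x)).re
      = 0 := by
  have hS := H1.isSobolev φ
  have hS' := H1.isSobolev ψ
  have h1 := hφ.re_eq hn hp hp' hVm hV hS'
  have h2 := hψ.re_eq hn hp hp' hVm hV hS
  obtain ⟨i1, i2⟩ := integrable_weak_terms hn hp hp' hVm hV E hS hS'
  obtain ⟨i3, i4⟩ := integrable_weak_terms hn hp hp' hVm hV E' hS' hS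
  replace i1 := (integral_ofReal_mul_re i1).1
  replace i2 := (integral_ofReal_mul_re i2).1
  replace i3 := (integral_ofReal_mul_re i3).1
  replace i4 := (integral_ofReal_mul_re i4).1
  simp only [fun x => re_mul_star_comm (H1.val ψ x) (H1.val φ x)] at h2 i3 i4
  have e1 : ∀ x, (inner ℂ (H1.grad φ x) (H1.grad ψ x)).re
      = (inner ℂ (H1.grad ψ x) (H1.grad φ x)).re := fun x => inner_re_symm (𝕜 := ℂ) _ _
  simp only [e1] at h2
  have e2 : (E - E') * (∫ x, (H1.val φ x * star (H1.val ψ x)).re)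
      = (∫ x, (V x + E) * (H1.val φ x * star (H1.val ψ x)).re)
        - ∫ x, (V x + E') * (H1.val φ x * star (H1.val ψ x)).re := by
    rw [← integral_const_mul, ← integral_sub i1 i3]
    refine integral_congr_ae (.of_forall fun x => ?_)
    simp only
    ring
  have e3 : ∫ x, (‖H1.val φ x‖ ^ p - ‖H1.val ψ x‖ ^ p) * (H1.val φ x * star (H1.val ψ x)).re
      = (∫ x, ‖H1.val φ x‖ ^ p * (H1.val φ x * star (H1.val ψ x)).re)
        - ∫ x, ‖H1.val ψ x‖ ^ p * (H1.val φ x * star (H1.val ψ x)).re := by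
    rw [← integral_sub i2 i4]
    simp only [sub_mul]
  rw [e2, e3]
  linarith

theorem isSobolev_sub_H1 (φ ψ : H1 n) :
    IsSobolev (H1.val φ - H1.val ψ) (H1.grad φ - H1.grad ψ) ∧
      sobolevSq (H1.val φ - H1.val ψ) (H1.grad φ - H1.grad ψ) = ‖φ - ψ‖ ^ 2 := by
  refine ⟨(H1.isSobolev φ).sub (H1.isSobolev ψ), ?_⟩
  rw [norm_sq_eq_sobolevSq, sobolevSq, sobolevSq]
  have h1 : H1.val (φ - ψ) =ᵐ[volume] H1.val φ - H1.val ψ := Lp.coeFn_sub _ _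
  have h2 : H1.grad (φ - ψ) =ᵐ[volume] H1.grad φ - H1.grad ψ := Lp.coeFn_sub _ _
  congr 1
  · exact integral_congr_ae (by filter_upwards [h1] with x hx; rw [hx])
  · exact integral_congr_ae (by filter_upwards [h2] with x hx; rw [hx])

/-- The integrand of the cross identity in terms of the two Taylor remainders. -/
theorem abs_cross_integrand_le (hp : 0 < p) (a b : ℂ) :
    |(‖a‖ ^ p - ‖b‖ ^ p) * (a * star b).re - p / (p + 2) * (‖a‖ ^ (p + 2) - ‖b‖ ^ (p + 2))|
      ≤ (p + 2) * (‖a‖ ^ p * ‖a - b‖ ^ 2 + ‖b‖ ^ p * ‖a - b‖ ^ 2) := by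
  have hp2 : 0 < p + 2 := by linarith
  have r1 := powerRemainder_eq hp a b
  have r2 := powerRemainder_eq hp b a
  rw [re_mul_star_comm b a] at r2
  have n1 := powerRemainder_nonneg hp a b
  have n2 := powerRemainder_nonneg hp b a
  have l1 := powerRemainder_le hp a b
  have l2 := powerRemainder_le hp b a
  rw [norm_sub_rev] at l1
  have e : (‖a‖ ^ p - ‖b‖ ^ p) * (a * star b).re
      - p / (p + 2) * (‖a‖ ^ (p + 2) - ‖b‖ ^ (p + 2))
      = (powerRemainder p b a - powerRemainder p a b) / (p + 2) := by
    rw [r1, r2]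
    field_simp
    ring
  rw [e, abs_div, abs_of_pos hp2, div_le_iff₀ hp2, abs_le]
  constructor <;> nlinarith

set_option maxHeartbeats 800000 in
/-- The nonlinear term of the cross identity is a difference of `L^{p+2}` norms up to an error that
is quadratic in the distance of the two states. -/
theorem IsCoherentState.abs_cross_le (hn : 1 ≤ n) (hp : 0 < p)
    (hp' : 3 ≤ n → p < 4 / ((n : ℝ) - 2)) (hVm : AEStronglyMeasurable V volume)
    (hV : HasFormBound V) : ∃ K : ℝ, 0 ≤ K ∧ ∀ (E E' : ℝ) (φ ψ : H1 n),
      IsCoherentState V γ p E φ → IsCoherentState V γ p E' ψ →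
      |(E - E') * (∫ x, (H1.val φ x * star (H1.val ψ x)).re)
        + γ * (p / (p + 2)) * (lpPow p φ - lpPow p ψ)|
        ≤ K * (‖φ‖ ^ p + ‖ψ‖ ^ p) * ‖φ - ψ‖ ^ 2 := by
  obtain ⟨C, hC, H⟩ := integrable_power_weight hn hp hp'
  refine ⟨|γ| * ((p + 2) * C), by positivity, fun E E' φ ψ hφ hψ => ?_⟩
  have hS := H1.isSobolev φ
  have hS' := H1.isSobolev ψ
  obtain ⟨hSd, hSe⟩ := isSobolev_sub_H1 φ ψ
  have hid := hφ.cross_identity hn hp hp' hVm hV hψ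
  obtain ⟨a1, a2⟩ := H _ _ hS _ _ hSd
  obtain ⟨b1, b2⟩ := H _ _ hS' _ _ hSd
  have q1 : √(sobolevSq (H1.val φ) (H1.grad φ)) = ‖φ‖ := by
    rw [← norm_sq_eq_sobolevSq φ, Real.sqrt_sq (norm_nonneg φ)]
  have q2 : √(sobolevSq (H1.val ψ) (H1.grad ψ)) = ‖ψ‖ := by
    rw [← norm_sq_eq_sobolevSq ψ, Real.sqrt_sq (norm_nonneg ψ)]
  rw [hSe, q1] at a2
  rw [hSe, q2] at b2
  simp only [Pi.sub_apply] at a1 a2 b1 b2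
  have hp2 : 0 < p + 2 := by linarith
  have hpt := fun x => abs_cross_integrand_le hp (H1.val φ x) (H1.val ψ x)
  have hN : Integrable fun x => ‖H1.val φ x‖ ^ (p + 2) :=
    integrable_norm_rpow_add_two hn hp hp' hS
  have hN' : Integrable fun x => ‖H1.val ψ x‖ ^ (p + 2) :=
    integrable_norm_rpow_add_two hn hp hp' hS'
  obtain ⟨-, i2⟩ := integrable_weak_terms hn hp hp' hVm hV E hS hS'
  obtain ⟨-, i4⟩ := integrable_weak_terms hn hp hp' hVm hV E' hS' hS
  replace i2 := (integral_ofReal_mul_re i2).1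
  replace i4 := (integral_ofReal_mul_re i4).1
  simp only [fun x => re_mul_star_comm (H1.val ψ x) (H1.val φ x)] at i4
  have i5 : Integrable fun x =>
      (‖H1.val φ x‖ ^ p - ‖H1.val ψ x‖ ^ p) * (H1.val φ x * star (H1.val ψ x)).re := by
    simpa only [sub_mul] using! i2.sub i4
  have i6 : Integrable fun x =>
      p / (p + 2) * (‖H1.val φ x‖ ^ (p + 2) - ‖H1.val ψ x‖ ^ (p + 2)) := (hN.sub hN').const_mul _
  have hdiff : p / (p + 2) * (lpPow p φ - lpPow p ψ)
      = ∫ x, p / (p + 2) * (‖H1.val φ x‖ ^ (p + 2) - ‖H1.val ψ x‖ ^ (p + 2)) := by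
    rw [integral_const_mul, integral_sub hN hN', lpPow, lpPow]
  have hbd : |(∫ x, (‖H1.val φ x‖ ^ p - ‖H1.val ψ x‖ ^ p) * (H1.val φ x * star (H1.val ψ x)).re)
      - p / (p + 2) * (lpPow p φ - lpPow p ψ)|
      ≤ (p + 2) * (C * ‖φ‖ ^ p * ‖φ - ψ‖ ^ 2 + C * ‖ψ‖ ^ p * ‖φ - ψ‖ ^ 2) := by
    rw [hdiff, ← integral_sub i5 i6]
    refine (abs_integral_le_integral_abs).trans ?_
    refine (integral_mono (i5.sub i6).abs ((a1.add b1).const_mul (p + 2)) hpt).trans ?_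
    rw [integral_const_mul]
    refine mul_le_mul_of_nonneg_left ?_ hp2.le
    have := integral_add a1 b1
    simp only [Pi.add_apply] at this ⊢
    rw [this]
    exact add_le_add a2 b2
  have e : (E - E') * (∫ x, (H1.val φ x * star (H1.val ψ x)).re)
        + γ * (p / (p + 2)) * (lpPow p φ - lpPow p ψ)
      = -γ * ((∫ x, (‖H1.val φ x‖ ^ p - ‖H1.val ψ x‖ ^ p)
          * (H1.val φ x * star (H1.val ψ x)).re) - p / (p + 2) * (lpPow p φ - lpPow p ψ)) := by
    linarith
  have e' := congrArg (fun t : ℝ => |t|) e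
  simp only [abs_mul (-γ), abs_neg] at e'
  refine e'.trans_le ((mul_le_mul_of_nonneg_left hbd (abs_nonneg γ)).trans (le_of_eq ?_))
  ring

theorem integral_re_mul_star_eq_inner (φ ψ : H1 n) :
    ∫ x, (H1.val φ x * star (H1.val ψ x)).re = (inner ℂ ψ.1.fst φ.1.fst).re := by
  rw [L2.inner_def]
  have h := integral_re (𝕜 := ℂ) (L2.integrable_inner (𝕜 := ℂ) ψ.1.fst φ.1.fst)
  simp only [RCLike.re_to_complex] at h
  rw [← h]
  rfl

theorem tendsto_integral_re_mul_star (φ : H1 n) :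
    Tendsto (fun ψ : H1 n => ∫ x, (H1.val ψ x * star (H1.val φ x)).re) (𝓝 φ)
      (𝓝 (2 * charge φ)) := by
  have h1 : ∫ x, (H1.val φ x * star (H1.val φ x)).re = 2 * charge φ := by
    rw [← charge_eq]
    simp only [re_mul_star_self]
  rw [← h1]
  simp only [integral_re_mul_star_eq_inner]
  have h2 : Continuous fun ψ : H1 n => ψ.1.fst :=
    (WithLp.prod_continuous_ofLp 2 _ _).fst.comp continuous_subtype_val
  have h3 : Continuous fun ψ : H1 n => (inner ℂ φ.1.fst ψ.1.fst).re :=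
    Complex.continuous_re.comp (continuous_const.inner h2)
  exact h3.tendsto φ

/-- A first order expansion of a real function `f` along a differentiable curve `φ`, with an error
quadratic in the increment of `φ`, determines the derivative of `f`. -/
theorem hasDerivAt_of_quadratic_error {X : Type*} [NormedAddCommGroup X] [NormedSpace ℝ X]
    {φ : ℝ → X} {E : ℝ} (hφ : DifferentiableAt ℝ φ E) {f J : ℝ → ℝ} {k l K p : ℝ} (hk : k ≠ 0)
    (hp : 0 < p) (hJ : Tendsto J (𝓝[≠] E) (𝓝 l))
    (H : ∀ᶠ E' in 𝓝[≠] E, |(E' - E) * J E' + k * (f E' - f E)|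
      ≤ K * (‖φ E'‖ ^ p + ‖φ E‖ ^ p) * ‖φ E' - φ E‖ ^ 2) :
    HasDerivAt f (-l / k) E := by
  have hd := hφ.hasDerivAt
  have hcont : Tendsto φ (𝓝[≠] E) (𝓝 (φ E)) :=
    hφ.continuousAt.tendsto.mono_left nhdsWithin_le_nhds
  rw [hasDerivAt_iff_tendsto_slope] at hd ⊢
  have h1 : Tendsto (fun E' => ‖φ E'‖ ^ p + ‖φ E‖ ^ p) (𝓝[≠] E)
      (𝓝 (‖φ E‖ ^ p + ‖φ E‖ ^ p)) :=
    (hcont.norm.rpow_const (Or.inr hp.le)).add tendsto_const_nhds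
  have h2 : Tendsto (fun E' => ‖φ E' - φ E‖) (𝓝[≠] E) (𝓝 0) := by
    simpa using (hcont.sub_const (φ E)).norm
  have herr : Tendsto (fun E' => |k|⁻¹ * (K * ((‖φ E'‖ ^ p + ‖φ E‖ ^ p)
      * (‖slope φ E E'‖ * ‖φ E' - φ E‖)))) (𝓝[≠] E) (𝓝 0) := by
    have := ((h1.mul (hd.norm.mul h2)).const_mul K).const_mul |k|⁻¹
    simpa only [mul_zero] using this
  have hmain : Tendsto (fun E' => slope f E E' + k⁻¹ * J E') (𝓝[≠] E) (𝓝 0) := by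
    refine squeeze_zero_norm' ?_ herr
    filter_upwards [H, eventually_mem_nhdsWithin] with E' hE' hne
    have hne' : E' - E ≠ 0 := sub_ne_zero.2 hne
    have hne0 : 0 < |E' - E| := abs_pos.2 hne'
    have hk0 : 0 < |k| := abs_pos.2 hk
    have e : slope f E E' + k⁻¹ * J E'
        = k⁻¹ * (E' - E)⁻¹ * ((E' - E) * J E' + k * (f E' - f E)) := by
      rw [slope_def_field]
      field_simp
      ring
    have e2 : ‖slope φ E E'‖ = |E' - E|⁻¹ * ‖φ E' - φ E‖ := by
      rw [slope_def_module, norm_smul, norm_inv, Real.norm_eq_abs]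
    rw [e, norm_mul, norm_mul, norm_inv, norm_inv, Real.norm_eq_abs, Real.norm_eq_abs,
      Real.norm_eq_abs, e2, mul_assoc]
    refine mul_le_mul_of_nonneg_left ?_ (inv_nonneg.2 hk0.le)
    refine (mul_le_mul_of_nonneg_left hE' (inv_nonneg.2 hne0.le)).trans (le_of_eq ?_)
    ring
  have := hmain.sub (hJ.const_mul k⁻¹)
  refine (this.congr fun E' => by ring).trans (le_of_eq ?_)
  congr 1
  field_simp
  ring

/-- Along a branch of coherent states, the `L^{p+2}` norm is differentiable with a derivative
proportional to the charge. This is the key monotonicity of the problem. -/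
theorem IsC1Branch.hasDerivAt_lpPow (hn : 1 ≤ n) (hp : 0 < p)
    (hp' : 3 ≤ n → p < 4 / ((n : ℝ) - 2)) (hγ : γ < 0) (hVm : AEStronglyMeasurable V volume)
    (hV : HasFormBound V) {I : Set ℝ} {φ : ℝ → H1 n} (hb : IsC1Branch V γ p I φ) {E : ℝ}
    (hE : E ∈ I) :
    HasDerivAt (fun E => lpPow p (φ E)) ((2 * p + 4) / (-γ * p) * charge (φ E)) E := by
  obtain ⟨K, hK, H⟩ := IsCoherentState.abs_cross_le (γ := γ) hn hp hp' hVm hV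
  have hd : DifferentiableAt ℝ φ E :=
    (hb.contDiffOn.differentiableOn one_ne_zero).differentiableAt (hb.isOpen.mem_nhds hE)
  have hcont : Tendsto φ (𝓝[≠] E) (𝓝 (φ E)) := hd.continuousAt.tendsto.mono_left
    nhdsWithin_le_nhds
  have hJt := (tendsto_integral_re_mul_star (φ E)).comp hcont
  have hp2 : p + 2 ≠ 0 := by linarith
  have hk : γ * (p / (p + 2)) ≠ 0 := mul_ne_zero hγ.ne (div_ne_zero hp.ne' hp2)
  have hev : ∀ᶠ E' in 𝓝[≠] E, E' ∈ I :=
    eventually_nhdsWithin_of_eventually_nhds (hb.isOpen.mem_nhds hE)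
  have e : (2 * p + 4) / (-γ * p) * charge (φ E)
      = -(2 * charge (φ E)) / (γ * (p / (p + 2))) := by
    have := hγ.ne
    have := hp.ne'
    field_simp
    ring
  exact e ▸ hasDerivAt_of_quadratic_error hd hk hp hJt
    (hev.mono fun E' hE' => H E' E (φ E') (φ E) (hb.coherent E' hE') (hb.coherent E hE))

end ChargeIdentity

/-! ### Dilations and the quadratic form of the potential -/

section WeightDilation

variable {n : ℕ} {f V W : Space n → ℝ}

theorem HasFormBound.integrableOn_closedBall (hf : HasFormBound f)
    (hfm : AEStronglyMeasurable f volume) (R : ℝ) :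
    IntegrableOn f (Metric.closedBall (0 : Space n) R) := by
  have hR : 0 < max R 1 := lt_max_of_lt_right one_pos
  let b : ContDiffBump (0 : Space n) := ⟨max R 1, max R 1 + 1, hR, by linarith⟩
  have hb : ContDiff ℝ 1 fun x => (b x : ℂ) := Complex.ofRealCLM.contDiff.comp b.contDiff
  have hs : HasCompactSupport fun x => (b x : ℂ) :=
    b.hasCompactSupport.comp_left (g := fun t : ℝ => (t : ℂ)) Complex.ofReal_zero
  have hi := (hf.integrable (isSobolev_of_contDiff hb hs)).integrableOn
    (s := Metric.closedBall (0 : Space n) R)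
  refine Integrable.mono' hi hfm.restrict ?_
  filter_upwards [ae_restrict_mem Metric.isClosed_closedBall.measurableSet] with x hx
  have : b x = 1 := b.one_of_mem_closedBall (Metric.closedBall_subset_closedBall (le_max_left _ _) hx)
  simp [this]

theorem HasFormBound.integrable_mul_of_hasCompactSupport (hf : HasFormBound f)
    (hfm : AEStronglyMeasurable f volume) {g : Space n → ℝ} (hg : Continuous g)
    (hgs : HasCompactSupport g) : Integrable fun x => f x * g x := by
  obtain ⟨R, hR⟩ := hgs.isBounded.subset_closedBall (0 : Space n)
  obtain ⟨M, hM⟩ := hg.bounded_above_of_compact_support hgs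
  have hi : IntegrableOn (fun x => f x * g x) (Metric.closedBall (0 : Space n) R) := by
    refine ((hf.integrableOn_closedBall hfm R).norm.const_mul M).mono'
      (hfm.mul hg.aestronglyMeasurable).restrict (.of_forall fun x => ?_)
    rw [norm_mul, mul_comm]
    exact mul_le_mul_of_nonneg_right (hM x) (norm_nonneg _)
  refine (integrableOn_iff_integrable_of_support_subset fun x hx => hR ?_).1 hi
  exact subset_tsupport _ (right_ne_zero_of_mul hx)

/-- The derivative of `c ↦ ∫ V(x) F(c x) dx` for a test function `F`, expressed through the radial
derivative `W` of `V`. -/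
theorem IsRadialDerivative.hasDerivAt_integral_dilate (h : IsRadialDerivative V W)
    (hVm : AEStronglyMeasurable V volume) (hV : HasFormBound V)
    {F : Space n → ℝ} (hF : IsTestFunction F)
    {c : ℝ} (hc : 0 < c) :
    HasDerivAt (fun c => ∫ x, V x * F (c • x))
      (-(c⁻¹ * ((∫ x, W x * F (c • x)) + n * ∫ x, V x * F (c • x)))) c := by
  obtain ⟨R, hR0, hR⟩ : ∃ R : ℝ, 0 ≤ R ∧ tsupport F ⊆ Metric.closedBall 0 R := by
    obtain ⟨R, hR⟩ := hF.2.isBounded.subset_closedBall (0 : Space n)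
    exact ⟨max R 0, le_max_right _ _, hR.trans (Metric.closedBall_subset_closedBall (le_max_left _ _))⟩
  have hF1 : ContDiff ℝ 1 F := hF.1.of_le (by exact_mod_cast le_top)
  have hdc : Continuous (fderiv ℝ F) := hF1.continuous_fderiv (by simp)
  obtain ⟨M, hM⟩ := hdc.bounded_above_of_compact_support (hF.2.fderiv (𝕜 := ℝ))
  have hM0 : 0 ≤ M := (norm_nonneg _).trans (hM 0)
  have htest : ∀ t : ℝ, 0 < t → IsTestFunction fun x : Space n => F (t • x) := fun t ht =>
    ⟨hF.1.comp (contDiff_const_smul _),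
      hF.2.comp_homeomorph (Homeomorph.smulOfNeZero t ht.ne')⟩
  have hηc := (htest c hc).1.continuous
  set bd : Space n → ℝ := (Metric.closedBall (0 : Space n) (R / (c / 2))).indicator
    fun x => |V x| * (M * (R / (c / 2))) with hbd
  have hbi : Integrable bd := by
    rw [hbd, integrable_indicator_iff Metric.isClosed_closedBall.measurableSet]
    exact (hV.integrableOn_closedBall hVm _).norm.mul_const _
  have hball : ∀ t ∈ Metric.ball c (c / 2), c / 2 < t := fun t ht => by
    rw [Metric.mem_ball, Real.dist_eq, abs_lt] at ht
    linarith
  have key := hasDerivAt_integral_of_dominated_loc_of_deriv_le (μ := (volume : Measure (Space n)))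
    (F := fun t x => V x * F (t • x)) (F' := fun t x => V x * fderiv ℝ F (t • x) x) (x₀ := c)
    (s := Metric.ball c (c / 2)) (bound := bd) (Metric.ball_mem_nhds c (by linarith))
    (.of_forall fun t => hVm.mul (hF.1.continuous.comp (by fun_prop)).aestronglyMeasurable)
    (hV.integrable_mul_of_hasCompactSupport hVm hηc (htest c hc).2)
    (hVm.mul ((hdc.comp (by fun_prop)).clm_apply continuous_id).aestronglyMeasurable)
    (.of_forall fun x t ht => by
      have ht' := hball t ht
      have ht0 : 0 < t := by linarith
      by_cases hx : t • x ∈ tsupport F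
      · have hx1 : ‖x‖ ≤ R / (c / 2) := by
          have h1 := hR hx
          rw [mem_closedBall_zero_iff, norm_smul, Real.norm_of_nonneg ht0.le] at h1
          rw [le_div_iff₀ (by linarith)]
          nlinarith [norm_nonneg x]
        rw [hbd, Set.indicator_of_mem (by simpa using hx1), norm_mul, Real.norm_eq_abs]
        gcongr
        exact (ContinuousLinearMap.le_opNorm _ _).trans (by gcongr; exact hM _)
      · have : fderiv ℝ F (t • x) = 0 := by
          by_contra h0
          exact hx (support_fderiv_subset ℝ h0)
        rw [this]
        rw [zero_apply, mul_zero, norm_zero]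
        exact Set.indicator_nonneg (fun y _ => by positivity) x)
    hbi
    (.of_forall fun x t ht => by
      have h1 : HasDerivAt (fun t : ℝ => t • x) ((1 : ℝ) • x) t := (hasDerivAt_id t).smul_const x
      have h2 := (hF1.differentiable one_ne_zero (t • x)).hasFDerivAt.comp_hasDerivAt t h1
      rw [one_smul] at h2
      exact h2.const_mul (V x))
  have hval := h _ (htest c hc)
  have hfd : ∀ x, fderiv ℝ (fun x : Space n => F (c • x)) x x = c * fderiv ℝ F (c • x) x := by
    intro x
    have h1 : HasFDerivAt (fun x : Space n => c • x) (c • ContinuousLinearMap.id ℝ (Space n)) x :=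
      (hasFDerivAt_id x).const_smul c
    have h2 := (hF1.differentiable one_ne_zero (c • x)).hasFDerivAt.comp x h1
    have h3 := h2.fderiv
    simp only [Function.comp_def] at h3
    rw [h3]
    simp
  have hI1 := hV.integrable_mul_of_hasCompactSupport hVm hηc (htest c hc).2
  have e : ∫ x, V x * (fderiv ℝ (fun x : Space n => F (c • x)) x x + n * F (c • x))
      = c * (∫ x, V x * fderiv ℝ F (c • x) x) + n * ∫ x, V x * F (c • x) := by
    rw [← integral_const_mul, ← integral_const_mul, ← integral_add (key.1.const_mul c)
      (hI1.const_mul (n : ℝ))]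
    refine integral_congr_ae (.of_forall fun x => ?_)
    simp only [hfd]
    ring
  rw [e] at hval
  refine key.2.congr_deriv ?_
  rw [hval]
  field_simp
  ring

/-- On bounded sets of `H¹`, the quadratic form of a form bounded weight is uniformly continuous with
respect to the `L²` norm. -/
theorem HasFormBound.abs_integral_sub_le (hf : HasFormBound f)
    (hfm : AEStronglyMeasurable f volume) {B ε : ℝ} (hB : 0 ≤ B) (hε : 0 < ε) :
    ∃ M : ℝ, 0 ≤ M ∧ ∀ (u u' : Space n → ℂ) (v v' : Space n → EuclideanSpace ℂ (Fin n)),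
      IsSobolev u v → IsSobolev u' v' → sobolevSq u v ≤ B → sobolevSq u' v' ≤ B →
      |(∫ x, f x * ‖u x‖ ^ 2) - ∫ x, f x * ‖u' x‖ ^ 2| ≤ ε + M * ∫ x, ‖u x - u' x‖ ^ 2 := by
  obtain ⟨C, κ, hC, hκ, H⟩ := hf
  -- the cross term is split with a weight `k` so large that `k⁻¹ ∫ |f| |u'|²` is negligible
  obtain ⟨k, hk, hk1⟩ : ∃ k : ℝ, 0 < k ∧ k⁻¹ * (C * (2 * B)) ≤ ε / 2 := by
    refine ⟨2 * (C * (2 * B)) / ε + 1, by positivity, ?_⟩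
    rw [inv_mul_le_iff₀ (by positivity)]
    have : (2 * (C * (2 * B)) / ε + 1) * (ε / 2) = C * (2 * B) + ε / 2 := by
      field_simp
    rw [this]
    linarith
  obtain ⟨m, hm, hm1⟩ : ∃ m : ℝ, 1 ≤ m ∧ (1 + k) * (C * (m ^ (-κ) * (4 * B))) ≤ ε / 2 := by
    have h1 : Tendsto (fun m : ℝ => (1 + k) * (C * (m ^ (-κ) * (4 * B)))) atTop (𝓝 0) := by
      have := (((tendsto_rpow_neg_atTop hκ).mul_const (4 * B)).const_mul C).const_mul (1 + k)
      simpa using this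
    exact ((eventually_ge_atTop 1).and (h1.eventually_le_const (by positivity))).exists
  have hC0 : 0 ≤ (1 + k) * (C * m) := by positivity
  refine ⟨(1 + k) * (C * m), hC0, fun u u' v v' h h' hb hb' => ?_⟩
  have hd := h.sub h'
  have hdb : sobolevSq (u - u') (v - v') ≤ 4 * B := by
    have a1 : ∫ x, ‖(u - u') x‖ ^ 2 ≤ 2 * (∫ x, ‖u x‖ ^ 2) + 2 * ∫ x, ‖u' x‖ ^ 2 := by
      rw [← integral_const_mul, ← integral_const_mul,
        ← integral_add (h.integrable_sq.const_mul 2) (h'.integrable_sq.const_mul 2)]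
      refine integral_mono hd.integrable_sq
        ((h.integrable_sq.const_mul 2).add (h'.integrable_sq.const_mul 2)) fun x => ?_
      have := norm_sub_le (u x) (u' x)
      simp only [Pi.sub_apply]
      nlinarith [sq_nonneg (‖u x‖ - ‖u' x‖), norm_nonneg (u x - u' x), norm_nonneg (u x),
        norm_nonneg (u' x)]
    have a2 : ∫ x, ‖(v - v') x‖ ^ 2 ≤ 2 * (∫ x, ‖v x‖ ^ 2) + 2 * ∫ x, ‖v' x‖ ^ 2 := by
      rw [← integral_const_mul, ← integral_const_mul,
        ← integral_add (h.integrable_grad_sq.const_mul 2) (h'.integrable_grad_sq.const_mul 2)]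
      refine integral_mono hd.integrable_grad_sq
        ((h.integrable_grad_sq.const_mul 2).add (h'.integrable_grad_sq.const_mul 2)) fun x => ?_
      have := norm_sub_le (v x) (v' x)
      simp only [Pi.sub_apply]
      nlinarith [sq_nonneg (‖v x‖ - ‖v' x‖), norm_nonneg (v x - v' x), norm_nonneg (v x),
        norm_nonneg (v' x)]
    rw [sobolevSq] at hb hb' ⊢
    linarith
  obtain ⟨d1, d2⟩ := H m hm _ _ hd
  obtain ⟨b1, b2⟩ := H 1 le_rfl _ _ h'
  obtain ⟨a1, -⟩ := H 1 le_rfl _ _ h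
  simp only [Pi.sub_apply] at d1 d2
  have hsig : ∀ {g : Space n → ℂ}, AEStronglyMeasurable g volume →
      Integrable (fun x => |f x| * ‖g x‖ ^ 2) → Integrable fun x => f x * ‖g x‖ ^ 2 :=
    fun hg hi => hi.mono' (hfm.mul (hg.norm.pow 2)) (.of_forall fun x => by
      rw [norm_mul, Real.norm_eq_abs, Real.norm_of_nonneg (by positivity)])
  have i1 := hsig h.memLp.1 a1
  have i2 := hsig h'.memLp.1 b1
  have hpt : ∀ x, |f x * ‖u x‖ ^ 2 - f x * ‖u' x‖ ^ 2|
      ≤ (1 + k) * (|f x| * ‖u x - u' x‖ ^ 2) + k⁻¹ * (|f x| * ‖u' x‖ ^ 2) := by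
    intro x
    rw [← mul_sub, abs_mul]
    have e : (1 + k) * (|f x| * ‖u x - u' x‖ ^ 2) + k⁻¹ * (|f x| * ‖u' x‖ ^ 2)
        = |f x| * ((1 + k) * ‖u x - u' x‖ ^ 2 + k⁻¹ * ‖u' x‖ ^ 2) := by ring
    rw [e]
    refine mul_le_mul_of_nonneg_left ?_ (abs_nonneg _)
    set d := ‖u x - u' x‖ with hdd
    have t1 : ‖u x‖ ≤ d + ‖u' x‖ := by
      have := norm_add_le (u x - u' x) (u' x)
      rwa [sub_add_cancel] at this
    have t2 : ‖u' x‖ ≤ d + ‖u x‖ := by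
      have := norm_add_le (u' x - u x) (u x)
      rwa [sub_add_cancel, norm_sub_rev, ← hdd] at this
    have hd0 : 0 ≤ d := norm_nonneg _
    have hu0 := norm_nonneg (u x)
    have hu0' := norm_nonneg (u' x)
    have t3 : 2 * d * ‖u' x‖ ≤ k * d ^ 2 + k⁻¹ * ‖u' x‖ ^ 2 := by
      have : k * d ^ 2 + k⁻¹ * ‖u' x‖ ^ 2 - 2 * d * ‖u' x‖ = k⁻¹ * (k * d - ‖u' x‖) ^ 2 := by
        field_simp
        ring
      have : 0 ≤ k⁻¹ * (k * d - ‖u' x‖) ^ 2 := by positivity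
      linarith
    rw [abs_le]
    constructor <;> nlinarith
  rw [← integral_sub i1 i2]
  refine abs_integral_le_integral_abs.trans ?_
  refine (integral_mono (i1.sub i2).abs ((d1.const_mul (1 + k)).add (b1.const_mul k⁻¹)) hpt).trans ?_
  have := integral_add (d1.const_mul (1 + k)) (b1.const_mul k⁻¹)
  simp only [Pi.add_apply] at this ⊢
  rw [this, integral_const_mul, integral_const_mul]
  have hk0 : 0 ≤ 1 + k := by linarith
  have s1 : (1 + k) * ∫ x, |f x| * ‖u x - u' x‖ ^ 2
      ≤ (1 + k) * (C * (m * (∫ x, ‖u x - u' x‖ ^ 2) + m ^ (-κ) * (4 * B))) := by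
    refine mul_le_mul_of_nonneg_left (d2.trans ?_) hk0
    gcongr
  have s2 : k⁻¹ * ∫ x, |f x| * ‖u' x‖ ^ 2 ≤ k⁻¹ * (C * (2 * B)) := by
    refine mul_le_mul_of_nonneg_left (b2.trans ?_) (by positivity)
    refine mul_le_mul_of_nonneg_left ?_ hC
    have := integral_sq_le_sobolevSq u' v'
    rw [Real.one_rpow]
    linarith
  nlinarith

/-- The form of `V` is differentiable under dilations of an arbitrary `H¹` function: smooth
approximations converge uniformly, together with their derivatives. -/
theorem IsRadialDerivative.hasDerivAt_weight (h : IsRadialDerivative V W)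
    (hVm : AEStronglyMeasurable V volume) (hV : HasFormBound V)
    (hWm : AEStronglyMeasurable W volume) (hW : HasFormBound W)
    {u : Space n → ℂ} {v : Space n → EuclideanSpace ℂ (Fin n)} (hu : IsSobolev u v) :
    HasDerivAt (fun c : ℝ => ∫ x, V x * ‖u (c • x)‖ ^ 2)
      (-((∫ x, W x * ‖u x‖ ^ 2) + n * ∫ x, V x * ‖u x‖ ^ 2)) 1 := by
  obtain ⟨C, hC, H⟩ := exists_smooth_approx n
  obtain ⟨U, hUs, hUc, hUb, -, hUt⟩ := H u v hu
  have hU1 : ∀ k, ContDiff ℝ 1 (U k) := fun k => (hUs k).of_le (by exact_mod_cast le_top)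
  have hUS := fun k => isSobolev_of_contDiff (hU1 k) (hUc k)
  set B := 2 ^ n * 4 * ((C + 1) * sobolevSq u v) with hBdef
  have hS0 := sobolevSq_nonneg u v
  have hB : 0 ≤ B := by positivity
  have hinv : ∀ c ∈ Set.Ioo (1 / 2 : ℝ) 2, 0 < c ∧ c⁻¹ ≤ 2 ∧ (c ^ n)⁻¹ ≤ 2 ^ n ∧ c ^ 2 ≤ 4 := by
    rintro c ⟨hc1, hc2⟩
    have hc0 : 0 < c := by linarith
    have h1 : c⁻¹ ≤ 2 := by
      rw [inv_le_comm₀ hc0 two_pos]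
      linarith
    refine ⟨hc0, h1, ?_, by nlinarith⟩
    rw [← inv_pow]
    gcongr
  have hdil : ∀ (a : Space n → ℂ) (b : Space n → EuclideanSpace ℂ (Fin n)),
      sobolevSq a b ≤ (C + 1) * sobolevSq u v → ∀ c ∈ Set.Ioo (1 / 2 : ℝ) 2,
      sobolevSq (fun x => a (c • x)) (fun x => c • b (c • x)) ≤ B := by
    intro a b hab c hc
    obtain ⟨hc0, -, hc3, hc4⟩ := hinv c hc
    rw [sobolevSq_dilate a b hc0, hBdef, mul_assoc (2 ^ n : ℝ)]
    have i1 : 0 ≤ ∫ x, ‖a x‖ ^ 2 := integral_nonneg fun _ => by positivity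
    have i2 : 0 ≤ ∫ x, ‖b x‖ ^ 2 := integral_nonneg fun _ => by positivity
    rw [sobolevSq] at hab
    have : (∫ x, ‖a x‖ ^ 2) + c ^ 2 * ∫ x, ‖b x‖ ^ 2 ≤ 4 * ((C + 1) * sobolevSq u v) := by
      nlinarith
    exact mul_le_mul hc3 this (by positivity) (by positivity)
  -- uniform convergence of the forms of the dilated approximations
  have hunif : ∀ f : Space n → ℝ, AEStronglyMeasurable f volume → HasFormBound f →
      ∀ ε : ℝ, 0 < ε → ∀ᶠ k in atTop, ∀ c ∈ Set.Ioo (1 / 2 : ℝ) 2,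
      |(∫ x, f x * ‖U k (c • x)‖ ^ 2) - ∫ x, f x * ‖u (c • x)‖ ^ 2| ≤ ε := by
    intro f hfm hf ε hε
    obtain ⟨M, hM, HM⟩ := hf.abs_integral_sub_le hfm hB (half_pos hε)
    have h1 : Tendsto (fun k => M * (2 ^ n * ∫ x, ‖U k x - u x‖ ^ 2)) atTop (𝓝 0) := by
      simpa using (hUt.const_mul (2 ^ n : ℝ)).const_mul M
    filter_upwards [h1.eventually_le_const (half_pos hε)] with k hk c hc
    obtain ⟨hc0, -, hc3, -⟩ := hinv c hc
    have h2 := HM _ _ _ _ ((hUS k).dilate hc0) (hu.dilate hc0)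
      (hdil _ _ ((hUb k).trans (by nlinarith)) c hc) (hdil _ _ (by nlinarith) c hc)
    have h3 := integral_comp_smul_space (fun x => ‖U k x - u x‖ ^ 2) hc0
    simp only [smul_eq_mul] at h3
    rw [h3] at h2
    have i1 : 0 ≤ ∫ x, ‖U k x - u x‖ ^ 2 := integral_nonneg fun _ => by positivity
    have : M * ((c ^ n)⁻¹ * ∫ x, ‖U k x - u x‖ ^ 2) ≤ M * (2 ^ n * ∫ x, ‖U k x - u x‖ ^ 2) := by
      gcongr
    linarith
  have hderiv : ∀ k, ∀ c ∈ Set.Ioo (1 / 2 : ℝ) 2,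
      HasDerivAt (fun c : ℝ => ∫ x, V x * ‖U k (c • x)‖ ^ 2)
        (-(c⁻¹ * ((∫ x, W x * ‖U k (c • x)‖ ^ 2) + n * ∫ x, V x * ‖U k (c • x)‖ ^ 2))) c := by
    intro k c hc
    refine h.hasDerivAt_integral_dilate hVm hV (F := fun x => ‖U k x‖ ^ 2)
      ⟨(hUs k).norm_sq ℝ, ?_⟩ (hinv c hc).1
    exact (hUc k).comp_left (g := fun z : ℂ => ‖z‖ ^ 2) (by simp)
  have h1mem : (1 : ℝ) ∈ Set.Ioo (1 / 2 : ℝ) 2 := by norm_num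
  have := hasDerivAt_of_tendstoUniformlyOn (l := atTop) (s := Set.Ioo (1 / 2 : ℝ) 2) isOpen_Ioo
    (f := fun k (c : ℝ) => ∫ x, V x * ‖U k (c • x)‖ ^ 2)
    (g := fun c : ℝ => ∫ x, V x * ‖u (c • x)‖ ^ 2)
    (f' := fun k (c : ℝ) =>
      -(c⁻¹ * ((∫ x, W x * ‖U k (c • x)‖ ^ 2) + n * ∫ x, V x * ‖U k (c • x)‖ ^ 2)))
    (g' := fun c : ℝ =>
      -(c⁻¹ * ((∫ x, W x * ‖u (c • x)‖ ^ 2) + n * ∫ x, V x * ‖u (c • x)‖ ^ 2)))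
    (by
      rw [Metric.tendstoUniformlyOn_iff]
      intro ε hε
      have hδ : 0 < ε / (4 * (n + 1)) := by positivity
      filter_upwards [hunif W hWm hW _ hδ, hunif V hVm hV _ hδ] with k hk1 hk2 c hc
      obtain ⟨hc0, hc2, -, -⟩ := hinv c hc
      rw [dist_comm, Real.dist_eq]
      have e : ∀ a b a' b' : ℝ, -(c⁻¹ * (a + n * b)) - -(c⁻¹ * (a' + n * b'))
          = -(c⁻¹ * ((a - a') + n * (b - b'))) := fun a b a' b' => by ring
      rw [e, abs_neg, abs_mul, abs_of_pos (inv_pos.2 hc0)]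
      have s1 := hk1 c hc
      have s2 := hk2 c hc
      refine lt_of_le_of_lt (mul_le_mul hc2 ((abs_add_le _ _).trans (add_le_add s1 ?_))
        (abs_nonneg _) two_pos.le) (b := 2 * (ε / (4 * (n + 1)) + n * (ε / (4 * (n + 1))))) ?_
      · rw [abs_mul, Nat.abs_cast]
        gcongr
      · have : 2 * (ε / (4 * (n + 1)) + n * (ε / (4 * (n + 1)))) = ε / 2 := by
          field_simp
          ring
        rw [this]
        linarith)
    (.of_forall hderiv)
    (fun c hc => by
      rw [Metric.tendsto_nhds]
      intro ε hε
      filter_upwards [hunif V hVm hV _ (half_pos hε)] with k hk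
      rw [Real.dist_eq]
      exact (hk c hc).trans_lt (by linarith)) h1mem
  simpa using this

end WeightDilation

/-! ### Local Lipschitz continuity of dilations -/

section DilationDifference

variable {n : ℕ}

/-- Dilations are Lipschitz in `L²` of a ball, for smooth functions: integrate the derivative along
the segment from `x` to `c x`. -/
theorem setLIntegral_dilate_sub_le {U : Space n → ℂ} (hU : ContDiff ℝ 1 U)
    (hUs : HasCompactSupport U) {c R : ℝ} (hc : c ∈ Set.Icc (1 / 2 : ℝ) 2) :
    ∫⁻ x in Metric.ball (0 : Space n) R, ‖U (c • x) - U x‖ₑ ^ 2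
      ≤ ENNReal.ofReal ((c - 1) ^ 2 * R ^ 2 * (2 ^ n * ∫ x, ‖classicalGrad U x‖ ^ 2)) := by
  have hG := continuous_classicalGrad hU
  have hGL : MemLp (classicalGrad U) 2 volume :=
    hG.memLp_of_hasCompactSupport (hasCompactSupport_classicalGrad hUs)
  have hdc : Continuous (fderiv ℝ U) := hU.continuous_fderiv (by simp)
  set t : ℝ → ℝ := fun s => 1 + s * (c - 1) with ht
  have htc : Continuous t := by fun_prop
  have hpt : ∀ x ∈ Metric.ball (0 : Space n) R, ‖U (c • x) - U x‖ₑ ^ 2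
      ≤ ∫⁻ s in Set.Ioc (0 : ℝ) 1,
        ENNReal.ofReal ((c - 1) ^ 2 * R ^ 2) * ‖classicalGrad U (t s • x)‖ₑ ^ 2 := by
    intro x hx
    have hxR : ‖x‖ ≤ R := (mem_ball_zero_iff.1 hx).le
    have hcont : Continuous fun s => fderiv ℝ U (t s • x) ((c - 1) • x) :=
      (hdc.comp (by fun_prop)).clm_apply continuous_const
    have hder : ∀ s ∈ Set.uIcc (0 : ℝ) 1, HasDerivAt (fun s => U (t s • x))
        (fderiv ℝ U (t s • x) ((c - 1) • x)) s := by
      intro s _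
      have h1 : HasDerivAt (fun s : ℝ => t s • x) ((c - 1) • x) s := by
        have : HasDerivAt t (c - 1) s := by
          have h2 := ((hasDerivAt_id s).mul_const (c - 1)).const_add 1
          rwa [one_mul] at h2
        exact this.smul_const x
      exact (hU.differentiable one_ne_zero (t s • x)).hasFDerivAt.comp_hasDerivAt s h1
    have hftc := intervalIntegral.integral_eq_sub_of_hasDerivAt hder
      (hcont.intervalIntegrable 0 1)
    have e : U (c • x) - U x = ∫ s in Set.Ioc (0 : ℝ) 1, fderiv ℝ U (t s • x) ((c - 1) • x) := by
      rw [← intervalIntegral.integral_of_le zero_le_one, hftc]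
      simp [ht]
    rw [e]
    have h1 : ‖∫ s in Set.Ioc (0 : ℝ) 1, fderiv ℝ U (t s • x) ((c - 1) • x)‖ₑ ^ 2
        ≤ (∫⁻ s in Set.Ioc (0 : ℝ) 1, ‖fderiv ℝ U (t s • x) ((c - 1) • x)‖ₑ * 1) ^ 2 := by
      simp only [mul_one]
      gcongr
      exact enorm_integral_le_lintegral_enorm _
    refine (h1.trans (lintegral_mul_sq_le hcont.measurable.enorm.aemeasurable
      aemeasurable_const)).trans ?_
    simp only [one_pow, lintegral_const, Measure.restrict_apply_univ, Real.volume_Ioc, sub_zero,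
      ENNReal.ofReal_one, mul_one]
    refine lintegral_mono fun s => ?_
    rw [← ofReal_norm, ← ofReal_norm, ← ENNReal.ofReal_pow (norm_nonneg _),
      ← ENNReal.ofReal_pow (norm_nonneg _), ← ENNReal.ofReal_mul (by positivity)]
    refine ENNReal.ofReal_le_ofReal ?_
    have h2 : ‖fderiv ℝ U (t s • x) ((c - 1) • x)‖
        ≤ ‖classicalGrad U (t s • x)‖ * (|c - 1| * R) := by
      refine (ContinuousLinearMap.le_opNorm _ _).trans ?_
      rw [norm_smul, Real.norm_eq_abs]
      gcongr
      exact norm_fderiv_le_classicalGrad U _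
    calc _ ≤ (‖classicalGrad U (t s • x)‖ * (|c - 1| * R)) ^ 2 := by gcongr
      _ = _ := by rw [mul_pow, mul_pow, sq_abs]; ring
  have hmeas : AEMeasurable (Function.uncurry fun (x : Space n) (s : ℝ) =>
      ENNReal.ofReal ((c - 1) ^ 2 * R ^ 2) * ‖classicalGrad U (t s • x)‖ₑ ^ 2)
      ((volume.restrict (Metric.ball (0 : Space n) R)).prod
        (volume.restrict (Set.Ioc (0 : ℝ) 1))) := by
    have h1 : Continuous fun y : Space n × ℝ => classicalGrad U (t y.2 • y.1) :=
      hG.comp (by fun_prop)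
    exact ((h1.measurable.enorm.pow_const 2).const_mul _).aemeasurable
  refine (setLIntegral_mono' Metric.isOpen_ball.measurableSet hpt).trans ?_
  rw [lintegral_lintegral_swap hmeas]
  have hin : ∀ s ∈ Set.Ioc (0 : ℝ) 1, ∫⁻ x in Metric.ball (0 : Space n) R,
      ENNReal.ofReal ((c - 1) ^ 2 * R ^ 2) * ‖classicalGrad U (t s • x)‖ₑ ^ 2
      ≤ ENNReal.ofReal ((c - 1) ^ 2 * R ^ 2 * (2 ^ n * ∫ x, ‖classicalGrad U x‖ ^ 2)) := by
    intro s hs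
    have hts : 1 / 2 ≤ t s := by
      simp only [ht]
      nlinarith [hs.1, hs.2, hc.1, hc.2]
    have hts0 : 0 < t s := by linarith
    rw [lintegral_const_mul' _ _ ENNReal.ofReal_ne_top,
      ENNReal.ofReal_mul (p := (c - 1) ^ 2 * R ^ 2) (by positivity)]
    gcongr
    refine (setLIntegral_le_lintegral _ _).trans ?_
    rw [lintegral_enorm_sq_eq (memLp_comp_smul hts0.ne' hGL)]
    refine ENNReal.ofReal_le_ofReal ?_
    rw [integral_comp_smul_space (fun x => ‖classicalGrad U x‖ ^ 2) hts0, smul_eq_mul]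
    have h1 : (t s ^ n)⁻¹ ≤ 2 ^ n := by
      rw [← inv_pow]
      gcongr
      rw [inv_le_comm₀ hts0 two_pos]
      linarith
    exact mul_le_mul_of_nonneg_right h1 (integral_nonneg fun _ => by positivity)
  refine (setLIntegral_mono' measurableSet_Ioc hin).trans ?_
  simp

theorem ae_comp_smul {P : Space n → Prop} (h : ∀ᵐ x, P x) {c : ℝ} (hc : c ≠ 0) :
    ∀ᵐ x : Space n, P (c • x) := by
  refine ae_of_ae_map (measurableEmbedding_smul hc).measurable.aemeasurable ?_
  rw [Measure.map_addHaar_smul _ hc]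
  exact Measure.ae_smul_measure h _

/-- Dilations are Lipschitz from `H¹` to `L²` of a ball. -/
theorem exists_integral_ball_dilate_sub_le (n : ℕ) : ∃ C : ℝ, 0 ≤ C ∧
    ∀ (u : Space n → ℂ) (v : Space n → EuclideanSpace ℂ (Fin n)), IsSobolev u v →
    ∀ c ∈ Set.Icc (1 / 2 : ℝ) 2, ∀ R : ℝ, 0 ≤ R →
      ∫ x in Metric.ball (0 : Space n) R, ‖u (c • x) - u x‖ ^ 2
        ≤ (c - 1) ^ 2 * R ^ 2 * (C * sobolevSq u v) := by
  obtain ⟨C, hC, H⟩ := exists_smooth_approx n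
  refine ⟨2 ^ n * C, by positivity, fun u v h c hc R hR => ?_⟩
  obtain ⟨U, hUs, hUc, hUb, hUt, -⟩ := H u v h
  have hS := sobolevSq_nonneg u v
  have hU1 : ∀ k, ContDiff ℝ 1 (U k) := fun k => (hUs k).of_le (by exact_mod_cast le_top)
  have hc0 : c ≠ 0 := by
    have := hc.1
    intro h0
    norm_num [h0] at this
  have hlim : ∀ᵐ x, Tendsto (fun k => ‖U k (c • x) - U k x‖ₑ ^ 2) atTop
      (𝓝 (‖u (c • x) - u x‖ₑ ^ 2)) := by
    filter_upwards [hUt, ae_comp_smul hUt hc0] with x hx hx'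
    exact ENNReal.Tendsto.pow (hx'.sub hx).enorm
  have hle : ∀ k, ∫⁻ x in Metric.ball (0 : Space n) R, ‖U k (c • x) - U k x‖ₑ ^ 2
      ≤ ENNReal.ofReal ((c - 1) ^ 2 * R ^ 2 * (2 ^ n * C * sobolevSq u v)) := by
    intro k
    refine (setLIntegral_dilate_sub_le (hU1 k) (hUc k) hc).trans (ENNReal.ofReal_le_ofReal ?_)
    have h1 : ∫ x, ‖classicalGrad (U k) x‖ ^ 2 ≤ C * sobolevSq u v := by
      refine le_trans ?_ (hUb k)
      exact le_add_of_nonneg_left (integral_nonneg fun _ => by positivity)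
    rw [mul_assoc (2 ^ n : ℝ)]
    gcongr
  have hfatou : ∫⁻ x in Metric.ball (0 : Space n) R, ‖u (c • x) - u x‖ₑ ^ 2
      ≤ ENNReal.ofReal ((c - 1) ^ 2 * R ^ 2 * (2 ^ n * C * sobolevSq u v)) := by
    calc _ = ∫⁻ x in Metric.ball (0 : Space n) R,
          liminf (fun k => ‖U k (c • x) - U k x‖ₑ ^ 2) atTop :=
          lintegral_congr_ae (ae_restrict_of_ae (hlim.mono fun x hx => hx.liminf_eq.symm))
      _ ≤ liminf (fun k => ∫⁻ x in Metric.ball (0 : Space n) R, ‖U k (c • x) - U k x‖ₑ ^ 2)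
          atTop := lintegral_liminf_le' fun k => by
            have hcc : Continuous fun x => U k (c • x) - U k x :=
              ((hU1 k).continuous.comp (by fun_prop)).sub (hU1 k).continuous
            exact (hcc.measurable.enorm.pow_const 2).aemeasurable
      _ ≤ _ := (liminf_le_liminf (.of_forall hle)).trans_eq (liminf_const _)
  have hm : AEStronglyMeasurable (fun x => u (c • x) - u x) volume :=
    (memLp_comp_smul hc0 h.memLp).1.sub h.memLp.1
  have hm2 : AEStronglyMeasurable (fun x => ‖u (c • x) - u x‖ ^ 2) volume := hm.norm.pow 2
  rw [integral_eq_lintegral_of_nonneg_ae (.of_forall fun x => by positivity) hm2.restrict]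
  refine ENNReal.toReal_le_of_le_ofReal (by positivity) (le_trans (le_of_eq ?_) hfatou)
  refine lintegral_congr fun x => ?_
  rw [ENNReal.ofReal_pow (norm_nonneg _), ofReal_norm]

end DilationDifference

/-! ### The dilation identity for coherent states -/

section Pohozaev

variable {n : ℕ} {p γ E : ℝ} {V W : Space n → ℝ}

theorem integral_add_three {f g h : Space n → ℝ} (hf : Integrable f) (hg : Integrable g)
    (hh : Integrable h) :
    ∫ x, (f x + g x + h x) = (∫ x, f x) + (∫ x, g x) + ∫ x, h x := by
  rw [← integral_add hf hg]
  exact integral_add (hf.add hg) hh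

/-- Form compactness is uniform over bounded dilations of the weight. -/
theorem IsFormCompact.dilate {f : Space n → ℝ} (hf : IsFormCompact f) {ε : ℝ} (hε : 0 < ε) :
    ∃ M R : ℝ, 0 ≤ M ∧ 0 < R ∧ ∀ c ∈ Set.Icc (1 / 2 : ℝ) 2,
      ∀ (w : Space n → ℂ) (z : Space n → EuclideanSpace ℂ (Fin n)), IsSobolev w z →
      Integrable (fun x => |f (c • x)| * ‖w x‖ ^ 2) ∧
      ∫ x, |f (c • x)| * ‖w x‖ ^ 2
        ≤ ε * sobolevSq w z + M * ∫ x in Metric.ball 0 R, ‖w x‖ ^ 2 := by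
  obtain ⟨M, R, hM, hR, H⟩ := hf (ε / 4) (by positivity)
  refine ⟨M, 2 * R, hM, by linarith, fun c hc w z h => ?_⟩
  have hc0 : 0 < c := by linarith [hc.1]
  have hci : 0 < c⁻¹ := inv_pos.2 hc0
  have hci2 : c⁻¹ ≤ 2 := by
    rw [inv_le_comm₀ hc0 two_pos]
    linarith [hc.1]
  obtain ⟨h1, h2⟩ := H _ _ (h.dilate hci)
  have hint : Integrable fun x => |f (c • x)| * ‖w x‖ ^ 2 := by
    have := h1.comp_smul hc0.ne'
    simpa only [inv_smul_smul₀ hc0.ne'] using this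
  refine ⟨hint, ?_⟩
  have e : ∫ x, |f (c • x)| * ‖w x‖ ^ 2 = (c ^ n)⁻¹ * ∫ x, |f x| * ‖w (c⁻¹ • x)‖ ^ 2 := by
    have := integral_comp_smul_space (fun x => |f x| * ‖w (c⁻¹ • x)‖ ^ 2) hc0
    simpa only [inv_smul_smul₀ hc0.ne', smul_eq_mul] using this
  have cB : (c ^ n)⁻¹ * ∫ x in Metric.ball (0 : Space n) R, ‖w (c⁻¹ • x)‖ ^ 2
      ≤ ∫ x in Metric.ball (0 : Space n) (2 * R), ‖w x‖ ^ 2 := by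
    have := integral_comp_smul_space
      ((Metric.ball (0 : Space n) R).indicator fun x => ‖w (c⁻¹ • x)‖ ^ 2) hc0
    rw [smul_eq_mul, integral_indicator Metric.isOpen_ball.measurableSet] at this
    rw [← this, ← integral_indicator Metric.isOpen_ball.measurableSet]
    refine integral_mono_of_nonneg
      (.of_forall fun x => Set.indicator_nonneg (fun y _ => by positivity) _)
      (h.integrable_sq.indicator Metric.isOpen_ball.measurableSet) (.of_forall fun x => ?_)
    by_cases hx : c • x ∈ Metric.ball (0 : Space n) R
    · have hx2 : x ∈ Metric.ball (0 : Space n) (2 * R) := by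
        rw [mem_ball_zero_iff, norm_smul, Real.norm_of_nonneg hc0.le] at hx
        rw [mem_ball_zero_iff]
        nlinarith [norm_nonneg x, hc.1]
      simp only [Set.indicator_of_mem hx, Set.indicator_of_mem hx2, inv_smul_smul₀ hc0.ne']
      exact le_rfl
    · simp only [Set.indicator_of_notMem hx]
      exact Set.indicator_nonneg (fun y _ => by positivity) _
  have cS : (c ^ n)⁻¹ * sobolevSq (fun x => w (c⁻¹ • x)) (fun x => c⁻¹ • z (c⁻¹ • x))
      ≤ 4 * sobolevSq w z := by
    rw [sobolevSq_dilate w z hci, inv_pow, inv_inv, ← mul_assoc, inv_mul_cancel₀ (by positivity),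
      one_mul, sobolevSq]
    have i1 : 0 ≤ ∫ x, ‖w x‖ ^ 2 := integral_nonneg fun _ => by positivity
    have i2 : 0 ≤ ∫ x, ‖z x‖ ^ 2 := integral_nonneg fun _ => by positivity
    have : (c⁻¹) ^ 2 ≤ 4 := by nlinarith
    nlinarith
  rw [e]
  refine (mul_le_mul_of_nonneg_left h2 (by positivity : (0 : ℝ) ≤ (c ^ n)⁻¹)).trans ?_
  calc _ = ε / 4 * ((c ^ n)⁻¹ * sobolevSq (fun x => w (c⁻¹ • x)) (fun x => c⁻¹ • z (c⁻¹ • x)))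
        + M * ((c ^ n)⁻¹ * ∫ x in Metric.ball (0 : Space n) R, ‖w (c⁻¹ • x)‖ ^ 2) := by ring
    _ ≤ ε / 4 * (4 * sobolevSq w z) + M * ∫ x in Metric.ball (0 : Space n) (2 * R), ‖w x‖ ^ 2 := by
      gcongr
    _ = _ := by ring

theorem HasFormBound.integrable_mul (hV : HasFormBound V) (hVm : AEStronglyMeasurable V volume)
    {a : Space n → ℂ} {b : Space n → EuclideanSpace ℂ (Fin n)} (h : IsSobolev a b) :
    Integrable fun x => V x * ‖a x‖ ^ 2 :=
  (hV.integrable h).mono' (hVm.mul (h.memLp.1.norm.pow 2)) (.of_forall fun x => by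
    rw [norm_mul, Real.norm_eq_abs, Real.norm_of_nonneg (by positivity)])

theorem HasFormBound.integral_add_const_mul (hV : HasFormBound V)
    (hVm : AEStronglyMeasurable V volume) (E : ℝ)
    {a : Space n → ℂ} {b : Space n → EuclideanSpace ℂ (Fin n)} (h : IsSobolev a b) :
    Integrable (fun x => (V x + E) * ‖a x‖ ^ 2) ∧
    ∫ x, (V x + E) * ‖a x‖ ^ 2 = (∫ x, V x * ‖a x‖ ^ 2) + E * ∫ x, ‖a x‖ ^ 2 := by
  have h1 := hV.integrable_mul hVm h
  have h2 := h.integrable_sq.const_mul E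
  simp only [add_mul]
  exact ⟨h1.add h2, by rw [integral_add h1 h2, integral_const_mul]⟩

/-- Exact second order expansion of the action at a coherent state. -/
theorem IsCoherentState.action_sub (hn : 1 ≤ n) (hp : 0 < p)
    (hp' : 3 ≤ n → p < 4 / ((n : ℝ) - 2)) (hVm : AEStronglyMeasurable V volume)
    (hV : HasFormBound V) {φ : H1 n} (hφ : IsCoherentState V γ p E φ)
    {u : Space n → ℂ} {v : Space n → EuclideanSpace ℂ (Fin n)} (h : IsSobolev u v) :
    1 / 2 * ((∫ x, ‖v x‖ ^ 2) - gradSq φ)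
      + 1 / 2 * ((∫ x, (V x + E) * ‖u x‖ ^ 2) - ∫ x, (V x + E) * ‖H1.val φ x‖ ^ 2)
      + γ / (p + 2) * ((∫ x, ‖u x‖ ^ (p + 2)) - lpPow p φ)
    = 1 / 2 * (∫ x, ‖v x - H1.grad φ x‖ ^ 2)
      + 1 / 2 * (∫ x, (V x + E) * ‖u x - H1.val φ x‖ ^ 2)
      + γ / (p + 2) * ∫ x, powerRemainder p (H1.val φ x) (u x) := by
  have hS := H1.isSobolev φ
  have hd := h.sub hS
  have heq := hφ.re_eq hn hp hp' hVm hV hd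
  obtain ⟨i1, i2⟩ := integrable_weak_terms hn hp hp' hVm hV E hS hd
  replace i1 := (integral_ofReal_mul_re i1).1
  replace i2 := (integral_ofReal_mul_re i2).1
  have i3 : Integrable fun x => (inner ℂ ((v - H1.grad φ) x) (H1.grad φ x)).re :=
    (hS.integrable_grad_inner hd).re
  have hVint : ∀ {a : Space n → ℂ} {b : Space n → EuclideanSpace ℂ (Fin n)}, IsSobolev a b →
      Integrable fun x => (V x + E) * ‖a x‖ ^ 2 :=
    fun hab => (hV.integral_add_const_mul hVm E hab).1
  simp only [Pi.sub_apply] at heq i1 i2 i3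
  have j1 := hd.integrable_grad_sq
  have j2 := hVint hd
  simp only [Pi.sub_apply] at j1 j2
  have hN := integrable_norm_rpow_add_two hn hp hp' h
  have hN' := integrable_norm_rpow_add_two hn hp hp' hS
  have e1 : ∫ x, ‖v x‖ ^ 2 = gradSq φ + 2 * (∫ x, (inner ℂ (v x - H1.grad φ x) (H1.grad φ x)).re)
      + ∫ x, ‖v x - H1.grad φ x‖ ^ 2 := by
    rw [gradSq, ← integral_const_mul, ← integral_add_three hS.integrable_grad_sq
      (i3.const_mul 2) j1]
    refine integral_congr_ae (.of_forall fun x => ?_)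
    have := norm_add_sq (𝕜 := ℂ) (v x - H1.grad φ x) (H1.grad φ x)
    rw [sub_add_cancel] at this
    simp only [RCLike.re_to_complex] at this
    simp only [this]
    ring
  have e2 : ∫ x, (V x + E) * ‖u x‖ ^ 2 = (∫ x, (V x + E) * ‖H1.val φ x‖ ^ 2)
      + 2 * (∫ x, (V x + E) * (H1.val φ x * star (u x - H1.val φ x)).re)
      + ∫ x, (V x + E) * ‖u x - H1.val φ x‖ ^ 2 := by
    rw [← integral_const_mul, ← integral_add_three (hVint hS) (i1.const_mul 2) j2]
    refine integral_congr_ae (.of_forall fun x => ?_)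
    have : ‖u x‖ ^ 2 = ‖H1.val φ x‖ ^ 2 + 2 * (H1.val φ x * star (u x - H1.val φ x)).re
        + ‖u x - H1.val φ x‖ ^ 2 := by
      simp only [← re_mul_star_self, star_sub, mul_sub, sub_mul, Complex.sub_re]
      rw [re_mul_star_comm (u x) (H1.val φ x)]
      ring
    simp only [this]
    ring
  have e3 : ∫ x, powerRemainder p (H1.val φ x) (u x) = (∫ x, ‖u x‖ ^ (p + 2)) - lpPow p φ
      - (p + 2) * ∫ x, ‖H1.val φ x‖ ^ p * (H1.val φ x * star (u x - H1.val φ x)).re := by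
    have h1 := integral_add_three hN hN'.neg (i2.const_mul (p + 2)).neg
    simp only [Pi.neg_apply, integral_neg, integral_const_mul, ← sub_eq_add_neg] at h1
    rw [lpPow, ← h1]
    rfl
  have hp2 : p + 2 ≠ 0 := by linarith
  rw [e1, e2, e3]
  field_simp
  linear_combination (p + 2) * 2 * heq

/-- Near a coherent state, the action is bounded below by its quadratic errors. -/
theorem IsCoherentState.action_sub_ge (hn : 1 ≤ n) (hp : 0 < p)
    (hp' : 3 ≤ n → p < 4 / ((n : ℝ) - 2)) (hγ : γ < 0) (hVm : AEStronglyMeasurable V volume)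
    (hV : HasFormBound V) {φ : H1 n} (hφ : IsCoherentState V γ p E φ)
    {u : Space n → ℂ} {v : Space n → EuclideanSpace ℂ (Fin n)} (h : IsSobolev u v) :
    1 / 2 * (∫ x, ‖v x - H1.grad φ x‖ ^ 2) + E / 2 * (∫ x, ‖u x - H1.val φ x‖ ^ 2)
      - 1 / 2 * (∫ x, |V x| * ‖u x - H1.val φ x‖ ^ 2)
      + γ * (p + 2) * ((∫ x, ‖H1.val φ x‖ ^ p * ‖u x - H1.val φ x‖ ^ 2)
        + ∫ x, ‖u x‖ ^ p * ‖u x - H1.val φ x‖ ^ 2)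
    ≤ 1 / 2 * ((∫ x, ‖v x‖ ^ 2) - gradSq φ)
      + 1 / 2 * ((∫ x, V x * ‖u x‖ ^ 2) - ∫ x, V x * ‖H1.val φ x‖ ^ 2)
      + E / 2 * ((∫ x, ‖u x‖ ^ 2) - 2 * charge φ)
      + γ / (p + 2) * ((∫ x, ‖u x‖ ^ (p + 2)) - lpPow p φ) := by
  have hp2 : 0 < p + 2 := by linarith
  have hS := H1.isSobolev φ
  have hd := h.sub hS
  have hact := hφ.action_sub hn hp hp' hVm hV h
  have e1 := (hV.integral_add_const_mul hVm E h).2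
  have e2 := (hV.integral_add_const_mul hVm E hS).2
  have e3 := (hV.integral_add_const_mul hVm E hd).2
  simp only [Pi.sub_apply] at e3
  rw [charge_eq] at e2
  rw [e1, e2, e3] at hact
  obtain ⟨K, hK, HK⟩ := integrable_power_weight hn hp hp'
  have iP := (HK _ _ hS _ _ hd).1
  have iP' := (HK _ _ h _ _ hd).1
  have iV := hV.integrable hd
  have iV' := hV.integrable_mul hVm hd
  simp only [Pi.sub_apply] at iP iP' iV iV'
  have t1 : -(∫ x, |V x| * ‖u x - H1.val φ x‖ ^ 2) ≤ ∫ x, V x * ‖u x - H1.val φ x‖ ^ 2 := by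
    rw [← integral_neg]
    refine integral_mono iV.neg iV' fun x => ?_
    simp only
    rw [neg_mul_eq_neg_mul]
    exact mul_le_mul_of_nonneg_right (neg_abs_le _) (by positivity)
  have t3 : ∫ x, powerRemainder p (H1.val φ x) (u x)
      ≤ (p + 2) ^ 2 * ((∫ x, ‖H1.val φ x‖ ^ p * ‖u x - H1.val φ x‖ ^ 2)
        + ∫ x, ‖u x‖ ^ p * ‖u x - H1.val φ x‖ ^ 2) := by
    rw [← integral_add iP iP', ← integral_const_mul]
    refine integral_mono_of_nonneg (.of_forall fun x => powerRemainder_nonneg hp _ _)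
      ((iP.add iP').const_mul _) (.of_forall fun x => ?_)
    have := powerRemainder_le hp (H1.val φ x) (u x)
    rw [add_mul] at this
    exact this
  have h2 := mul_le_mul_of_nonneg_left t3 (div_nonneg (by linarith : 0 ≤ -γ) hp2.le)
  have e : -γ / (p + 2) * ((p + 2) ^ 2 * ((∫ x, ‖H1.val φ x‖ ^ p * ‖u x - H1.val φ x‖ ^ 2)
        + ∫ x, ‖u x‖ ^ p * ‖u x - H1.val φ x‖ ^ 2))
      = -(γ * (p + 2) * ((∫ x, ‖H1.val φ x‖ ^ p * ‖u x - H1.val φ x‖ ^ 2)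
        + ∫ x, ‖u x‖ ^ p * ‖u x - H1.val φ x‖ ^ 2)) := by
    field_simp
  rw [e, neg_div, neg_mul] at h2
  linarith

/-- Near a coherent state, the action decreases at most quadratically under dilations: the second
order terms are controlled on a ball by form compactness, where dilations are Lipschitz. -/
theorem IsCoherentState.dilate_action_ge (hn : 1 ≤ n) (hp : 0 < p)
    (hp' : 3 ≤ n → p < 4 / ((n : ℝ) - 2)) (hγ : γ < 0) (hE : 0 < E)
    (hVm : AEStronglyMeasurable V volume)
    (hV : HasFormBound V) (hVc : IsFormCompact V) {φ : H1 n} (hφ : IsCoherentState V γ p E φ) :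
    ∃ B : ℝ, ∀ c ∈ Set.Icc (1 / 2 : ℝ) 2, -(B * (c - 1) ^ 2)
      ≤ 1 / 2 * ((c ^ n)⁻¹ * c ^ 2 * gradSq φ - gradSq φ)
      + 1 / 2 * ((∫ x, V x * ‖H1.val φ (c • x)‖ ^ 2) - ∫ x, V x * ‖H1.val φ x‖ ^ 2)
      + E / 2 * ((c ^ n)⁻¹ * (2 * charge φ) - 2 * charge φ)
      + γ / (p + 2) * ((c ^ n)⁻¹ * lpPow p φ - lpPow p φ) := by
  have hS := H1.isSobolev φ
  have hp2 : 0 < p + 2 := by linarith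
  obtain ⟨D, hD, hDil⟩ := exists_integral_ball_dilate_sub_le n
  -- `ε` is chosen so that all error terms are absorbed by `(1/2) ∫ |z|² + (E/2) ∫ |w|²`
  set g := -(γ * (p + 2)) with hg
  have hg0 : 0 < g := neg_pos.2 (mul_neg_of_neg_of_pos hγ hp2)
  set a := min (1 / 2) (E / 2) with ha
  have ha0 : 0 < a := lt_min (by norm_num) (by linarith)
  set ε := a / (1 / 2 + 2 * g) with hε
  have hε0 : 0 < ε := by positivity
  have hεa : (1 / 2 + 2 * g) * ε = a := by
    rw [hε]
    field_simp
  obtain ⟨M₁, R₁, hM₁, hR₁, H₁⟩ := hVc ε hε0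
  obtain ⟨M₂, R₂, hM₂, hR₂, H₂⟩ := (isFormCompact_norm_rpow hn hp hp' hS).dilate hε0
  set DS := D * sobolevSq (H1.val φ) (H1.grad φ) with hDS
  refine ⟨1 / 2 * (M₁ * (R₁ ^ 2 * DS)) + 2 * (g * (M₂ * (R₂ ^ 2 * DS))), fun c hc => ?_⟩
  have hc0 : 0 < c := by linarith [hc.1]
  have hSc := hS.dilate hc0
  have hd := hSc.sub hS
  have hact := hφ.action_sub_ge hn hp hp' hγ hVm hV hSc
  have eT : ∫ x, ‖c • H1.grad φ (c • x)‖ ^ 2 = (c ^ n)⁻¹ * c ^ 2 * gradSq φ := by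
    have e2 : (fun x => ‖c • H1.grad φ (c • x)‖ ^ 2)
        = fun x => c ^ 2 * ‖H1.grad φ (c • x)‖ ^ 2 := by
      ext x
      rw [norm_smul, mul_pow, Real.norm_eq_abs, sq_abs]
    rw [e2, integral_const_mul, integral_comp_smul_space (fun x => ‖H1.grad φ x‖ ^ 2) hc0,
      smul_eq_mul, gradSq]
    ring
  have eN : ∫ x, ‖H1.val φ (c • x)‖ ^ (p + 2) = (c ^ n)⁻¹ * lpPow p φ :=
    integral_comp_smul_space (fun x => ‖H1.val φ x‖ ^ (p + 2)) hc0
  have eQ : ∫ x, ‖H1.val φ (c • x)‖ ^ 2 = (c ^ n)⁻¹ * (2 * charge φ) := by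
    rw [integral_comp_smul_space (fun x => ‖H1.val φ x‖ ^ 2) hc0, smul_eq_mul, charge_eq]
  rw [eT, eN, eQ] at hact
  refine le_trans ?_ hact
  have hone : (1 : ℝ) ∈ Set.Icc (1 / 2 : ℝ) 2 := by norm_num
  have t1 := (H₁ _ _ hd).2
  have t2 := (H₂ 1 hone _ _ hd).2
  have t3 := (H₂ c hc _ _ hd).2
  have habs : ∀ x, |‖H1.val φ x‖ ^ p| = ‖H1.val φ x‖ ^ p := fun x => abs_of_nonneg (by positivity)
  simp only [habs, one_smul] at t2 t3
  have b1 := mul_le_mul_of_nonneg_left (hDil _ _ hS c hc R₁ hR₁.le) hM₁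
  have b2 := mul_le_mul_of_nonneg_left (hDil _ _ hS c hc R₂ hR₂.le) hM₂
  have hsob : sobolevSq ((fun x => H1.val φ (c • x)) - H1.val φ)
      ((fun x => c • H1.grad φ (c • x)) - H1.grad φ)
      = (∫ x, ‖H1.val φ (c • x) - H1.val φ x‖ ^ 2)
        + ∫ x, ‖c • H1.grad φ (c • x) - H1.grad φ x‖ ^ 2 := rfl
  simp only [Pi.sub_apply, hsob] at t1 t2 t3
  have i1 : 0 ≤ ∫ x, ‖H1.val φ (c • x) - H1.val φ x‖ ^ 2 := integral_nonneg fun _ => by positivity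
  have i2 : 0 ≤ ∫ x, ‖c • H1.grad φ (c • x) - H1.grad φ x‖ ^ 2 :=
    integral_nonneg fun _ => by positivity
  have l1 := mul_le_mul_of_nonneg_right (min_le_left (1 / 2 : ℝ) (E / 2)) i2
  have l2 := mul_le_mul_of_nonneg_right (min_le_right (1 / 2 : ℝ) (E / 2)) i1
  rw [← ha, ← hεa] at l1 l2
  have eg : γ * (p + 2) = -g := by rw [hg, neg_neg]
  have m4 := mul_le_mul_of_nonneg_left (add_le_add (t2.trans (add_le_add_right b2 _))
    (t3.trans (add_le_add_right b2 _))) hg0.le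
  rw [eg]
  linarith

/-- Dilation (Pohozaev) identity for the kinetic energy of a coherent state. -/
theorem IsCoherentState.pohozaev (hn : 1 ≤ n) (hp : 0 < p)
    (hp' : 3 ≤ n → p < 4 / ((n : ℝ) - 2)) (hγ : γ < 0) (hE : 0 < E)
    (hVm : AEStronglyMeasurable V volume) (hV : HasFormBound V) (hVc : IsFormCompact V)
    (hWm : AEStronglyMeasurable W volume) (hW : HasFormBound W) (hVW : IsRadialDerivative V W)
    {φ : H1 n} (hφ : IsCoherentState V γ p E φ) :
    gradSq φ = -γ * (n * p / (2 * p + 4)) * lpPow p φ + 1 / 2 * ∫ x, W x * ‖H1.val φ x‖ ^ 2 := by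
  have hp2 : p + 2 ≠ 0 := by linarith
  obtain ⟨B, hB⟩ := hφ.dilate_action_ge hn hp hp' hγ hE hVm hV hVc
  have hv := hVW.hasDerivAt_weight hVm hV hWm hW (H1.isSobolev φ)
  have h1 : HasDerivAt (fun c : ℝ => (c ^ n)⁻¹) (-(n : ℝ)) 1 := by
    have := (hasDerivAt_pow n (1 : ℝ)).inv (by simp)
    simp only [one_pow, mul_one, div_one] at this
    exact this
  have h2 : HasDerivAt (fun c : ℝ => c ^ 2) 2 1 := by
    simpa using hasDerivAt_pow 2 (1 : ℝ)
  have h3 : HasDerivAt (fun c : ℝ => (c - 1) ^ 2) 0 1 := by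
    have := ((hasDerivAt_id (1 : ℝ)).sub_const 1).pow 2
    simp only [id, sub_self] at this
    convert! this using 1
    norm_num
  -- the action plus the quadratic error is minimal at `c = 1`
  have hder : HasDerivAt (fun c : ℝ => 1 / 2 * ((c ^ n)⁻¹ * c ^ 2 * gradSq φ - gradSq φ)
      + 1 / 2 * ((∫ x, V x * ‖H1.val φ (c • x)‖ ^ 2) - ∫ x, V x * ‖H1.val φ x‖ ^ 2)
      + E / 2 * ((c ^ n)⁻¹ * (2 * charge φ) - 2 * charge φ)
      + γ / (p + 2) * ((c ^ n)⁻¹ * lpPow p φ - lpPow p φ) + B * (c - 1) ^ 2) _ 1 :=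
    ((((((h1.mul h2).mul_const (gradSq φ)).sub_const (gradSq φ)).const_mul (1 / 2)).add
    ((hv.sub_const (∫ x, V x * ‖H1.val φ x‖ ^ 2)).const_mul (1 / 2))).add
    (((h1.mul_const (2 * charge φ)).sub_const (2 * charge φ)).const_mul (E / 2))).add
    (((h1.mul_const (lpPow p φ)).sub_const (lpPow p φ)).const_mul (γ / (p + 2))) |>.add
    (h3.const_mul B)
  have h0 := IsLocalMin.hasDerivAt_eq_zero (Filter.Eventually.mono
    (Icc_mem_nhds (by norm_num : (1 / 2 : ℝ) < 1) one_lt_two) fun c hc => by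
      have := hB c hc
      simp only [one_pow, inv_one, one_mul, one_smul, sub_self, mul_zero]
      linarith) hder
  have hen := hφ.energy_identity hn hp hp' hVm hV
  simp only [one_pow, inv_one, one_mul, mul_one, mul_zero] at h0
  have e1 : γ / (p + 2) * (-(n : ℝ) * lpPow p φ) = -(γ * n / (p + 2)) * lpPow p φ := by ring
  have e2 : -γ * (n * p / (2 * p + 4)) * lpPow p φ
      = -(n / 2 * γ * lpPow p φ) + γ * n / (p + 2) * lpPow p φ := by
    have : 2 * p + 4 ≠ 0 := by linarith
    field_simp
    ring
  rw [e1] at h0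
  rw [e2]
  linear_combination h0 + (n : ℝ) / 2 * hen

end Pohozaev

/-! ### Bounds near a finite positive parameter -/

section FiniteParameter

variable {n : ℕ} {p γ : ℝ} {V : Space n → ℝ}

/-- On sets of finite measure this controls the `L²` norm by the `L^{p+2}` norm. -/
theorem sq_le_one_add_rpow {p : ℝ} (hp : 0 < p) {t : ℝ} (ht : 0 ≤ t) : t ^ 2 ≤ 1 + t ^ (p + 2) := by
  have h0 : 0 ≤ t ^ (p + 2) := by positivity
  rcases le_total t 1 with h | h
  · nlinarith
  · have : t ^ (2 : ℝ) ≤ t ^ (p + 2) := Real.rpow_le_rpow_of_exponent_le h (by linarith)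
    rw [Real.rpow_two] at this
    linarith

/-- As long as the parameter stays away from `0`, the charge and the kinetic energy of coherent
states are controlled by the `L^{p+2}` norm. -/
theorem exists_energy_le_lpPow (hn : 1 ≤ n) (hp : 0 < p)
    (hp' : 3 ≤ n → p < 4 / ((n : ℝ) - 2)) (hγ : γ < 0) (hVm : AEStronglyMeasurable V volume)
    (hV : HasFormBound V) (hVc : IsFormCompact V) {e : ℝ} (he : 0 < e) :
    ∃ K : ℝ, 0 ≤ K ∧ ∀ E : ℝ, e ≤ E → ∀ φ : H1 n, IsCoherentState V γ p E φ →
      charge φ ≤ K * (lpPow p φ + 1) ∧ gradSq φ ≤ K * (lpPow p φ + 1) := by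
  set ε := min (1 / 2) (e / 2) with hε
  have hε0 : 0 < ε := lt_min (by norm_num) (by linarith)
  have hε1 : ε ≤ 1 / 2 := min_le_left _ _
  have hε2 : ε ≤ e / 2 := min_le_right _ _
  obtain ⟨M, R, hM, hR, H⟩ := hVc ε hε0
  set v := volume.real (Metric.ball (0 : Space n) R) with hv
  have hv0 : 0 ≤ v := measureReal_nonneg
  have hA : 0 ≤ -γ + M + M * v := by
    have := mul_nonneg hM hv0
    linarith
  refine ⟨(2 + e⁻¹) * (-γ + M + M * v), by positivity, fun E hE φ hφ => ?_⟩
  have hS := H1.isSobolev φ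
  have hN := lpPow_nonneg p φ
  have hQ := charge_nonneg φ
  have hT := gradSq_nonneg φ
  have hen := hφ.energy_identity hn hp hp' hVm hV
  obtain ⟨i1, h1⟩ := H _ _ hS
  rw [sobolevSq_H1] at h1
  have hball : ∫ x in Metric.ball (0 : Space n) R, ‖H1.val φ x‖ ^ 2 ≤ v + lpPow p φ := by
    have iN := integrable_norm_rpow_add_two hn hp hp' hS
    have i1 : IntegrableOn (fun _ => (1 : ℝ)) (Metric.ball (0 : Space n) R) :=
      integrableOn_const Metric.isBounded_ball.measure_lt_top.ne
    calc _ ≤ ∫ x in Metric.ball (0 : Space n) R, (1 + ‖H1.val φ x‖ ^ (p + 2)) :=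
          setIntegral_mono hS.integrable_sq.integrableOn (i1.add iN.integrableOn)
            fun x => sq_le_one_add_rpow hp (norm_nonneg _)
      _ = v + ∫ x in Metric.ball (0 : Space n) R, ‖H1.val φ x‖ ^ (p + 2) := by
          rw [integral_add i1 iN.integrableOn]
          simp [hv]
      _ ≤ _ := by
          gcongr
          exact setIntegral_le_integral iN (.of_forall fun x => by positivity)
  have hVle : -∫ x, V x * ‖H1.val φ x‖ ^ 2 ≤ ∫ x, |V x| * ‖H1.val φ x‖ ^ 2 := by
    rw [← integral_neg]
    refine integral_mono (hV.integrable_mul hVm hS).neg i1 fun x => ?_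
    simp only
    rw [neg_mul_eq_neg_mul]
    exact mul_le_mul_of_nonneg_right (neg_le_abs _) (by positivity)
  have h2 := mul_le_mul_of_nonneg_left hball hM
  have h3 : ε * (2 * charge φ + gradSq φ) ≤ e * charge φ + 1 / 2 * gradSq φ := by
    nlinarith
  have h4 : e * charge φ ≤ E * charge φ := by gcongr
  have h5 : e * charge φ + 1 / 2 * gradSq φ ≤ (-γ + M + M * v) * (lpPow p φ + 1) := by
    have : 0 ≤ M * v * lpPow p φ := by positivity
    linarith
  have h6 : 0 ≤ (-γ + M + M * v) * (lpPow p φ + 1) := by positivity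
  have h7 : 0 ≤ e * charge φ := by positivity
  have h8 : 0 ≤ e⁻¹ * ((-γ + M + M * v) * (lpPow p φ + 1)) := by positivity
  constructor
  · have : charge φ ≤ e⁻¹ * ((-γ + M + M * v) * (lpPow p φ + 1)) := by
      rw [le_inv_mul_iff₀ he]
      linarith
    linarith
  · linarith

/-- A differential inequality `0 ≤ N' ≤ L (N + 1)` on an interval bounds `N` on bounded parts of the
interval, to the left by monotonicity and to the right by Grönwall's inequality. -/
theorem exists_bound_of_deriv_le {N N' : ℝ → ℝ} {J : Set ℝ} {L b : ℝ} (hJ : J.OrdConnected)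
    (hL : 0 ≤ L) (hb : ∀ E ∈ J, 0 < E ∧ E ≤ b) (hN : ∀ E ∈ J, 0 ≤ N E)
    (hd : ∀ E ∈ J, HasDerivAt N (N' E) E) (h0 : ∀ E ∈ J, 0 ≤ N' E)
    (h1 : ∀ E ∈ J, N' E ≤ L * (N E + 1)) : ∃ A : ℝ, ∀ E ∈ J, N E ≤ A := by
  rcases J.eq_empty_or_nonempty with rfl | ⟨E₀, hE₀⟩
  · exact ⟨0, by simp⟩
  have hconv : Convex ℝ J := hJ.convex
  have hmono : MonotoneOn N J := monotoneOn_of_hasDerivWithinAt_nonneg hconv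
    (fun E hE => (hd E hE).continuousAt.continuousWithinAt)
    (fun E hE => (hd E (interior_subset hE)).hasDerivWithinAt)
    (fun E hE => h0 E (interior_subset hE))
  have hd' : ∀ E ∈ J, HasDerivAt (fun E => (N E + 1) * Real.exp (-L * E))
      (N' E * Real.exp (-L * E) + (N E + 1) * (Real.exp (-L * E) * (-L))) E := by
    intro E hE
    have h2 : HasDerivAt (fun E => -L * E) (-L) E := by
      simpa using (hasDerivAt_id E).const_mul (-L)
    exact ((hd E hE).add_const 1).mul h2.exp
  have hanti : AntitoneOn (fun E => (N E + 1) * Real.exp (-L * E)) J :=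
    antitoneOn_of_hasDerivWithinAt_nonpos hconv
    (fun E hE => (hd' E hE).continuousAt.continuousWithinAt)
    (fun E hE => (hd' E (interior_subset hE)).hasDerivWithinAt)
    (fun E hE => by
      have h3 := h1 E (interior_subset hE)
      have h4 := Real.exp_pos (-L * E)
      nlinarith)
  have hA0 : 0 ≤ N E₀ := hN E₀ hE₀
  refine ⟨N E₀ + (N E₀ + 1) * Real.exp (L * b), fun E hE => ?_⟩
  have hpos : 0 ≤ (N E₀ + 1) * Real.exp (L * b) := by positivity
  rcases le_total E E₀ with h | h
  · have := hmono hE hE₀ h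
    linarith
  · have h2 := hanti hE₀ hE h
    simp only at h2
    have h3 : (N E + 1) = (N E + 1) * Real.exp (-L * E) * Real.exp (L * E) := by
      rw [mul_assoc, ← Real.exp_add]
      simp
    have h4 : Real.exp (-L * E₀) ≤ 1 := by
      rw [Real.exp_le_one_iff]
      nlinarith [(hb E₀ hE₀).1]
    have h5 : Real.exp (L * E) ≤ Real.exp (L * b) := by
      rw [Real.exp_le_exp]
      exact mul_le_mul_of_nonneg_left (hb E hE).2 hL
    have h6 : (N E + 1) * Real.exp (-L * E) ≤ N E₀ + 1 :=
      h2.trans (mul_le_of_le_one_right (by linarith) h4)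
    have h7 := mul_le_mul h6 h5 (Real.exp_pos _).le (by linarith)
    linarith

theorem norm_sq_H1 (φ : H1 n) : ‖φ‖ ^ 2 = 2 * charge φ + gradSq φ := by
  rw [norm_sq_eq_sobolevSq, sobolevSq_H1]

/-- Near a positive parameter, the `L^{p+2}` norm and the kinetic energy stay bounded along a
branch. -/
theorem IsC1Branch.exists_bound (hn : 1 ≤ n) (hp : 0 < p)
    (hp' : 3 ≤ n → p < 4 / ((n : ℝ) - 2)) (hγ : γ < 0) (hVm : AEStronglyMeasurable V volume)
    (hV : HasFormBound V) (hVc : IsFormCompact V) {I : Set ℝ} {φ : ℝ → H1 n}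
    (hb : IsC1Branch V γ p I φ) {Estar : ℝ} (hE : 0 < Estar) :
    ∃ A : ℝ, ∀ᶠ E in 𝓝[I] Estar, lpPow p (φ E) ≤ A ∧ gradSq (φ E) ≤ A := by
  obtain ⟨K, hK, H⟩ := exists_energy_le_lpPow hn hp hp' hγ hVm hV hVc (half_pos hE)
  set c := (2 * p + 4) / (-γ * p) with hc
  have hc0 : 0 ≤ c := div_nonneg (by linarith) (mul_pos (by linarith) hp).le
  set J := I ∩ Set.Ioo (Estar / 2) (2 * Estar) with hJ
  have hJI : ∀ E ∈ J, E ∈ I := fun E h => h.1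
  have hbd : ∀ E ∈ J, charge (φ E) ≤ K * (lpPow p (φ E) + 1) ∧
      gradSq (φ E) ≤ K * (lpPow p (φ E) + 1) := fun E h =>
    H E h.2.1.le (φ E) (hb.coherent E h.1)
  obtain ⟨A, hA⟩ := exists_bound_of_deriv_le (N := fun E => lpPow p (φ E))
    (N' := fun E => c * charge (φ E)) (J := J) (L := c * K) (b := 2 * Estar)
    (hb.ordConnected.inter Set.ordConnected_Ioo) (by positivity)
    (fun E h => ⟨by linarith [h.2.1], h.2.2.le⟩) (fun E _ => lpPow_nonneg p _)
    (fun E h => hb.hasDerivAt_lpPow hn hp hp' hγ hVm hV h.1)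
    (fun E _ => mul_nonneg hc0 (charge_nonneg _))
    (fun E h => by
      rw [mul_assoc]
      exact mul_le_mul_of_nonneg_left (hbd E h).1 hc0)
  refine ⟨max A (K * (A + 1)), ?_⟩
  have hmem : J ∈ 𝓝[I] Estar := inter_mem self_mem_nhdsWithin
    (mem_nhdsWithin_of_mem_nhds (Ioo_mem_nhds (by linarith) (by linarith)))
  filter_upwards [hmem] with E h
  refine ⟨(hA E h).trans (le_max_left _ _), (hbd E h).2.trans (le_trans ?_ (le_max_right _ _))⟩
  exact mul_le_mul_of_nonneg_left (add_le_add_left (hA E h) 1) hK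

end FiniteParameter

/-! ### Asymptotic identities for large parameters -/

section LargeParameter

variable {n : ℕ} {p γ : ℝ} {V W : Space n → ℝ}

/-- Two form bounded weights can be given a common rate. -/
theorem HasFormBound.exists_common (hV : HasFormBound V) (hW : HasFormBound W) :
    ∃ C κ : ℝ, 0 ≤ C ∧ 0 < κ ∧ ∀ m : ℝ, 1 ≤ m → ∀ φ : H1 n,
      |∫ x, V x * ‖H1.val φ x‖ ^ 2| ≤ C * (m * charge φ + m ^ (-κ) * (charge φ + gradSq φ)) ∧
      |∫ x, W x * ‖H1.val φ x‖ ^ 2| ≤ C * (m * charge φ + m ^ (-κ) * (charge φ + gradSq φ)) := by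
  obtain ⟨C, κ, hC, hκ, H⟩ := hV
  obtain ⟨C', κ', hC', hκ', H'⟩ := hW
  refine ⟨2 * (C + C'), min κ κ', by positivity, lt_min hκ hκ', fun m hm φ => ?_⟩
  have hQ := charge_nonneg φ
  have hT := gradSq_nonneg φ
  have habs : ∀ f : Space n → ℝ, |∫ x, f x * ‖H1.val φ x‖ ^ 2|
      ≤ ∫ x, |f x| * ‖H1.val φ x‖ ^ 2 := by
    intro f
    refine abs_integral_le_integral_abs.trans (le_of_eq (integral_congr_ae (.of_forall fun x => ?_)))
    simp only
    rw [abs_mul, abs_of_nonneg (by positivity : 0 ≤ ‖H1.val φ x‖ ^ 2)]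
  have hm0 : 0 < m := by linarith
  have key : ∀ D κ₀ : ℝ, 0 ≤ D → D ≤ C + C' → min κ κ' ≤ κ₀ →
      D * (m * (∫ x, ‖H1.val φ x‖ ^ 2) + m ^ (-κ₀) * sobolevSq (H1.val φ) (H1.grad φ))
      ≤ 2 * (C + C') * (m * charge φ + m ^ (-(min κ κ')) * (charge φ + gradSq φ)) := by
    intro D κ₀ hD hDC hκ₀
    rw [charge_eq, sobolevSq_H1]
    have h1 : m ^ (-κ₀) ≤ m ^ (-(min κ κ')) :=
      Real.rpow_le_rpow_of_exponent_le hm (by linarith)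
    have h2 : 0 ≤ m ^ (-κ₀) := by positivity
    have h3 : m ^ (-κ₀) * (2 * charge φ + gradSq φ)
        ≤ m ^ (-(min κ κ')) * (2 * (charge φ + gradSq φ)) := by
      refine mul_le_mul h1 (by linarith) (by positivity) (h2.trans h1)
    calc _ ≤ (C + C') * (m * (2 * charge φ) + m ^ (-(min κ κ')) * (2 * (charge φ + gradSq φ))) := by
          gcongr
      _ = _ := by ring
  exact ⟨(habs V).trans (((H m hm _ _ (H1.isSobolev φ)).2).trans
      (key C κ hC (by linarith) (min_le_left _ _))),
    (habs W).trans (((H' m hm _ _ (H1.isSobolev φ)).2).trans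
      (key C' κ' hC' (by linarith) (min_le_right _ _)))⟩

/-- For large parameters the potential is a lower order term, with a power rate in `E`; then the
energy and Pohozaev identities express the kinetic energy and the charge through the `L^{p+2}`
norm. -/
theorem exists_asymptotic_identities (hn : 1 ≤ n) (hp : 0 < p)
    (hp' : 3 ≤ n → p < 4 / ((n : ℝ) - 2)) (hγ : γ < 0) (hVm : AEStronglyMeasurable V volume)
    (hV : HasFormBound V) (hVc : IsFormCompact V)
    (hWm : AEStronglyMeasurable W volume) (hW : HasFormBound W) (hVW : IsRadialDerivative V W) :
    ∃ C δ E₀ : ℝ, 0 < δ ∧ 0 < E₀ ∧ ∀ E : ℝ, E₀ ≤ E → ∀ φ : H1 n, IsCoherentState V γ p E φ →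
      |gradSq φ - -γ * (n * p / (2 * p + 4)) * lpPow p φ| ≤ C * E ^ (-δ) * lpPow p φ ∧
      |2 * E * charge φ - -γ * (1 - n * p / (2 * p + 4)) * lpPow p φ|
        ≤ C * E ^ (-δ) * lpPow p φ := by
  obtain ⟨C, κ, hC, hκ, H⟩ := hV.exists_common hW
  set g := -γ with hg
  have hg0 : 0 < g := by linarith
  obtain ⟨m, hm, hm1⟩ : ∃ m : ℝ, 1 ≤ m ∧ C * m ^ (-κ) ≤ 1 / 2 := by
    have h1 : Tendsto (fun m : ℝ => C * m ^ (-κ)) atTop (𝓝 0) := by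
      simpa using (tendsto_rpow_neg_atTop hκ).const_mul C
    exact ((eventually_ge_atTop 1).and (h1.eventually_le_const (by norm_num))).exists
  have hCm : 0 ≤ C * m := by positivity
  set δ := min (1 / 2) (κ / 2) with hδ
  refine ⟨2 * (C * (6 * g)), δ, C * m + 1, lt_min (by norm_num) (by linarith), by linarith,
    fun E hE φ hφ => ?_⟩
  have hE1 : 1 ≤ E := by linarith
  have hE0 : 0 < E := by linarith
  have hN := lpPow_nonneg p φ
  have hQ := charge_nonneg φ
  have hT := gradSq_nonneg φ
  have hen := hφ.energy_identity hn hp hp' hVm hV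
  have hpo := hφ.pohozaev hn hp hp' hγ hE0 hVm hV hVc hWm hW hVW
  set IV := ∫ x, V x * ‖H1.val φ x‖ ^ 2 with hIV
  set IW := ∫ x, W x * ‖H1.val φ x‖ ^ 2 with hIW
  -- a rough bound, with a fixed `m`
  have hrough : 1 / 2 * gradSq φ + E * charge φ ≤ g * lpPow p φ := by
    have h1 := (abs_le.1 (H m hm φ).1).1
    have h2 : C * m ^ (-κ) * (charge φ + gradSq φ) ≤ 1 / 2 * (charge φ + gradSq φ) := by gcongr
    have h3 : (C * m + 1) * charge φ ≤ E * charge φ := by gcongr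
    rw [← hIV] at h1
    nlinarith
  have hQ' : E * charge φ ≤ g * lpPow p φ := by linarith
  have hT' : gradSq φ ≤ 2 * (g * lpPow p φ) := by
    have : 0 ≤ E * charge φ := by positivity
    linarith
  -- the refined bound, with `m = E^{1/2}`
  have hm2 : 1 ≤ E ^ (1 / 2 : ℝ) := Real.one_le_rpow hE1 (by norm_num)
  have hX : E ^ (1 / 2 : ℝ) * charge φ + (E ^ (1 / 2 : ℝ)) ^ (-κ) * (charge φ + gradSq φ)
      ≤ E ^ (-δ) * (6 * g * lpPow p φ) := by
    have a1 : E ^ (1 / 2 : ℝ) * charge φ ≤ E ^ (-δ) * (g * lpPow p φ) := by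
      have e1 : E ^ (1 / 2 : ℝ) = E ^ (-(1 / 2) : ℝ) * E := by
        rw [← Real.rpow_add_one hE0.ne']
        norm_num
      have e2 : E ^ (-(1 / 2) : ℝ) ≤ E ^ (-δ) :=
        Real.rpow_le_rpow_of_exponent_le hE1 (neg_le_neg (min_le_left _ _))
      rw [e1, mul_assoc]
      exact mul_le_mul e2 hQ' (by positivity) (by positivity)
    have a2 : (E ^ (1 / 2 : ℝ)) ^ (-κ) ≤ E ^ (-δ) := by
      rw [← Real.rpow_mul hE0.le]
      refine Real.rpow_le_rpow_of_exponent_le hE1 ?_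
      have : δ ≤ κ / 2 := min_le_right _ _
      linarith
    have a3 : charge φ ≤ E * charge φ := le_mul_of_one_le_left hQ hE1
    have a4 : charge φ + gradSq φ ≤ 3 * (g * lpPow p φ) := by linarith
    have a5 := mul_le_mul a2 a4 (by positivity) (by positivity)
    have a6 : 0 ≤ E ^ (-δ) * (g * lpPow p φ) := by positivity
    linarith
  have hX' := mul_le_mul_of_nonneg_left hX hC
  have hIV' := abs_le.1 ((H _ hm2 φ).1.trans hX')
  have hIW' := abs_le.1 ((H _ hm2 φ).2.trans hX')
  rw [← hIV] at hIV'
  rw [← hIW] at hIW'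
  have hgγ : γ = -g := by rw [hg, neg_neg]
  rw [hgγ] at hen
  set t := g * (n * p / (2 * p + 4)) * lpPow p φ with ht
  have et : g * (1 - n * p / (2 * p + 4)) * lpPow p φ = g * lpPow p φ - t := by
    rw [ht]
    ring
  have hY : 0 ≤ C * (E ^ (-δ) * (6 * g * lpPow p φ)) := by positivity
  have eY : 2 * (C * (6 * g)) * E ^ (-δ) * lpPow p φ
      = 2 * (C * (E ^ (-δ) * (6 * g * lpPow p φ))) := by ring
  rw [et, eY]
  constructor <;> rw [abs_le] <;> constructor <;> linarith

/-- A positive function whose logarithmic derivative is `s / E` up to an integrable power is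
asymptotic to a positive multiple of `E ^ s`. -/
theorem exists_tendsto_div_rpow {N N' : ℝ → ℝ} {s C δ E₀ : ℝ} (hE₀ : 0 < E₀) (hδ : 0 < δ)
    (hN : ∀ E, E₀ < E → 0 < N E) (hd : ∀ E, E₀ < E → HasDerivAt N (N' E) E)
    (hb : ∀ E, E₀ < E → |E * N' E - s * N E| ≤ C * E ^ (-δ) * N E) :
    ∃ b : ℝ, 0 < b ∧ Tendsto (fun E => N E / E ^ s) atTop (𝓝 b) := by
  set f : ℝ → ℝ := fun E => Real.log (N E) - s * Real.log E with hf
  have hder : ∀ E ∈ Set.Ioi E₀, HasDerivAt f (N' E / N E - s * E⁻¹) E := fun E hE =>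
    ((hd E hE).log (hN E hE).ne').sub
      ((Real.hasDerivAt_log (hE₀.trans hE).ne').const_mul s)
  have hder' : ∀ E ∈ Set.Ioi E₀, HasDerivAt f (deriv f E) E := fun E hE =>
    (hder E hE).differentiableAt.hasDerivAt
  have hint : IntegrableOn (deriv f) (Set.Ioi E₀) := by
    refine ((integrableOn_Ioi_rpow_of_lt (by linarith : -δ - 1 < -1) hE₀).const_mul C).mono'
      (measurable_deriv f).aestronglyMeasurable ?_
    filter_upwards [ae_restrict_mem measurableSet_Ioi] with E hE
    have hEp : 0 < E := hE₀.trans hE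
    have hNp := hN E hE
    rw [(hder E hE).deriv, Real.norm_eq_abs]
    have e : N' E / N E - s * E⁻¹ = (E * N' E - s * N E) / (E * N E) := by
      field_simp
    rw [e, abs_div, abs_of_pos (mul_pos hEp hNp), div_le_iff₀ (mul_pos hEp hNp)]
    refine (hb E hE).trans (le_of_eq ?_)
    rw [Real.rpow_sub_one hEp.ne']
    field_simp
  have hlim := tendsto_limUnder_of_hasDerivAt_of_integrableOn_Ioi hder' hint
  refine ⟨Real.exp (limUnder atTop f), Real.exp_pos _, ?_⟩
  refine ((Real.continuous_exp.tendsto _).comp hlim).congr' ?_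
  filter_upwards [eventually_gt_atTop E₀] with E hE
  have hEp : 0 < E := hE₀.trans hE
  simp only [Function.comp_apply, hf]
  rw [Real.exp_sub, Real.exp_log (hN E hE), Real.rpow_def_of_pos hEp, mul_comm s]

/-- If `|X - a N| = o(N)` and `N ∼ b E^s`, then `X ∼ a b E^s`. -/
theorem tendsto_div_of_abs_sub_le {X N D : ℝ → ℝ} {a b C δ : ℝ} (hδ : 0 < δ)
    (hD : ∀ᶠ E in atTop, 0 < D E) (hN : Tendsto (fun E => N E / D E) atTop (𝓝 b))
    (h : ∀ᶠ E in atTop, |X E - a * N E| ≤ C * E ^ (-δ) * N E) :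
    Tendsto (fun E => X E / D E) atTop (𝓝 (a * b)) := by
  have h1 : Tendsto (fun E => C * E ^ (-δ) * (N E / D E)) atTop (𝓝 0) := by
    simpa using ((tendsto_rpow_neg_atTop hδ).const_mul C).mul hN
  have h2 : Tendsto (fun E => X E / D E - a * (N E / D E)) atTop (𝓝 0) := by
    refine squeeze_zero_norm' ?_ h1
    filter_upwards [h, hD] with E hE hDE
    have e : X E / D E - a * (N E / D E) = (X E - a * N E) / D E := by ring
    rw [e, Real.norm_eq_abs, abs_div, abs_of_pos hDE, ← mul_div_assoc]
    gcongr
  have h3 := h2.add (hN.const_mul a)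
  rw [zero_add] at h3
  exact h3.congr fun E => by ring

end LargeParameter

/-! ### Asymptotics along branches -/

section Asymptotics

variable {n : ℕ} {p γ : ℝ} {V W : Space n → ℝ}

/-- Since the kinetic energy stays bounded, only the charge can carry a divergence of the `H¹`
norm. -/
theorem IsC1Branch.tendsto_charge (hn : 1 ≤ n) (hp : 0 < p)
    (hp' : 3 ≤ n → p < 4 / ((n : ℝ) - 2)) (hγ : γ < 0) (hVm : AEStronglyMeasurable V volume)
    (hV : HasFormBound V) (hVc : IsFormCompact V) {I : Set ℝ} {φ : ℝ → H1 n}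
    (hb : IsC1Branch V γ p I φ) {Estar : ℝ} (hE : 0 < Estar)
    (hnorm : Tendsto (fun E => ‖φ E‖) (𝓝[I] Estar) atTop) :
    Tendsto (fun E => charge (φ E)) (𝓝[I] Estar) atTop ∧
      Tendsto (fun E => lpPow p (φ E) / charge (φ E)) (𝓝[I] Estar) (𝓝 0) := by
  obtain ⟨A, hA⟩ := hb.exists_bound hn hp hp' hγ hVm hV hVc hE
  have h1 : Tendsto (fun E => ‖φ E‖ ^ 2) (𝓝[I] Estar) atTop :=
    (tendsto_pow_atTop two_ne_zero).comp hnorm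
  have h2 : Tendsto (fun E => (1 / 2) * (‖φ E‖ ^ 2 + -A)) (𝓝[I] Estar) atTop :=
    (tendsto_atTop_add_const_right _ (-A) h1).const_mul_atTop (by norm_num)
  have hQ : Tendsto (fun E => charge (φ E)) (𝓝[I] Estar) atTop := by
    refine tendsto_atTop_mono' _ ?_ h2
    filter_upwards [hA] with E h
    have h3 := norm_sq_H1 (φ E)
    linarith [h.2]
  refine ⟨hQ, ?_⟩
  refine squeeze_zero' (.of_forall fun E => div_nonneg (lpPow_nonneg p _) (charge_nonneg _)) ?_
    (hQ.const_div_atTop A)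
  filter_upwards [hA] with E h
  exact div_le_div_of_nonneg_right h.1 (charge_nonneg _)

/-- Asymptotics along a branch over a half line. -/
theorem IsC1Branch.exists_asymptotics (hn : 1 ≤ n) (hp : 0 < p)
    (hp' : 3 ≤ n → p < 4 / ((n : ℝ) - 2)) (hγ : γ < 0) (hVm : AEStronglyMeasurable V volume)
    (hV : HasFormBound V) (hVc : IsFormCompact V)
    (hWm : AEStronglyMeasurable W volume) (hW : HasFormBound W) (hVW : IsRadialDerivative V W)
    {E₁ : ℝ} {φ : ℝ → H1 n} (hb : IsC1Branch V γ p (Set.Ioi E₁) φ)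
    (hne : ¬ ∀ᶠ E in atTop, φ E = 0) :
    ∃ b : ℝ, 0 < b ∧
      Tendsto (fun E => lpPow p (φ E) / E ^ (2 / p + 1 - (n : ℝ) / 2)) atTop (𝓝 b) ∧
      Tendsto (fun E => charge (φ E) / E ^ (2 / p - (n : ℝ) / 2)) atTop
        (𝓝 (-γ * ((2 - (n : ℝ)) * p + 4) / (4 * p + 8) * b)) ∧
      Tendsto (fun E => gradSq (φ E) / E ^ (2 / p + 1 - (n : ℝ) / 2)) atTop
        (𝓝 (-γ * ((n : ℝ) * p * b) / (2 * p + 4))) := by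
  obtain ⟨C, δ, E₀, hδ, hE₀, H⟩ :=
    exists_asymptotic_identities hn hp hp' hγ hVm hV hVc hWm hW hVW
  have hp4 : 2 * p + 4 ≠ 0 := by linarith
  have hγ0 := hγ.ne
  have hp0 := hp.ne'
  have hc0 : 0 < (2 * p + 4) / (-γ * p) := div_pos (by linarith) (mul_pos (by linarith) hp)
  have hder := fun E (hE : E ∈ Set.Ioi E₁) => hb.hasDerivAt_lpPow hn hp hp' hγ hVm hV hE
  have hmono : MonotoneOn (fun E => lpPow p (φ E)) (Set.Ioi E₁) :=
    monotoneOn_of_hasDerivWithinAt_nonneg (convex_Ioi E₁)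
      (fun E hE => (hder E hE).continuousAt.continuousWithinAt)
      (fun E hE => (hder E (interior_subset hE)).hasDerivWithinAt)
      (fun E _ => mul_nonneg hc0.le (charge_nonneg _))
  -- a single non-zero state at a large parameter makes the `L^{p+2}` norm positive from there on
  obtain ⟨E₂, hE₂, hpos⟩ : ∃ E₂, max E₀ E₁ < E₂ ∧ 0 < lpPow p (φ E₂) := by
    obtain ⟨E₂, h2, hE₂⟩ := ((not_eventually.1 hne).and_eventually
      (eventually_gt_atTop (max E₀ E₁))).exists
    refine ⟨E₂, hE₂, (lpPow_nonneg p _).lt_of_ne fun h0 => h2 ?_⟩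
    have h3 := H E₂ ((le_max_left _ _).trans hE₂.le) (φ E₂)
      (hb.coherent E₂ ((le_max_right _ _).trans_lt hE₂))
    simp only [← h0, mul_zero, sub_zero] at h3
    have hE₂0 : 0 < E₂ := hE₀.trans ((le_max_left _ _).trans_lt hE₂)
    have hT : gradSq (φ E₂) = 0 := abs_nonpos_iff.1 h3.1
    have hQ : charge (φ E₂) = 0 := by
      have := abs_nonpos_iff.1 h3.2
      simpa [hE₂0.ne'] using this
    have h4 := norm_sq_H1 (φ E₂)
    rw [hT, hQ, mul_zero, add_zero] at h4
    exact norm_eq_zero.1 (pow_eq_zero_iff two_ne_zero |>.1 h4)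
  have hE₂0 : 0 < E₂ := hE₀.trans ((le_max_left _ _).trans_lt hE₂)
  have hmem : ∀ E, E₂ < E → E₀ ≤ E ∧ E ∈ Set.Ioi E₁ := fun E hE =>
    ⟨((le_max_left _ _).trans hE₂.le).trans hE.le, ((le_max_right _ _).trans_lt hE₂).trans hE⟩
  have hNpos : ∀ E, E₂ < E → 0 < lpPow p (φ E) := fun E hE =>
    hpos.trans_le (hmono ((le_max_right _ _).trans_lt hE₂ : E₁ < E₂) (hmem E hE).2 hE.le)
  obtain ⟨b, hb0, hlim⟩ := exists_tendsto_div_rpow (N := fun E => lpPow p (φ E))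
    (N' := fun E => (2 * p + 4) / (-γ * p) * charge (φ E)) (s := 2 / p + 1 - (n : ℝ) / 2)
    (C := (p + 2) / (-γ * p) * C) hE₂0 hδ hNpos (fun E hE => hder E (hmem E hE).2)
    (fun E hE => by
      have h1 := (H E (hmem E hE).1 (φ E) (hb.coherent E (hmem E hE).2)).2
      have hc1 : 0 < (p + 2) / (-γ * p) := div_pos (by linarith) (mul_pos (by linarith) hp)
      have e : E * ((2 * p + 4) / (-γ * p) * charge (φ E))
          - (2 / p + 1 - (n : ℝ) / 2) * lpPow p (φ E)
          = (p + 2) / (-γ * p) * (2 * E * charge (φ E)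
            - -γ * (1 - n * p / (2 * p + 4)) * lpPow p (φ E)) := by
        field_simp
        ring
      rw [e, abs_mul, abs_of_pos hc1]
      refine (mul_le_mul_of_nonneg_left h1 hc1.le).trans (le_of_eq ?_)
      ring)
  have hD : ∀ᶠ E : ℝ in atTop, 0 < E ^ (2 / p + 1 - (n : ℝ) / 2) :=
    (eventually_gt_atTop 0).mono fun E hE => Real.rpow_pos_of_pos hE _
  have hT := tendsto_div_of_abs_sub_le (X := fun E => gradSq (φ E)) hδ hD hlim
    ((eventually_gt_atTop E₂).mono fun E hE =>
      (H E (hmem E hE).1 (φ E) (hb.coherent E (hmem E hE).2)).1)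
  have hQ := tendsto_div_of_abs_sub_le (X := fun E => 2 * E * charge (φ E)) hδ hD hlim
    ((eventually_gt_atTop E₂).mono fun E hE =>
      (H E (hmem E hE).1 (φ E) (hb.coherent E (hmem E hE).2)).2)
  refine ⟨b, hb0, hlim, ?_, ?_⟩
  · have h1 := hQ.const_mul (1 / 2)
    have e : 1 / 2 * (-γ * (1 - n * p / (2 * p + 4)) * b)
        = -γ * ((2 - (n : ℝ)) * p + 4) / (4 * p + 8) * b := by
      have : 4 * p + 8 ≠ 0 := by linarith
      field_simp
      ring
    rw [e] at h1
    refine h1.congr' ?_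
    filter_upwards [eventually_gt_atTop 0] with E hE
    have e2 : (2 / p + 1 - (n : ℝ) / 2) = 2 / p - (n : ℝ) / 2 + 1 := by ring
    have := (Real.rpow_pos_of_pos hE (2 / p - (n : ℝ) / 2)).ne'
    rw [e2, Real.rpow_add_one hE.ne']
    field_simp
  · refine hT.trans (le_of_eq ?_)
    congr 1
    ring

end Asymptotics

theorem theorem4 (n : ℕ) (hn : 1 ≤ n) (p γ q : ℝ)
    (hp : 0 < p) (hp' : 3 ≤ n → p < 4 / ((n : ℝ) - 2))
    (hγ : γ < 0)
    (hq : 1 ≤ q) (hq' : (n : ℝ) / 2 < q)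
    (V : Space n → ℝ) (hV : MemLqAddLinfty q V)
    (hV0 : Tendsto V (cocompact (Space n)) (𝓝 0)) :
    (∀ (I : Set ℝ) (φ : ℝ → H1 n) (Estar : ℝ), IsC1Branch V γ p I φ →
        0 < Estar → Estar ∈ closure I →
        Tendsto (fun E => ‖φ E‖) (𝓝[I] Estar) atTop →
        Tendsto (fun E => charge (φ E)) (𝓝[I] Estar) atTop ∧
        Tendsto (fun E => lpPow p (φ E) / charge (φ E)) (𝓝[I] Estar) (𝓝 0)) ∧
    ((∃ (r : ℝ) (W : Space n → ℝ), 1 ≤ r ∧ (n : ℝ) / 2 < r ∧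
        IsRadialDerivative V W ∧ MemLqAddLinfty r W) →
      ∀ (E₁ : ℝ) (φ : ℝ → H1 n), IsC1Branch V γ p (Set.Ioi E₁) φ →
        (¬ ∀ᶠ E in atTop, φ E = 0) →
        ∃ b : ℝ, 0 < b ∧
          Tendsto (fun E => lpPow p (φ E) / E ^ (2 / p + 1 - (n : ℝ) / 2)) atTop (𝓝 b) ∧
          Tendsto (fun E => charge (φ E) / E ^ (2 / p - (n : ℝ) / 2)) atTop
            (𝓝 (-γ * ((2 - (n : ℝ)) * p + 4) / (4 * p + 8) * b)) ∧
          Tendsto (fun E => gradSq (φ E) / E ^ (2 / p + 1 - (n : ℝ) / 2)) atTop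
            (𝓝 (-γ * ((n : ℝ) * p * b) / (2 * p + 4)))) := by
  have hVm := hV.aestronglyMeasurable
  have hVf := hV.hasFormBound hn hq hq'
  have hVc := hV.isFormCompact hn hq hq' hV0
  constructor
  · intro I φ Estar hb hE _ hnorm
    exact hb.tendsto_charge hn hp hp' hγ hVm hVf hVc hE hnorm
  · rintro ⟨r, W, hr, hr', hVW, hW⟩ E₁ φ hb hne
    exact hb.exists_asymptotics hn hp hp' hγ hVm hVf hVc hW.aestronglyMeasurable
      (hW.hasFormBound hn hr hr') hVW hne
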